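/- For $f:\mathbb R\to\mathbb C$ let $\widehat f(\xi)=(2\pi)^{-1/2}\int_{\mathbb R}f(x)e^{-ix\xi}\,dx$ (extended to $L^2$ by Plancherel), $\langle\xi\rangle=(1+\xi^2)^{1/2}$ and $\|f\|_{H^s}=\|\langle\xi\rangle^s\widehat f\,\|_{L^2}$. Let $S(t)=e^{it\partial_{xx}}$ and $K(t)=e^{-t\partial_{xxx}}$, i.e. the Fourier multipliers with symbols $e^{-it\xi^2}$ and $e^{it\xi^3}$, and let $$\mathscr A(f)(t)=\int_0^tS(t-t')f(t')\,dt',\qquad \mathscr B(g)(t)=\int_0^t\partial_xK(t-t')g(t')\,dt'.$$ **Lemma 2.1.** Let $s_1,s_2\in\mathbb R$. Each of the inequalities (1)–(4) below is said to hold if there is a constant $C$, depending only on $s_1,s_2$, for which it is valid for all complex-valued Schwartz functions $u_0,v_0\in\mathcal S(\mathbb R)$. 1. $\|\mathscr A(|S(t)u_0|^2S(t)u_0)(1)\|_{H^{s_1}}\le C\|u_0\|_{H^{s_1}}^3$ holds if and only if $s_1\ge 0$. 2. $\|\mathscr A(S(t)u_0\,K(t)v_0)(1)\|_{H^{s_1}}\le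 C\|u_0\|_{H^{s_1}}\|v_0\|_{H^{s_2}}$ holds if and only if $s_2\ge\max\{-1,-3+|s_1|\}$. 3. $\|\mathscr B((K(t)v_0)^2)(1)\|_{H^{s_2}}\le C\|v_0\|_{H^{s_2}}^2$ holds if and only if $s_2\ge -1$. 4. $\|\mathscr B(|S(t)u_0|^2)(1)\|_{H^{s_2}}\le C\|u_0\|_{H^{s_1}}^2$ holds if and only if $s_1\ge -\tfrac12$ and $s_2\le\min\{4s_1,s_1+2\}$. -/

import Mathlib

open MeasureTheory FourierTransform
open scoped SchwartzMap ENNReal NNReal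

noncomputable section

namespace SKdV

/-- The space `L²(ℝ; ℂ)`. -/
abbrev L2 : Type := Lp ℂ 2 (volume : Measure ℝ)

/-- The norm `‖F‖_{H^s} = ‖J^s F‖_{L²}`, `J = (1 - ∂ₓₓ)^{1/2}`, of a function `F ∈ L²(ℝ)`, with
value `∞` if `F ∉ H^s`. Mathlib's Fourier transform is `𝓕 F(ξ) = ∫ F(x) e^{-2πixξ} dx` (extended to
`L²` by Plancherel), so the frequency dual to `x` is `2πξ`; with `η = 2πξ` this is
`(∫ ⟨η⟩^{2s} |F̂(η)|² dη)^{1/2}` for the unitary transform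
`F̂(η) = (2π)^{-1/2} ∫ F(x) e^{-ixη} dx`. -/
def hsNorm (s : ℝ) (F : L2) : ℝ≥0∞ :=
  eLpNorm (fun ξ : ℝ ↦ (((1 + (2 * Real.pi * ξ) ^ 2) ^ (s / 2) : ℝ) : ℂ) * (𝓕 F : L2) ξ) 2 volume

/-- The symbol `e^{-itη²}`, `η = 2πξ`, of `e^{it∂ₓₓ}`. -/
def schrodingerSymbol (t ξ : ℝ) : ℂ :=
  Complex.exp (((-t * (2 * Real.pi * ξ) ^ 2 : ℝ) : ℂ) * Complex.I)

/-- The symbol `e^{itη³}`, `η = 2πξ`, of `e^{-t∂ₓₓₓ}`. -/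
def airySymbol (t ξ : ℝ) : ℂ :=
  Complex.exp (((t * (2 * Real.pi * ξ) ^ 3 : ℝ) : ℂ) * Complex.I)

/-- `S(t) = e^{it∂ₓₓ}` on Schwartz functions. -/
def S (t : ℝ) : 𝓢(ℝ, ℂ) →L[ℂ] 𝓢(ℝ, ℂ) :=
  SchwartzMap.fourierMultiplierCLM ℂ (schrodingerSymbol t)

/-- `K(t) = e^{-t∂ₓₓₓ}` on Schwartz functions. -/
def K (t : ℝ) : 𝓢(ℝ, ℂ) →L[ℂ] 𝓢(ℝ, ℂ) :=
  SchwartzMap.fourierMultiplierCLM ℂ (airySymbol t)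

/-- The pointwise product of Schwartz functions. -/
def mul (f g : 𝓢(ℝ, ℂ)) : 𝓢(ℝ, ℂ) :=
  SchwartzMap.pairing (ContinuousLinearMap.mul ℂ ℂ) f g

/-- The pointwise complex conjugate of a Schwartz function. -/
def conj (f : 𝓢(ℝ, ℂ)) : 𝓢(ℝ, ℂ) :=
  SchwartzMap.postcompCLM (𝕜 := ℝ) (Complex.conjCLE : ℂ →L[ℝ] ℂ) f

/-- `|f|² = f f̄`. -/
def absSq (f : 𝓢(ℝ, ℂ)) : 𝓢(ℝ, ℂ) := mul f (conj f)

/-- The Duhamel operator `𝒜(f)(t) = ∫₀ᵗ S(t - t') f(t') dt'`, an integral in `L²(ℝ)`. -/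
def duhamelS (f : ℝ → 𝓢(ℝ, ℂ)) (t : ℝ) : L2 :=
  ∫ t' in (0 : ℝ)..t, (S (t - t') (f t')).toLp 2

/-- The Duhamel operator `ℬ(g)(t) = ∫₀ᵗ ∂ₓ K(t - t') g(t') dt'`, an integral in `L²(ℝ)`. -/
def duhamelK (g : ℝ → 𝓢(ℝ, ℂ)) (t : ℝ) : L2 :=
  ∫ t' in (0 : ℝ)..t, (SchwartzMap.derivCLM ℂ ℂ (K (t - t') (g t'))).toLp 2

theorem mul_apply (f g : 𝓢(ℝ, ℂ)) (x : ℝ) : mul f g x = f x * g x := rfl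

theorem conj_apply (f : 𝓢(ℝ, ℂ)) (x : ℝ) : conj f x = (starRingEnd ℂ) (f x) := rfl

theorem absSq_apply (f : 𝓢(ℝ, ℂ)) (x : ℝ) : absSq f x = ((‖f x‖ ^ 2 : ℝ) : ℂ) := by
  rw [absSq, mul_apply, conj_apply, Complex.mul_conj, Complex.normSq_eq_norm_sq]

theorem hasTemperateGrowth_expI :
    (fun x : ℝ ↦ Complex.exp ((x : ℂ) * Complex.I)).HasTemperateGrowth := by
  have hd : ∀ n : ℕ, iteratedDeriv n (fun x : ℝ ↦ Complex.exp ((x : ℂ) * Complex.I)) =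
      fun x : ℝ ↦ Complex.I ^ n * Complex.exp ((x : ℂ) * Complex.I) := by
    intro n
    induction n with
    | zero => simp
    | succ n ih =>
      rw [iteratedDeriv_succ, ih]
      funext x
      have h1 : HasDerivAt (fun x : ℝ ↦ (x : ℂ) * Complex.I) (1 * Complex.I) x :=
        (Complex.ofRealCLM.hasDerivAt (x := x)).mul_const Complex.I
      have h2 := (h1.cexp.const_mul (Complex.I ^ n)).deriv
      rw [h2]
      ring
  refine ⟨?_, fun n ↦ ⟨0, 1, fun x ↦ ?_⟩⟩
  · exact (Complex.ofRealCLM.contDiff.mul contDiff_const).cexp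
  · rw [norm_iteratedFDeriv_eq_norm_iteratedDeriv, hd]
    simp [Complex.norm_exp_ofReal_mul_I]

theorem schrodingerSymbol_hasTemperateGrowth (t : ℝ) :
    (schrodingerSymbol t).HasTemperateGrowth := by
  have h : (fun ξ : ℝ ↦ -t * (2 * Real.pi * ξ) ^ 2).HasTemperateGrowth := by fun_prop
  exact hasTemperateGrowth_expI.comp h

theorem airySymbol_hasTemperateGrowth (t : ℝ) : (airySymbol t).HasTemperateGrowth := by
  have h : (fun ξ : ℝ ↦ t * (2 * Real.pi * ξ) ^ 3).HasTemperateGrowth := by fun_prop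
  exact hasTemperateGrowth_expI.comp h

/-- `S(t)` is the Fourier multiplier with symbol `e^{-itη²}`. -/
theorem fourier_S (t : ℝ) (f : 𝓢(ℝ, ℂ)) (ξ : ℝ) :
    𝓕 (S t f) ξ = schrodingerSymbol t ξ * 𝓕 f ξ := by
  rw [S, SchwartzMap.fourierMultiplierCLM_apply, FourierTransform.fourier_fourierInv_eq,
    SchwartzMap.smulLeftCLM_apply_apply (schrodingerSymbol_hasTemperateGrowth t), smul_eq_mul]

/-- `K(t)` is the Fourier multiplier with symbol `e^{itη³}`. -/
theorem fourier_K (t : ℝ) (f : 𝓢(ℝ, ℂ)) (ξ : ℝ) :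
    𝓕 (K t f) ξ = airySymbol t ξ * 𝓕 f ξ := by
  rw [K, SchwartzMap.fourierMultiplierCLM_apply, FourierTransform.fourier_fourierInv_eq,
    SchwartzMap.smulLeftCLM_apply_apply (airySymbol_hasTemperateGrowth t), smul_eq_mul]

end SKdV

end

/-!
In the angular frequency `η = 2πξ` the Fourier transform of each Duhamel term at time `1` is, up
to a unimodular factor and a numerical constant, a multilinear integral over the input frequencies
in which integration in time leaves the factor `osc Φ = ∫₀¹ e^{itΦ} dt`. Here `Φ` is the resonance
function: it equals `2 y (η - x)` for the cubic term with input frequencies `x`, `x - y`, `η - y`,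
`k (2η - k + k²)` for the mixed term with Airy frequency `k`, `-3 η y (η - y)` for the square of
the Airy flow, and `-η (η² - η + 2y)` for the density. As the map `u ↦ û` is onto the Schwartz
space, each inequality becomes an inequality between weighted `L²` energies of these forms
(`cubic_bound_iff`, `mixed_bound_iff`, `kdv_bound_iff`, `density_bound_iff`).

Sufficiency uses only `|osc Φ| ≤ 1` and `|osc Φ|² ≤ 8 / (1 + Φ²)`. For the bilinear terms,
`exists_energy_bilinear_le` reduces the bound, by Cauchy–Schwarz, to splitting the weighted
squared kernel into a part integrable in the input frequency uniformly in the output frequency and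
a part with the roles exchanged. Away from resonance the kernel is bounded by the integrable
weight `rho`. Near resonance it concentrates where `Φ` vanishes; it is bounded there by rescaled
Cauchy kernels centred at the zeros of `Φ`, each of which has integral `π` whatever its width
(`resonant_le_resKernel`, `kdv_low_le`). For the cubic term the phase factors, so the kernel is
bounded by integrable functions of either factor, and `lintegral_trilinear_sq_le` applies the same
idea.

Necessity tests the inequalities on bumps with nonnegative Fourier transform, in two regimes that
both avoid cancellation between frequencies. If `|Φ| ≤ 1` on the support, then `Re (osc Φ) ≥ 1/2`
(`norm_integral_osc_ge_of_abs_le`); bumps of width `N⁻¹` and `N⁻²` at a zero of `Φ` give the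
conditions `s₂ ≥ -1` of the mixed term and `s₂ ≤ 4 s₁`, and a bump of fixed width gives `s₁ ≥ 0`.
If `Φ` has constant sign on the support, then so has `Im (osc Φ) = (1 - cos Φ) / Φ`
(`norm_integral_osc_ge_of_pos`), and since `Φ` varies fast with the output frequency, `1 - cos Φ`
is bounded below on average (`le_energy_of_phase`); unit bumps give the remaining conditions. In
each case the inequality compares two powers of `1 + N²` and `le_of_forall_rpow_le` orders the
exponents.
-/

namespace SKdV

/-! ### The time factor of a Duhamel term -/

/-- The oscillatory factor `∫₀¹ e^{itΦ} dt` produced by integrating a Duhamel term in time. -/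
noncomputable def osc (Φ : ℝ) : ℂ :=
  ∫ t in (0 : ℝ)..1, Complex.exp (((t * Φ : ℝ) : ℂ) * Complex.I)

/-- Time integration commutes with evaluation in frequency: an `L²`-valued Bochner integral is
almost everywhere given by the pointwise integral, under a domination hypothesis. -/
theorem coeFn_intervalIntegral_ae_eq {G : ℝ → L2} {h : ℝ → ℝ → ℂ} {H : ℝ → ℝ}
    (hG : ∀ t, G t =ᵐ[volume] h t) (hm : StronglyMeasurable (Function.uncurry h))
    (hH : MemLp H 2 volume) (hb : ∀ t ξ, ‖h t ξ‖ ≤ H ξ) (hc : ∀ ξ, Continuous fun t ↦ h t ξ) :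
    ((∫ t in (0 : ℝ)..1, G t : L2) : ℝ → ℂ) =ᵐ[volume] fun ξ ↦ ∫ t in (0 : ℝ)..1, h t ξ := by
  have hmt : ∀ t, StronglyMeasurable (h t) := fun t ↦
    hm.comp_measurable (measurable_prodMk_left)
  have hcont : Continuous G := by
    rw [continuous_iff_continuousAt]
    intro t₀
    rw [ContinuousAt, Lp.tendsto_Lp_iff_tendsto_eLpNorm']
    have hlim : Filter.Tendsto (fun t ↦ ∫⁻ ξ, ‖h t ξ - h t₀ ξ‖ₑ ^ (2 : ℝ)) (nhds t₀) (nhds 0) := by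
      have := tendsto_lintegral_filter_of_dominated_convergence (μ := (volume : Measure ℝ))
        (l := nhds t₀) (F := fun t ξ ↦ ‖h t ξ - h t₀ ξ‖ₑ ^ (2 : ℝ)) (f := fun _ ↦ 0)
        (fun ξ ↦ ‖2 * H ξ‖ₑ ^ (2 : ℝ))
        (Filter.Eventually.of_forall fun t ↦
          (((hmt t).sub (hmt t₀)).enorm.pow_const 2))
        (Filter.Eventually.of_forall fun t ↦ Filter.Eventually.of_forall fun ξ ↦ by
          refine ENNReal.rpow_le_rpow ?_ (by norm_num)
          rw [enorm_le_iff_norm_le]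
          calc ‖h t ξ - h t₀ ξ‖ ≤ ‖h t ξ‖ + ‖h t₀ ξ‖ := norm_sub_le _ _
            _ ≤ 2 * H ξ := by linarith [hb t ξ, hb t₀ ξ]
            _ ≤ ‖2 * H ξ‖ := le_abs_self _)
        (by
          have := (hH.const_mul 2).eLpNorm_lt_top
          rw [eLpNorm_lt_top_iff_lintegral_rpow_enorm_lt_top (by norm_num) (by norm_num)] at this
          simpa using this.ne)
        (Filter.Eventually.of_forall fun ξ ↦ by
          have h1 : Filter.Tendsto (fun t ↦ h t ξ - h t₀ ξ) (nhds t₀) (nhds 0) := by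
            have := ((hc ξ).tendsto t₀).sub_const (h t₀ ξ)
            simpa using this
          have h2 := h1.enorm
          have h3 := (ENNReal.continuous_rpow_const (y := 2)).tendsto (‖(0 : ℂ)‖ₑ) |>.comp h2
          simpa [Function.comp_def] using h3)
      simpa using this
    have heq : ∀ t, eLpNorm (⇑(G t) - ⇑(G t₀)) 2 volume
        = (∫⁻ ξ, ‖h t ξ - h t₀ ξ‖ₑ ^ (2 : ℝ)) ^ (1 / (2 : ℝ)) := by
      intro t
      rw [eLpNorm_congr_ae ((hG t).sub (hG t₀)),
        eLpNorm_eq_lintegral_rpow_enorm_toReal (by norm_num) (by norm_num)]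
      simp
    simp_rw [heq]
    have h3 := (ENNReal.continuous_rpow_const (y := 1 / 2)).tendsto 0 |>.comp hlim
    simpa [Function.comp_def] using h3
  have hHs : ∀ s : Set ℝ, volume s < ∞ → IntegrableOn H s := fun s hs ↦ by
    have : IsFiniteMeasure (volume.restrict s) := ⟨by simpa using hs⟩
    exact (hH.restrict s).integrable (by norm_num)
  have hprod : ∀ s : Set ℝ, volume s < ∞ →
      Integrable (fun p : ℝ × ℝ ↦ h p.2 p.1)
        ((volume.restrict s).prod (volume.restrict (Set.Ioc (0 : ℝ) 1))) := fun s hs ↦ by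
    have : IsFiniteMeasure (volume.restrict s) := ⟨by simpa using hs⟩
    have hHi : Integrable (fun p : ℝ × ℝ ↦ H p.1)
        ((volume.restrict s).prod (volume.restrict (Set.Ioc (0 : ℝ) 1))) :=
      (hHs s hs).comp_fst _
    refine hHi.mono (hm.comp_measurable measurable_swap).aestronglyMeasurable
      (Filter.Eventually.of_forall fun p ↦ (hb _ _).trans (le_abs_self _))
  refine ae_eq_of_forall_setIntegral_eq_of_sigmaFinite ?_ ?_ ?_
  · intro s hs hfin
    have : IsFiniteMeasure (volume.restrict s) := ⟨by simpa using hfin⟩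
    exact ((Lp.memLp _).restrict s).integrable (by norm_num)
  · intro s hs hfin
    have := (hprod s hfin).integral_prod_left
    simpa [IntegrableOn, intervalIntegral.integral_of_le] using this
  · intro s hs hfin
    have e1 : ∀ F : L2, ∫ ξ in s, F ξ = innerSL ℂ (indicatorConstLp 2 hs hfin.ne (1 : ℂ)) F := by
      intro F
      rw [innerSL_apply_apply, L2.inner_indicatorConstLp_one]
    rw [e1, ← ContinuousLinearMap.intervalIntegral_comp_comm _ (hcont.intervalIntegrable _ _)]
    simp_rw [← e1]
    have e2 : ∀ t, ∫ ξ in s, G t ξ = ∫ ξ in s, h t ξ := fun t ↦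
      integral_congr_ae (ae_restrict_of_ae (hG t))
    simp_rw [e2, intervalIntegral.integral_of_le zero_le_one]
    refine (integral_integral_swap ?_).symm
    exact hprod s hfin

theorem norm_phase (a : ℝ) : ‖Complex.exp ((a : ℂ) * Complex.I)‖ = 1 :=
  Complex.norm_exp_ofReal_mul_I a

theorem continuous_osc : Continuous osc := by
  unfold osc
  apply intervalIntegral.continuous_parametric_intervalIntegral_of_continuous'
  fun_prop

theorem norm_osc_le_one (Φ : ℝ) : ‖osc Φ‖ ≤ 1 := by
  have := intervalIntegral.norm_integral_le_of_norm_le_const (a := 0) (b := 1) (C := 1)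
    (f := fun t : ℝ ↦ Complex.exp (((t * Φ : ℝ) : ℂ) * Complex.I))
    (fun t _ ↦ (norm_phase _).le)
  simpa [osc] using this

theorem osc_eq {Φ : ℝ} (h : Φ ≠ 0) :
    osc Φ = (Complex.exp ((Φ : ℂ) * Complex.I) - 1) / (Φ * Complex.I) := by
  have hc : (Φ : ℂ) * Complex.I ≠ 0 := by simp [h]
  have := integral_exp_mul_complex (a := 0) (b := 1) hc
  simp only [Complex.ofReal_one, mul_one, Complex.ofReal_zero, mul_zero, Complex.exp_zero] at this
  rw [← this, osc]
  congr 1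
  ext t
  push_cast
  ring_nf

/-- The gain `|osc Φ| ≲ ⟨Φ⟩⁻¹` from oscillation in time. -/
theorem norm_osc_sq_le (Φ : ℝ) : ‖osc Φ‖ ^ 2 ≤ 8 / (1 + Φ ^ 2) := by
  rw [le_div_iff₀ (by positivity)]
  have h1 := norm_osc_le_one Φ
  have h0 := norm_nonneg (osc Φ)
  by_cases h : Φ = 0
  · subst h; nlinarith
  have h2 : ‖osc Φ‖ * |Φ| ≤ 2 := by
    rw [osc_eq h, norm_div, norm_mul, Complex.norm_I, mul_one, Complex.norm_real, Real.norm_eq_abs,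
      div_mul_cancel₀ _ (abs_ne_zero.2 h)]
    refine (norm_sub_le _ _).trans ?_
    rw [norm_phase]; norm_num
  have h3 : (‖osc Φ‖ * |Φ|) ^ 2 ≤ 4 := by nlinarith [mul_nonneg h0 (abs_nonneg Φ)]
  rw [mul_pow, sq_abs] at h3
  nlinarith

theorem im_osc {Φ : ℝ} (h : Φ ≠ 0) : (osc Φ).im = (1 - Real.cos Φ) / Φ := by
  rw [osc_eq h, Complex.exp_mul_I]
  have : (Complex.cos Φ + Complex.sin Φ * Complex.I - 1) / (Φ * Complex.I) =
      ((Real.sin Φ / Φ : ℝ) : ℂ) + ((1 - Real.cos Φ) / Φ : ℝ) * Complex.I := by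
    have hc : (Φ : ℂ) ≠ 0 := by simpa using h
    push_cast
    field_simp
    linear_combination (Complex.cos Φ - 1) * Complex.I_sq
  rw [this]
  simp [-Complex.ofReal_div]

theorem half_le_re_osc {Φ : ℝ} (h : |Φ| ≤ 1) : 1 / 2 ≤ (osc Φ).re := by
  have e : (osc Φ).re = ∫ t in (0 : ℝ)..1, Real.cos (t * Φ) := by
    have := Complex.reCLM.intervalIntegral_comp_comm (μ := volume) (a := 0) (b := 1)
      (f := fun t : ℝ ↦ Complex.exp (((t * Φ : ℝ) : ℂ) * Complex.I))
      (Continuous.intervalIntegrable (by fun_prop) _ _)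
    rw [osc, ← Complex.reCLM_apply, ← this]
    simp [Complex.exp_ofReal_mul_I_re, -Complex.ofReal_mul]
  rw [e]
  have := intervalIntegral.integral_mono_on (μ := volume) (a := 0) (b := 1)
    (f := fun _ ↦ (1 / 2 : ℝ)) (g := fun t ↦ Real.cos (t * Φ)) zero_le_one intervalIntegrable_const
    (Continuous.intervalIntegrable (by fun_prop) _ _) (fun t ht ↦ by
      have h1 := Real.one_sub_sq_div_two_le_cos (x := t * Φ)
      have h2 : |t * Φ| ≤ 1 := by
        rw [abs_mul, abs_of_nonneg ht.1]
        nlinarith [ht.1, ht.2, abs_nonneg Φ]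
      have h3 : (t * Φ) ^ 2 ≤ 1 := by rw [← sq_abs]; nlinarith [abs_nonneg (t * Φ)]
      show (1 / 2 : ℝ) ≤ Real.cos (t * Φ)
      linarith)
  simpa using this

/-- Fubini for a Duhamel term: if the frequency-side integrand is `∫ e^{itΦ} A`, the time integral
replaces the exponential by the factor `osc Φ`. -/
theorem coeFn_intervalIntegral_ae_eq_osc {X : Type*} [MeasurableSpace X] {μ : Measure X}
    [SFinite μ] {G : ℝ → L2} {Φ : ℝ → X → ℝ} {A : ℝ → X → ℂ} {H : ℝ → ℝ}
    (hΦ : Measurable (Function.uncurry Φ)) (hA : Measurable (Function.uncurry A))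
    (hAi : ∀ ξ, Integrable (A ξ) μ)
    (hG : ∀ t, G t =ᵐ[volume] fun ξ ↦
      ∫ x, Complex.exp (((t * Φ ξ x : ℝ) : ℂ) * Complex.I) * A ξ x ∂μ)
    (hH : MemLp H 2 volume) (hb : ∀ ξ, ∫ x, ‖A ξ x‖ ∂μ ≤ H ξ) :
    ((∫ t in (0 : ℝ)..1, G t : L2) : ℝ → ℂ) =ᵐ[volume] fun ξ ↦ ∫ x, osc (Φ ξ x) * A ξ x ∂μ := by
  have hme : Measurable fun p : (ℝ × ℝ) × X ↦
      Complex.exp (((p.1.1 * Φ p.1.2 p.2 : ℝ) : ℂ) * Complex.I) * A p.1.2 p.2 := by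
    have h1 : Measurable fun p : (ℝ × ℝ) × X ↦ Φ p.1.2 p.2 :=
      hΦ.comp (by fun_prop : Measurable fun p : (ℝ × ℝ) × X ↦ (p.1.2, p.2))
    have h2 : Measurable fun p : (ℝ × ℝ) × X ↦ A p.1.2 p.2 :=
      hA.comp (by fun_prop : Measurable fun p : (ℝ × ℝ) × X ↦ (p.1.2, p.2))
    fun_prop
  refine (coeFn_intervalIntegral_ae_eq hG ?_ hH ?_ ?_).trans
    (Filter.Eventually.of_forall fun ξ ↦ ?_)
  · exact hme.stronglyMeasurable.integral_prod_right
  · intro t ξ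
    refine (norm_integral_le_integral_norm _).trans (le_trans (le_of_eq ?_) (hb ξ))
    simp_rw [norm_mul, norm_phase, one_mul]
  · intro ξ
    refine continuous_of_dominated (bound := fun x ↦ ‖A ξ x‖) ?_ ?_ (hAi ξ).norm ?_
    · intro t
      exact (hme.comp (by fun_prop : Measurable fun x : X ↦ ((t, ξ), x))).aestronglyMeasurable
    · intro t
      refine Filter.Eventually.of_forall fun x ↦ ?_
      rw [norm_mul, norm_phase, one_mul]
    · refine Filter.Eventually.of_forall fun x ↦ ?_
      fun_prop
  · simp only []
    simp_rw [osc, ← intervalIntegral.integral_mul_const]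
    simp_rw [intervalIntegral.integral_of_le zero_le_one]
    refine integral_integral_swap ?_
    have hAp : Integrable (fun p : ℝ × X ↦ ‖A ξ p.2‖)
        ((volume.restrict (Set.Ioc (0 : ℝ) 1)).prod μ) := (hAi ξ).norm.comp_snd _
    refine hAp.mono ?_ (Filter.Eventually.of_forall fun p ↦ ?_)
    · exact (hme.comp
        (by fun_prop : Measurable fun p : ℝ × X ↦ ((p.1, ξ), p.2))).aestronglyMeasurable
    · simp [Function.uncurry, -Complex.ofReal_mul]

/-! ### Products, conjugates and derivatives on the Fourier side -/

/-- The Fourier transform turns the pointwise product of Schwartz functions into convolution. -/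
theorem fourier_mul (f g : 𝓢(ℝ, ℂ)) (ξ : ℝ) :
    𝓕 (mul f g) ξ = ∫ x, 𝓕 f x * 𝓕 g (ξ - x) := by
  have h1 : mul f g = 𝓕 (SchwartzMap.convolution (ContinuousLinearMap.mul ℂ ℂ) (𝓕⁻ f) (𝓕⁻ g)) := by
    rw [SchwartzMap.fourier_convolution, FourierTransform.fourier_fourierInv_eq,
      FourierTransform.fourier_fourierInv_eq, mul]
  have h2 : ∀ (h : 𝓢(ℝ, ℂ)) (x : ℝ), 𝓕⁻ h x = 𝓕 h (-x) := fun h x ↦ by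
    rw [SchwartzMap.fourierInv_apply_eq]; rfl
  have h3 : ∀ (h : 𝓢(ℝ, ℂ)) (x : ℝ), 𝓕 h x = 𝓕⁻ h (-x) := fun h x ↦ by rw [h2, neg_neg]
  rw [h3, h1, FourierTransform.fourierInv_fourier_eq, SchwartzMap.convolution_apply,
    convolution_def, ← integral_neg_eq_self]
  refine integral_congr_ae (Filter.Eventually.of_forall fun x ↦ ?_)
  simp only [ContinuousLinearMap.mul_apply']
  rw [h2, h2]
  congr 2 <;> ring

theorem fourier_conj (f : 𝓢(ℝ, ℂ)) (ξ : ℝ) :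
    𝓕 (conj f) ξ = (starRingEnd ℂ) (𝓕 f (-ξ)) := by
  rw [SchwartzMap.fourier_coe, SchwartzMap.fourier_coe, Real.fourier_eq', Real.fourier_eq',
    ← integral_conj]
  refine integral_congr_ae (Filter.Eventually.of_forall fun x ↦ ?_)
  simp only [conj_apply, smul_eq_mul, map_mul, ← Complex.exp_conj, Complex.conj_I,
    Complex.conj_ofReal]
  congr 2
  simp

theorem fourier_derivCLM (f : 𝓢(ℝ, ℂ)) (ξ : ℝ) :
    𝓕 (SchwartzMap.derivCLM ℂ ℂ f) ξ = ((2 * Real.pi * ξ : ℝ) : ℂ) * Complex.I * 𝓕 f ξ := by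
  rw [SchwartzMap.fourier_coe, SchwartzMap.fourier_coe]
  have h : (SchwartzMap.derivCLM ℂ ℂ f : ℝ → ℂ) = deriv f := by
    ext x; simp [SchwartzMap.derivCLM_apply]
  rw [h, Real.fourier_deriv f.integrable f.differentiable
    (by rw [← h]; exact (SchwartzMap.derivCLM ℂ ℂ f).integrable)]
  simp only [smul_eq_mul]
  push_cast
  ring

/-! ### Rapid decay of convolutions -/

theorem one_add_sq_le_mul (x y : ℝ) : 1 + (x + y) ^ 2 ≤ 2 * (1 + x ^ 2) * (1 + y ^ 2) := by
  nlinarith [sq_nonneg (x - y), sq_nonneg (x * y)]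

theorem exists_norm_le_div_one_add_sq_pow (f : 𝓢(ℝ, ℂ)) (k : ℕ) :
    ∃ C, 0 ≤ C ∧ ∀ x, ‖f x‖ ≤ C / (1 + x ^ 2) ^ k := by
  have h := SchwartzMap.one_add_le_sup_seminorm_apply (𝕜 := ℝ) (m := (2 * k, 0)) (k := 2 * k)
    (n := 0) le_rfl le_rfl f
  refine ⟨_, (by positivity : (0 : ℝ) ≤ 2 ^ (2 * k) * ((Finset.Iic (2 * k, 0)).sup
    fun m ↦ SchwartzMap.seminorm ℝ (F := ℂ) (E := ℝ) m.1 m.2) f), fun x ↦ ?_⟩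
  rw [le_div_iff₀ (by positivity)]
  refine le_trans ?_ (h x)
  rw [norm_iteratedFDeriv_zero, mul_comm, pow_mul]
  gcongr
  rw [Real.norm_eq_abs, ← sq_abs x]
  nlinarith [abs_nonneg x]

/-- The convolution of two rapidly decaying functions decays rapidly. -/
theorem integral_norm_mul_norm_le {F G : ℝ → ℂ} {C D : ℝ} {k : ℕ} (hC : 0 ≤ C) (hD : 0 ≤ D)
    (hF : ∀ x, ‖F x‖ ≤ C / (1 + x ^ 2) ^ (k + 1)) (hG : ∀ x, ‖G x‖ ≤ D / (1 + x ^ 2) ^ k) (ξ : ℝ) :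
    ∫ x, ‖F x‖ * ‖G (ξ - x)‖ ≤ 2 ^ k * C * D * Real.pi / (1 + ξ ^ 2) ^ k := by
  have h : ∀ x, ‖F x‖ * ‖G (ξ - x)‖ ≤ 2 ^ k * C * D / (1 + ξ ^ 2) ^ k * (1 + x ^ 2)⁻¹ := by
    intro x
    have h1 := one_add_sq_le_mul x (ξ - x)
    rw [add_sub_cancel] at h1
    have h2 : (1 + ξ ^ 2) ^ k ≤ 2 ^ k * (1 + x ^ 2) ^ k * (1 + (ξ - x) ^ 2) ^ k := by
      rw [← mul_pow, ← mul_pow]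
      gcongr
    calc ‖F x‖ * ‖G (ξ - x)‖ ≤ C / (1 + x ^ 2) ^ (k + 1) * (D / (1 + (ξ - x) ^ 2) ^ k) :=
          mul_le_mul (hF x) (hG _) (norm_nonneg _) (by positivity)
      _ ≤ _ := by
        rw [div_mul_div_comm, ← div_eq_mul_inv, div_div, div_le_div_iff₀ (by positivity)
          (by positivity), pow_succ (1 + x ^ 2)]
        have : 0 ≤ C * D * (1 + x ^ 2) := by positivity
        nlinarith [mul_le_mul_of_nonneg_left h2 this]
  have hi : Integrable fun x : ℝ ↦ 2 ^ k * C * D / (1 + ξ ^ 2) ^ k * (1 + x ^ 2)⁻¹ :=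
    integrable_inv_one_add_sq.const_mul _
  calc ∫ x, ‖F x‖ * ‖G (ξ - x)‖ ≤ ∫ x, 2 ^ k * C * D / (1 + ξ ^ 2) ^ k * (1 + x ^ 2)⁻¹ :=
        integral_mono_of_nonneg (Filter.Eventually.of_forall fun x ↦ by positivity) hi
          (Filter.Eventually.of_forall h)
    _ = _ := by rw [integral_const_mul, integral_univ_inv_one_add_sq]; ring

theorem memLp_const_div_one_add_sq (C : ℝ) : MemLp (fun x : ℝ ↦ C / (1 + x ^ 2)) 2 volume := by
  rw [memLp_two_iff_integrable_sq]
  · refine (integrable_inv_one_add_sq.const_mul (C ^ 2)).mono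
      (Continuous.aestronglyMeasurable
        ((continuous_const.div (by fun_prop) fun x ↦ by positivity).pow 2))
      (Filter.Eventually.of_forall fun x ↦ ?_)
    rw [Real.norm_of_nonneg (by positivity), Real.norm_of_nonneg (by positivity), div_pow,
      div_eq_mul_inv]
    gcongr
    nlinarith [sq_nonneg x]
  · exact Continuous.aestronglyMeasurable
      (continuous_const.div (by fun_prop) fun x ↦ by positivity)

/-! ### Duhamel terms on the Fourier side -/

/-- `L²`-valued Duhamel integrals may be computed frequency by frequency. -/
theorem fourier_intervalIntegral_toLp (w : ℝ → 𝓢(ℝ, ℂ)) :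
    𝓕 (∫ t in (0 : ℝ)..1, (w t).toLp 2 : L2) = ∫ t in (0 : ℝ)..1, ((𝓕 (w t)).toLp 2 : L2) := by
  rw [intervalIntegral.integral_of_le zero_le_one, intervalIntegral.integral_of_le zero_le_one,
    show ∀ F : L2, 𝓕 F = (Lp.fourierTransformₗᵢ ℝ ℂ).toContinuousLinearEquiv F from fun _ ↦ rfl,
    ← ContinuousLinearEquiv.integral_comp_comm]
  congr 1
  ext1 t
  exact SchwartzMap.toLp_fourier_eq (w t)

/-- Fourier transform of a bilinear Duhamel term. The phases `p₀`, `p₁`, `p₂` are those of the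
propagator and of the two factors, and `m` is the symbol of the derivative in front. -/
theorem fourier_duhamel_bilinear {p₀ p₁ p₂ : ℝ → ℝ} {m : ℝ → ℂ} {f g : 𝓢(ℝ, ℂ)}
    {a b w : ℝ → 𝓢(ℝ, ℂ)} {L : ℝ} (hp₀ : Continuous p₀) (hp₁ : Continuous p₁)
    (hp₂ : Continuous p₂) (hm : Continuous m) (hL : 0 ≤ L) (hmL : ∀ ξ, ‖m ξ‖ ≤ L * (1 + ξ ^ 2))
    (ha : ∀ t x, 𝓕 (a t) x = Complex.exp (((t * p₁ x : ℝ) : ℂ) * Complex.I) * f x)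
    (hb : ∀ t x, 𝓕 (b t) x = Complex.exp (((t * p₂ x : ℝ) : ℂ) * Complex.I) * g x)
    (hw : ∀ t ξ, 𝓕 (w t) ξ = m ξ * Complex.exp ((((1 - t) * p₀ ξ : ℝ) : ℂ) * Complex.I) *
      𝓕 (mul (a t) (b t)) ξ) :
    (𝓕 (∫ t in (0 : ℝ)..1, (w t).toLp 2 : L2) : L2) =ᵐ[volume] fun ξ ↦
      m ξ * Complex.exp ((p₀ ξ : ℂ) * Complex.I) *
        ∫ x, osc (p₁ x + p₂ (ξ - x) - p₀ ξ) * (f x * g (ξ - x)) := by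
  obtain ⟨C, hC, hf⟩ := exists_norm_le_div_one_add_sq_pow f 3
  obtain ⟨D, hD, hg⟩ := exists_norm_le_div_one_add_sq_pow g 2
  rw [fourier_intervalIntegral_toLp]
  have key := coeFn_intervalIntegral_ae_eq_osc (X := ℝ) (μ := volume)
    (G := fun t ↦ ((𝓕 (w t)).toLp 2 : L2)) (Φ := fun ξ x ↦ p₁ x + p₂ (ξ - x) - p₀ ξ)
    (A := fun ξ x ↦ m ξ * Complex.exp ((p₀ ξ : ℂ) * Complex.I) * (f x * g (ξ - x)))
    (H := fun ξ ↦ (L * (2 ^ 2 * C * D * Real.pi)) / (1 + ξ ^ 2))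
    (by apply Continuous.measurable; unfold Function.uncurry; fun_prop)
    (by apply Continuous.measurable; unfold Function.uncurry; fun_prop)
    (fun ξ ↦ ?_) (fun t ↦ ?_) (memLp_const_div_one_add_sq _) (fun ξ ↦ ?_)
  · refine key.trans (Filter.Eventually.of_forall fun ξ ↦ ?_)
    simp only []
    rw [← integral_const_mul]
    congr 1
    ext x
    ring
  · refine Integrable.const_mul ?_ _
    refine (f.integrable).mul_bdd (c := D) (by fun_prop) (Filter.Eventually.of_forall fun x ↦ ?_)
    refine (hg _).trans (div_le_self hD ?_)
    exact one_le_pow₀ (by nlinarith [sq_nonneg (ξ - x)])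
  · refine (SchwartzMap.coeFn_toLp _ _ volume).trans (Filter.Eventually.of_forall fun ξ ↦ ?_)
    simp only []
    rw [hw, fourier_mul, ← integral_const_mul]
    congr 1
    ext x
    have e : ((t * (p₁ x + p₂ (ξ - x) - p₀ ξ) : ℝ) : ℂ) * Complex.I =
        ((t * p₁ x : ℝ) : ℂ) * Complex.I + ((t * p₂ (ξ - x) : ℝ) : ℂ) * Complex.I +
        (((1 - t) * p₀ ξ : ℝ) : ℂ) * Complex.I - (p₀ ξ : ℂ) * Complex.I := by
      push_cast; ring
    rw [ha, hb, e, Complex.exp_sub, Complex.exp_add, Complex.exp_add]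
    field_simp
  · simp_rw [norm_mul, norm_phase, mul_one]
    rw [integral_const_mul]
    have h := integral_norm_mul_norm_le hC hD hf hg ξ
    calc ‖m ξ‖ * ∫ x, ‖f x‖ * ‖g (ξ - x)‖
        ≤ (L * (1 + ξ ^ 2)) * (2 ^ 2 * C * D * Real.pi / (1 + ξ ^ 2) ^ 2) :=
          mul_le_mul (hmL ξ) h (integral_nonneg fun x ↦ by positivity) (by positivity)
      _ = _ := by field_simp

/-- Fourier transform of a trilinear Duhamel term. -/
theorem fourier_duhamel_trilinear {p₀ p₁ p₂ p₃ : ℝ → ℝ} {f g h : 𝓢(ℝ, ℂ)}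
    {a b c w : ℝ → 𝓢(ℝ, ℂ)} (hp₀ : Continuous p₀) (hp₁ : Continuous p₁)
    (hp₂ : Continuous p₂) (hp₃ : Continuous p₃)
    (ha : ∀ t x, 𝓕 (a t) x = Complex.exp (((t * p₁ x : ℝ) : ℂ) * Complex.I) * f x)
    (hb : ∀ t x, 𝓕 (b t) x = Complex.exp (((t * p₂ x : ℝ) : ℂ) * Complex.I) * g x)
    (hc : ∀ t x, 𝓕 (c t) x = Complex.exp (((t * p₃ x : ℝ) : ℂ) * Complex.I) * h x)
    (hw : ∀ t ξ, 𝓕 (w t) ξ = Complex.exp ((((1 - t) * p₀ ξ : ℝ) : ℂ) * Complex.I) *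
      𝓕 (mul (mul (a t) (b t)) (c t)) ξ) :
    (𝓕 (∫ t in (0 : ℝ)..1, (w t).toLp 2 : L2) : L2) =ᵐ[volume] fun ξ ↦
      Complex.exp ((p₀ ξ : ℂ) * Complex.I) *
        ∫ q : ℝ × ℝ, osc (p₁ q.2 + p₂ (q.1 - q.2) + p₃ (ξ - q.1) - p₀ ξ) *
          (f q.2 * g (q.1 - q.2) * h (ξ - q.1)) := by
  obtain ⟨C, hC, hf⟩ := exists_norm_le_div_one_add_sq_pow f 3
  obtain ⟨D, hD, hg⟩ := exists_norm_le_div_one_add_sq_pow g 2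
  obtain ⟨E, hE, hh⟩ := exists_norm_le_div_one_add_sq_pow h 1
  have hint : ∀ ξ, Integrable (fun q : ℝ × ℝ ↦ f q.2 * g (q.1 - q.2) * h (ξ - q.1)) := fun ξ ↦ by
    have := (f.integrable (μ := volume)).convolution_integrand (ContinuousLinearMap.mul ℂ ℂ)
      (g.integrable (μ := volume))
    refine this.mul_bdd (c := E) (by fun_prop) (Filter.Eventually.of_forall fun x ↦ ?_)
    refine (hh _).trans (div_le_self hE ?_)
    exact one_le_pow₀ (by nlinarith [sq_nonneg (ξ - x.1)])
  have hconv : ∀ y, ‖∫ x, ‖f x‖ * ‖g (y - x)‖‖ ≤ 2 ^ 2 * C * D * Real.pi / (1 + y ^ 2) ^ (1 + 1) :=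
    fun y ↦ by
      rw [Real.norm_of_nonneg (integral_nonneg fun x ↦ by positivity)]
      exact integral_norm_mul_norm_le hC hD hf hg y
  rw [fourier_intervalIntegral_toLp]
  have key := coeFn_intervalIntegral_ae_eq_osc (X := ℝ × ℝ) (μ := volume)
    (G := fun t ↦ ((𝓕 (w t)).toLp 2 : L2))
    (Φ := fun ξ q ↦ p₁ q.2 + p₂ (q.1 - q.2) + p₃ (ξ - q.1) - p₀ ξ)
    (A := fun ξ q ↦ Complex.exp ((p₀ ξ : ℂ) * Complex.I) * (f q.2 * g (q.1 - q.2) * h (ξ - q.1)))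
    (H := fun ξ ↦ (2 ^ 1 * (2 ^ 2 * C * D * Real.pi) * E * Real.pi) / (1 + ξ ^ 2))
    (by apply Continuous.measurable; unfold Function.uncurry; fun_prop)
    (by apply Continuous.measurable; unfold Function.uncurry; fun_prop)
    (fun ξ ↦ (hint ξ).const_mul _) (fun t ↦ ?_) (memLp_const_div_one_add_sq _) (fun ξ ↦ ?_)
  · refine key.trans (Filter.Eventually.of_forall fun ξ ↦ ?_)
    simp only []
    rw [← integral_const_mul]
    congr 1
    ext x
    ring
  · refine (SchwartzMap.coeFn_toLp _ _ volume).trans (Filter.Eventually.of_forall fun ξ ↦ ?_)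
    simp only []
    have e : ∀ x y : ℝ, Complex.exp (((t * (p₁ x + p₂ (y - x) + p₃ (ξ - y) - p₀ ξ) : ℝ) : ℂ) *
        Complex.I) * (Complex.exp ((p₀ ξ : ℂ) * Complex.I) * (f x * g (y - x) * h (ξ - y))) =
        Complex.exp ((((1 - t) * p₀ ξ : ℝ) : ℂ) * Complex.I) *
          (𝓕 (a t) x * 𝓕 (b t) (y - x) * 𝓕 (c t) (ξ - y)) := by
      intro x y
      have e : ((t * (p₁ x + p₂ (y - x) + p₃ (ξ - y) - p₀ ξ) : ℝ) : ℂ) * Complex.I =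
          ((t * p₁ x : ℝ) : ℂ) * Complex.I + ((t * p₂ (y - x) : ℝ) : ℂ) * Complex.I +
          ((t * p₃ (ξ - y) : ℝ) : ℂ) * Complex.I +
          (((1 - t) * p₀ ξ : ℝ) : ℂ) * Complex.I - (p₀ ξ : ℂ) * Complex.I := by
        push_cast; ring
      rw [ha, hb, hc, e, Complex.exp_sub, Complex.exp_add, Complex.exp_add, Complex.exp_add]
      field_simp
    have hi2 : Integrable (fun q : ℝ × ℝ ↦ Complex.exp (((t * (p₁ q.2 + p₂ (q.1 - q.2) +
        p₃ (ξ - q.1) - p₀ ξ) : ℝ) : ℂ) * Complex.I) * (Complex.exp ((p₀ ξ : ℂ) * Complex.I) *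
        (f q.2 * g (q.1 - q.2) * h (ξ - q.1)))) := by
      refine ((hint ξ).const_mul _).bdd_mul (c := 1) (by fun_prop)
        (Filter.Eventually.of_forall fun q ↦ ?_)
      rw [norm_phase]
    rw [hw, fourier_mul, Measure.volume_eq_prod, integral_prod _ hi2, ← integral_const_mul]
    congr 1
    ext y
    simp_rw [e]
    rw [fourier_mul, integral_const_mul, integral_mul_const]
  · simp_rw [norm_mul, norm_phase, one_mul]
    have hi3 : Integrable (fun q : ℝ × ℝ ↦ ‖f q.2‖ * ‖g (q.1 - q.2)‖ * ‖h (ξ - q.1)‖) := by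
      simpa only [norm_mul] using (hint ξ).norm
    rw [Measure.volume_eq_prod, integral_prod _ hi3]
    simp_rw [integral_mul_const]
    have := integral_norm_mul_norm_le (k := 1) (C := 2 ^ 2 * C * D * Real.pi)
      (F := fun y ↦ ((∫ x, ‖f x‖ * ‖g (y - x)‖ : ℝ) : ℂ)) (G := h) (by positivity) hE
      (fun y ↦ (Complex.norm_real _).le.trans (hconv y)) hh ξ
    have e : ∀ y, ‖((∫ x, ‖f x‖ * ‖g (y - x)‖ : ℝ) : ℂ)‖ = ∫ x, ‖f x‖ * ‖g (y - x)‖ := fun y ↦ by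
      rw [Complex.norm_real, Real.norm_of_nonneg (integral_nonneg fun x ↦ by positivity)]
    simp_rw [e] at this
    simpa using this

/-! ### Passing to angular frequency -/

/-- The weighted energy `∫ (1 + η²)^s |h(η)|² dη`; for `h = û` it is `‖u‖²_{H^s}`. -/
noncomputable def energy (s : ℝ) (h : ℝ → ℂ) : ℝ≥0∞ :=
  ∫⁻ η, ENNReal.ofReal ((1 + η ^ 2) ^ s) * ‖h η‖ₑ ^ 2

/-- The Fourier transform in the angular frequency `η = 2πξ`, as a Schwartz function. -/
noncomputable def hatFn (u : 𝓢(ℝ, ℂ)) : 𝓢(ℝ, ℂ) :=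
  SchwartzMap.compCLMOfContinuousLinearEquiv ℂ
    (ContinuousLinearEquiv.unitsEquivAut ℝ (Units.mk0 ((2 * Real.pi)⁻¹) (by positivity))) (𝓕 u)

theorem hatFn_apply (u : 𝓢(ℝ, ℂ)) (η : ℝ) : hatFn u η = 𝓕 u ((2 * Real.pi)⁻¹ * η) := by
  rw [hatFn, SchwartzMap.compCLMOfContinuousLinearEquiv_apply]
  simp [mul_comm]

theorem fourier_eq_hatFn (u : 𝓢(ℝ, ℂ)) (ξ : ℝ) : 𝓕 u ξ = hatFn u (2 * Real.pi * ξ) := by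
  rw [hatFn_apply, inv_mul_cancel_left₀ (by positivity)]

theorem hatFn_surjective : Function.Surjective hatFn := by
  intro f
  refine ⟨𝓕⁻ (SchwartzMap.compCLMOfContinuousLinearEquiv ℂ
    (ContinuousLinearEquiv.unitsEquivAut ℝ (Units.mk0 (2 * Real.pi) (by positivity))) f), ?_⟩
  ext η
  rw [hatFn_apply, FourierTransform.fourier_fourierInv_eq,
    SchwartzMap.compCLMOfContinuousLinearEquiv_apply]
  have : 2 * Real.pi * ((2 * Real.pi)⁻¹ * η) = η := by
    rw [mul_inv_cancel_left₀ (by positivity)]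
  simp only [Function.comp_apply]
  congr 1
  simpa [mul_comm] using this

theorem lintegral_comp_mul_left (F : ℝ → ℝ≥0∞) {c : ℝ} (hc : 0 < c) :
    ∫⁻ x, F (c * x) = ENNReal.ofReal c⁻¹ * ∫⁻ x, F x := by
  have h := lintegral_map_equiv (μ := (volume : Measure ℝ)) F
    (Homeomorph.mulLeft₀ c hc.ne').toMeasurableEquiv
  have e : Measure.map (Homeomorph.mulLeft₀ c hc.ne').toMeasurableEquiv volume =
      ENNReal.ofReal c⁻¹ • (volume : Measure ℝ) := by
    have := Real.map_volume_mul_left hc.ne'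
    rw [abs_of_pos (by positivity)] at this
    exact this
  rw [e, lintegral_smul_measure] at h
  exact h.symm

/-- Change of variables `η = 2πξ` in the definition of the `H^s` norm. -/
theorem hsNorm_sq_eq {s : ℝ} {F : L2} {φ ψ : ℝ → ℂ} {r : ℝ} (hr : 0 ≤ r)
    (hF : (𝓕 F : L2) =ᵐ[volume] φ) (hφ : ∀ ξ, ‖φ ξ‖ = r * ‖ψ (2 * Real.pi * ξ)‖) :
    hsNorm s F ^ 2 = ENNReal.ofReal (r ^ 2 * (2 * Real.pi)⁻¹) * energy s ψ := by
  have h1 : hsNorm s F ^ 2 = ∫⁻ ξ, ENNReal.ofReal (r ^ 2) *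
      (ENNReal.ofReal ((1 + (2 * Real.pi * ξ) ^ 2) ^ s) * ‖ψ (2 * Real.pi * ξ)‖ₑ ^ 2) := by
    rw [hsNorm, eLpNorm_eq_lintegral_rpow_enorm_toReal (by norm_num) (by norm_num)]
    rw [← ENNReal.rpow_natCast, ← ENNReal.rpow_mul]
    norm_num
    refine lintegral_congr_ae ?_
    filter_upwards [hF] with ξ hξ
    rw [hξ, mul_pow, ← ofReal_norm (φ ξ), hφ, ENNReal.ofReal_mul hr, mul_pow, ofReal_norm,
      ENNReal.ofReal_pow hr, ← ofReal_norm, Complex.norm_real,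
      Real.norm_of_nonneg (Real.rpow_nonneg (by positivity) _),
      ← ENNReal.ofReal_pow (Real.rpow_nonneg (by positivity) _), ← Real.rpow_natCast,
      ← Real.rpow_mul (by positivity)]
    norm_num
    ring
  rw [h1, lintegral_const_mul' _ _ ENNReal.ofReal_ne_top, lintegral_comp_mul_left
    (fun η ↦ ENNReal.ofReal ((1 + η ^ 2) ^ s) * ‖ψ η‖ₑ ^ 2) (by positivity), ← mul_assoc,
    ← ENNReal.ofReal_mul (by positivity), energy]

theorem hsNorm_toLp_sq (s : ℝ) (u : 𝓢(ℝ, ℂ)) :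
    hsNorm s (u.toLp 2) ^ 2 = ENNReal.ofReal (1 ^ 2 * (2 * Real.pi)⁻¹) * energy s (hatFn u) := by
  refine hsNorm_sq_eq (φ := fun ξ ↦ 𝓕 u ξ) zero_le_one ?_ fun ξ ↦ ?_
  · rw [SchwartzMap.toLp_fourier_eq]
    exact SchwartzMap.coeFn_toLp _ _ volume
  · rw [fourier_eq_hatFn, one_mul]

/-- Inequalities between quantities may be checked on their squares, up to positive constants. -/
theorem exists_bound_iff_of_sq {ι : Type*} {a b A B : ι → ℝ≥0∞} {κ μ : ℝ} (hκ : 0 < κ) (hμ : 0 < μ)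
    (ha : ∀ i, a i ^ 2 = ENNReal.ofReal κ * A i) (hb : ∀ i, b i ^ 2 = ENNReal.ofReal μ * B i) :
    (∃ C : ℝ≥0, ∀ i, a i ≤ C * b i) ↔ ∃ C : ℝ≥0, ∀ i, A i ≤ C * B i := by
  constructor
  · rintro ⟨C, hC⟩
    refine ⟨κ.toNNReal⁻¹ * C ^ 2 * μ.toNNReal, fun i ↦ ?_⟩
    have h := pow_le_pow_left' (hC i) 2
    rw [mul_pow, ha, hb] at h
    have hk : (κ.toNNReal : ℝ≥0) ≠ 0 := by simpa using hκ
    rw [ENNReal.coe_mul, ENNReal.coe_mul, ENNReal.coe_inv hk, ENNReal.coe_pow, mul_assoc, mul_assoc,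
      ← ENNReal.div_eq_inv_mul, ENNReal.le_div_iff_mul_le (by simp [hκ]) (by simp), mul_comm]
    exact h
  · rintro ⟨C, hC⟩
    have hm : (μ.toNNReal : ℝ≥0) ≠ 0 := by simpa using hμ
    refine ⟨NNReal.sqrt (κ.toNNReal * C * μ.toNNReal⁻¹), fun i ↦ ?_⟩
    have h2 : a i ^ 2 ≤ ((NNReal.sqrt (κ.toNNReal * C * μ.toNNReal⁻¹) : ℝ≥0) * b i) ^ 2 := by
      rw [mul_pow, ha, hb, ← ENNReal.coe_pow, NNReal.sq_sqrt, ENNReal.coe_mul, ENNReal.coe_mul,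
        ENNReal.coe_inv hm, mul_assoc, mul_assoc, ← mul_assoc _ (ENNReal.ofReal μ)]
      rw [show ENNReal.ofReal μ = (μ.toNNReal : ℝ≥0∞) from rfl, ENNReal.inv_mul_cancel
        (by simpa using hμ) (by simp), one_mul]
      exact mul_le_mul_right (hC i) _
    exact (ENNReal.pow_le_pow_left_iff two_ne_zero).1 h2

theorem integral_scale (F : ℝ → ℂ) :
    ∫ x, F (2 * Real.pi * x) = (((2 * Real.pi)⁻¹ : ℝ) : ℂ) * ∫ y, F y := by
  rw [Measure.integral_comp_mul_left, abs_of_pos (by positivity), Complex.real_smul]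

theorem integral_prod_scale (F : ℝ × ℝ → ℂ) :
    ∫ q : ℝ × ℝ, F (2 * Real.pi * q.1, 2 * Real.pi * q.2) =
      (((2 * Real.pi)⁻¹ ^ 2 : ℝ) : ℂ) * ∫ q, F q := by
  have h := Measure.integral_comp_smul (volume : Measure (ℝ × ℝ)) F (2 * Real.pi)
  have h2 : Module.finrank ℝ (ℝ × ℝ) = 2 := by simp
  rw [h2, ← inv_pow, abs_of_pos (by positivity), Complex.real_smul] at h
  exact h

/-- The phase `-η²`, `η = 2πξ`, of `S(t)`. -/
noncomputable def phaseS (ξ : ℝ) : ℝ := -(2 * Real.pi * ξ) ^ 2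

/-- The phase `η³`, `η = 2πξ`, of `K(t)`. -/
noncomputable def phaseK (ξ : ℝ) : ℝ := (2 * Real.pi * ξ) ^ 3

theorem continuous_phaseS : Continuous phaseS := by unfold phaseS; fun_prop

theorem continuous_phaseK : Continuous phaseK := by unfold phaseK; fun_prop

theorem schrodingerSymbol_eq (t ξ : ℝ) :
    schrodingerSymbol t ξ = Complex.exp (((t * phaseS ξ : ℝ) : ℂ) * Complex.I) := by
  rw [schrodingerSymbol, phaseS]; congr 3; ring

theorem fourier_S_eq (t : ℝ) (u : 𝓢(ℝ, ℂ)) (ξ : ℝ) :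
    𝓕 (S t u) ξ = Complex.exp (((t * phaseS ξ : ℝ) : ℂ) * Complex.I) * 𝓕 u ξ := by
  rw [fourier_S, schrodingerSymbol_eq]

theorem fourier_K_eq (t : ℝ) (u : 𝓢(ℝ, ℂ)) (ξ : ℝ) :
    𝓕 (K t u) ξ = Complex.exp (((t * phaseK ξ : ℝ) : ℂ) * Complex.I) * 𝓕 u ξ := by
  rw [fourier_K, airySymbol, phaseK]

theorem fourier_conj_S (t : ℝ) (u : 𝓢(ℝ, ℂ)) (ξ : ℝ) :
    𝓕 (conj (S t u)) ξ =
      Complex.exp (((t * (-phaseS ξ) : ℝ) : ℂ) * Complex.I) * 𝓕 (conj u) ξ := by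
  rw [fourier_conj, fourier_S_eq, fourier_conj, map_mul, ← Complex.exp_conj]
  congr 2
  simp only [map_mul, Complex.conj_ofReal, Complex.conj_I, phaseS]
  push_cast
  ring

theorem fourier_conj_eq_hatFn (u : 𝓢(ℝ, ℂ)) (ξ : ℝ) :
    𝓕 (conj u) ξ = (starRingEnd ℂ) (hatFn u (-(2 * Real.pi * ξ))) := by
  rw [fourier_conj, fourier_eq_hatFn]; congr 2; ring

/-- The Duhamel term of `|S(t)u|²S(t)u` at time `1` in angular frequency, with `f = û`, up to a
unimodular factor and a numerical constant. The variables `q = (y, x)` are chosen so that the input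
frequencies are `x`, `x - y`, `η - y` and the phase factors. -/
noncomputable def cubicForm (f : ℝ → ℂ) (η : ℝ) : ℂ :=
  ∫ q : ℝ × ℝ, osc (2 * q.1 * (η - q.2)) *
    (f q.2 * (starRingEnd ℂ) (f (q.2 - q.1)) * f (η - q.1))

/-- The Duhamel term of `S(t)u · K(t)v` at time `1` in angular frequency, with `f = û`, `g = v̂`, up
to a unimodular factor and a numerical constant. -/
noncomputable def mixedForm (f g : ℝ → ℂ) (η : ℝ) : ℂ :=
  ∫ y, osc ((η - y) * (2 * η - (η - y) + (η - y) ^ 2)) * (f y * g (η - y))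

/-- The Duhamel term of `(K(t)v)²` at time `1` in angular frequency, with `g = v̂`, up to a
unimodular factor and a numerical constant. -/
noncomputable def kdvForm (g : ℝ → ℂ) (η : ℝ) : ℂ :=
  (η : ℂ) * ∫ y, osc (-(3 * η * y * (η - y))) * (g y * g (η - y))

/-- The Duhamel term of `|S(t)u|²` at time `1` in angular frequency, with `f = û`, up to a
unimodular factor and a numerical constant. -/
noncomputable def densityForm (f : ℝ → ℂ) (η : ℝ) : ℂ :=
  (η : ℂ) * ∫ y, osc (-(η * (η ^ 2 - η + 2 * y))) * (f y * (starRingEnd ℂ) (f (y - η)))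

theorem hsNorm_mixed_sq (s : ℝ) (u v : 𝓢(ℝ, ℂ)) :
    hsNorm s (duhamelS (fun t ↦ mul (S t u) (K t v)) 1) ^ 2 =
      ENNReal.ofReal (((2 * Real.pi)⁻¹) ^ 2 * (2 * Real.pi)⁻¹) *
        energy s (mixedForm (hatFn u) (hatFn v)) := by
  refine hsNorm_sq_eq (by positivity) (fourier_duhamel_bilinear (m := fun _ ↦ 1) (L := 1)
    continuous_phaseS continuous_phaseS continuous_phaseK continuous_const zero_le_one
    (fun ξ ↦ by rw [norm_one]; nlinarith [sq_nonneg ξ]) (fun t x ↦ fourier_S_eq t u x)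
    (fun t x ↦ fourier_K_eq t v x)
    (fun t ξ ↦ by rw [fourier_S_eq, one_mul])) fun ξ ↦ ?_
  rw [norm_mul, norm_mul, norm_one, norm_phase, one_mul, one_mul, mixedForm]
  have h := integral_scale fun y ↦ osc ((2 * Real.pi * ξ - y) *
    (2 * (2 * Real.pi * ξ) - (2 * Real.pi * ξ - y) + (2 * Real.pi * ξ - y) ^ 2)) *
    (hatFn u y * hatFn v (2 * Real.pi * ξ - y))
  have h2 : ‖(((2 * Real.pi)⁻¹ : ℝ) : ℂ)‖ = (2 * Real.pi)⁻¹ := by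
    rw [Complex.norm_real, Real.norm_of_nonneg (by positivity)]
  rw [← h2, ← norm_mul, ← h]
  congr 1
  refine integral_congr_ae (Filter.Eventually.of_forall fun x ↦ ?_)
  simp only [fourier_eq_hatFn, phaseS, phaseK, mul_sub]
  congr 2
  ring

theorem norm_derivative_symbol_le (ξ : ℝ) :
    ‖((2 * Real.pi * ξ : ℝ) : ℂ) * Complex.I‖ ≤ 2 * Real.pi * (1 + ξ ^ 2) := by
  rw [norm_mul, Complex.norm_I, mul_one, Complex.norm_real, Real.norm_eq_abs, abs_mul,
    abs_of_pos (by positivity)]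
  gcongr
  nlinarith [sq_nonneg (|ξ| - 1), sq_abs ξ]

theorem hsNorm_kdv_sq (s : ℝ) (v : 𝓢(ℝ, ℂ)) :
    hsNorm s (duhamelK (fun t ↦ mul (K t v) (K t v)) 1) ^ 2 =
      ENNReal.ofReal (((2 * Real.pi)⁻¹) ^ 2 * (2 * Real.pi)⁻¹) *
        energy s (kdvForm (hatFn v)) := by
  refine hsNorm_sq_eq (by positivity) (fourier_duhamel_bilinear
    (m := fun ξ ↦ ((2 * Real.pi * ξ : ℝ) : ℂ) * Complex.I) (L := 2 * Real.pi)
    continuous_phaseK continuous_phaseK continuous_phaseK (by fun_prop) (by positivity)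
    norm_derivative_symbol_le (fun t x ↦ fourier_K_eq t v x)
    (fun t x ↦ fourier_K_eq t v x)
    (fun t ξ ↦ by rw [fourier_derivCLM, fourier_K_eq, ← mul_assoc])) fun ξ ↦ ?_
  rw [norm_mul, norm_mul, norm_phase, norm_mul, Complex.norm_I, mul_one, mul_one, kdvForm]
  have h := integral_scale fun y ↦ osc (-(3 * (2 * Real.pi * ξ) * y * (2 * Real.pi * ξ - y))) *
    (hatFn v y * hatFn v (2 * Real.pi * ξ - y))
  have h2 : ‖(((2 * Real.pi)⁻¹ : ℝ) : ℂ)‖ = (2 * Real.pi)⁻¹ := by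
    rw [Complex.norm_real, Real.norm_of_nonneg (by positivity)]
  rw [norm_mul, mul_left_comm]
  congr 1
  rw [← h2, ← norm_mul, ← h]
  congr 1
  refine integral_congr_ae (Filter.Eventually.of_forall fun x ↦ ?_)
  simp only [fourier_eq_hatFn, phaseK, mul_sub]
  congr 2
  ring

theorem hsNorm_density_sq (s : ℝ) (u : 𝓢(ℝ, ℂ)) :
    hsNorm s (duhamelK (fun t ↦ absSq (S t u)) 1) ^ 2 =
      ENNReal.ofReal (((2 * Real.pi)⁻¹) ^ 2 * (2 * Real.pi)⁻¹) *
        energy s (densityForm (hatFn u)) := by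
  refine hsNorm_sq_eq (by positivity) (fourier_duhamel_bilinear
    (m := fun ξ ↦ ((2 * Real.pi * ξ : ℝ) : ℂ) * Complex.I) (L := 2 * Real.pi)
    (p₂ := fun ξ ↦ -phaseS ξ)
    continuous_phaseK continuous_phaseS continuous_phaseS.neg (by fun_prop) (by positivity)
    norm_derivative_symbol_le (fun t x ↦ fourier_S_eq t u x)
    (fun t x ↦ fourier_conj_S t u x)
    (fun t ξ ↦ by rw [fourier_derivCLM, fourier_K_eq, ← mul_assoc]; rfl)) fun ξ ↦ ?_
  rw [norm_mul, norm_mul, norm_phase, norm_mul, Complex.norm_I, mul_one, mul_one, densityForm]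
  have h := integral_scale fun y ↦
    osc (-((2 * Real.pi * ξ) * ((2 * Real.pi * ξ) ^ 2 - 2 * Real.pi * ξ + 2 * y))) *
    (hatFn u y * (starRingEnd ℂ) (hatFn u (y - 2 * Real.pi * ξ)))
  have h2 : ‖(((2 * Real.pi)⁻¹ : ℝ) : ℂ)‖ = (2 * Real.pi)⁻¹ := by
    rw [Complex.norm_real, Real.norm_of_nonneg (by positivity)]
  rw [norm_mul, mul_left_comm]
  congr 1
  rw [← h2, ← norm_mul, ← h]
  congr 1
  refine integral_congr_ae (Filter.Eventually.of_forall fun x ↦ ?_)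
  simp only [fourier_conj_eq_hatFn, fourier_eq_hatFn u, phaseK, phaseS, mul_sub, neg_sub]
  congr 2
  ring

theorem hsNorm_cubic_sq (s : ℝ) (u : 𝓢(ℝ, ℂ)) :
    hsNorm s (duhamelS (fun t ↦ mul (absSq (S t u)) (S t u)) 1) ^ 2 =
      ENNReal.ofReal (((2 * Real.pi)⁻¹ ^ 2) ^ 2 * (2 * Real.pi)⁻¹) *
        energy s (cubicForm (hatFn u)) := by
  refine hsNorm_sq_eq (by positivity) (fourier_duhamel_trilinear
    (p₂ := fun ξ ↦ -phaseS ξ)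
    continuous_phaseS continuous_phaseS continuous_phaseS.neg continuous_phaseS
    (fun t x ↦ fourier_S_eq t u x) (fun t x ↦ fourier_conj_S t u x) (fun t x ↦ fourier_S_eq t u x)
    (fun t ξ ↦ by rw [fourier_S_eq]; rfl)) fun ξ ↦ ?_
  rw [norm_mul, norm_phase, one_mul, cubicForm]
  have h := integral_prod_scale fun q ↦ osc (2 * q.1 * (2 * Real.pi * ξ - q.2)) *
    (hatFn u q.2 * (starRingEnd ℂ) (hatFn u (q.2 - q.1)) * hatFn u (2 * Real.pi * ξ - q.1))
  have h2 : ‖(((2 * Real.pi)⁻¹ ^ 2 : ℝ) : ℂ)‖ = (2 * Real.pi)⁻¹ ^ 2 := by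
    rw [Complex.norm_real, Real.norm_of_nonneg (by positivity)]
  rw [← h2, ← norm_mul, ← h]
  congr 1
  refine integral_congr_ae (Filter.Eventually.of_forall fun x ↦ ?_)
  simp only [fourier_conj_eq_hatFn, fourier_eq_hatFn u, phaseS, mul_sub, neg_sub]
  congr 2
  ring

/-! ### The four inequalities in terms of weighted energies -/

theorem inv_two_pi_factor_pos : 0 < 1 ^ 2 * (2 * Real.pi)⁻¹ := by positivity

theorem cubic_bound_iff (s : ℝ) :
    (∃ C : ℝ≥0, ∀ u : 𝓢(ℝ, ℂ), hsNorm s (duhamelS (fun t ↦ mul (absSq (S t u)) (S t u)) 1)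
      ≤ C * hsNorm s (u.toLp 2) ^ 3) ↔
    ∃ C : ℝ≥0, ∀ f : 𝓢(ℝ, ℂ), energy s (cubicForm f) ≤ C * energy s f ^ 3 := by
  refine (exists_bound_iff_of_sq (by positivity) (pow_pos inv_two_pi_factor_pos 3)
    (fun u ↦ hsNorm_cubic_sq s u) (B := fun u ↦ energy s (hatFn u) ^ 3) fun u ↦ ?_).trans ?_
  · rw [pow_right_comm, hsNorm_toLp_sq, mul_pow, ENNReal.ofReal_pow inv_two_pi_factor_pos.le]
  · exact exists_congr fun C ↦ (hatFn_surjective.forall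
      (p := fun f ↦ energy s (cubicForm f) ≤ C * energy s f ^ 3)).symm

theorem mixed_bound_iff (s₁ s₂ : ℝ) :
    (∃ C : ℝ≥0, ∀ u v : 𝓢(ℝ, ℂ), hsNorm s₁ (duhamelS (fun t ↦ mul (S t u) (K t v)) 1)
      ≤ C * (hsNorm s₁ (u.toLp 2) * hsNorm s₂ (v.toLp 2))) ↔
    ∃ C : ℝ≥0, ∀ f g : 𝓢(ℝ, ℂ), energy s₁ (mixedForm f g) ≤ C * (energy s₁ f * energy s₂ g) := by
  have := exists_bound_iff_of_sq (ι := 𝓢(ℝ, ℂ) × 𝓢(ℝ, ℂ)) (by positivity)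
    (mul_pos inv_two_pi_factor_pos inv_two_pi_factor_pos) (fun p ↦ hsNorm_mixed_sq s₁ p.1 p.2)
    (b := fun p ↦ hsNorm s₁ (p.1.toLp 2) * hsNorm s₂ (p.2.toLp 2))
    (B := fun p ↦ energy s₁ (hatFn p.1) * energy s₂ (hatFn p.2)) fun p ↦ by
      rw [mul_pow, hsNorm_toLp_sq, hsNorm_toLp_sq, ENNReal.ofReal_mul inv_two_pi_factor_pos.le]
      ring
  simp only [Prod.forall] at this
  rw [this]
  refine exists_congr fun C ↦ ((hatFn_surjective.forall
    (p := fun f ↦ ∀ g : 𝓢(ℝ, ℂ),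
      energy s₁ (mixedForm f g) ≤ C * (energy s₁ f * energy s₂ g))).trans
    (forall_congr' fun u ↦ hatFn_surjective.forall)).symm

theorem kdv_bound_iff (s : ℝ) :
    (∃ C : ℝ≥0, ∀ v : 𝓢(ℝ, ℂ), hsNorm s (duhamelK (fun t ↦ mul (K t v) (K t v)) 1)
      ≤ C * hsNorm s (v.toLp 2) ^ 2) ↔
    ∃ C : ℝ≥0, ∀ g : 𝓢(ℝ, ℂ), energy s (kdvForm g) ≤ C * energy s g ^ 2 := by
  refine (exists_bound_iff_of_sq (by positivity) (pow_pos inv_two_pi_factor_pos 2)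
    (fun u ↦ hsNorm_kdv_sq s u) (B := fun u ↦ energy s (hatFn u) ^ 2) fun u ↦ ?_).trans ?_
  · rw [pow_right_comm, hsNorm_toLp_sq, mul_pow, ENNReal.ofReal_pow inv_two_pi_factor_pos.le]
  · exact exists_congr fun C ↦ (hatFn_surjective.forall
      (p := fun f ↦ energy s (kdvForm f) ≤ C * energy s f ^ 2)).symm

theorem density_bound_iff (s₁ s₂ : ℝ) :
    (∃ C : ℝ≥0, ∀ u : 𝓢(ℝ, ℂ), hsNorm s₂ (duhamelK (fun t ↦ absSq (S t u)) 1)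
      ≤ C * hsNorm s₁ (u.toLp 2) ^ 2) ↔
    ∃ C : ℝ≥0, ∀ f : 𝓢(ℝ, ℂ), energy s₂ (densityForm f) ≤ C * energy s₁ f ^ 2 := by
  refine (exists_bound_iff_of_sq (by positivity) (pow_pos inv_two_pi_factor_pos 2)
    (fun u ↦ hsNorm_density_sq s₂ u) (B := fun u ↦ energy s₁ (hatFn u) ^ 2) fun u ↦ ?_).trans ?_
  · rw [pow_right_comm, hsNorm_toLp_sq, mul_pow, ENNReal.ofReal_pow inv_two_pi_factor_pos.le]
  · exact exists_congr fun C ↦ (hatFn_surjective.forall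
      (p := fun f ↦ energy s₂ (densityForm f) ≤ C * energy s₁ f ^ 2)).symm

/-! ### Weighted bilinear estimates -/

theorem sq_lintegral_mul_le {X : Type*} [MeasurableSpace X] (μ : Measure X) {f g : X → ℝ≥0∞}
    (hf : Measurable f) (hg : Measurable g) :
    (∫⁻ x, f x * g x ∂μ) ^ 2 ≤ (∫⁻ x, f x ^ 2 ∂μ) * ∫⁻ x, g x ^ 2 ∂μ := by
  have h := ENNReal.lintegral_mul_le_Lp_mul_Lq μ Real.HolderConjugate.two_two
    hf.aemeasurable hg.aemeasurable
  have h2 := pow_le_pow_left' h 2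
  simp only [mul_pow, ← ENNReal.rpow_natCast, ← ENNReal.rpow_mul] at h2
  simpa using h2

theorem add_sq_le_two_mul (a b : ℝ≥0∞) : (a + b) ^ 2 ≤ 2 * a ^ 2 + 2 * b ^ 2 := by
  have := ENNReal.rpow_add_le_mul_rpow_add_rpow a b (p := 2) (by norm_num)
  norm_num at this
  simpa [mul_add] using this

/-- Schur-type bound when the squared kernel is integrable in the inner variable. -/
theorem lintegral_sq_le_of_inner {α : ℝ → ℝ → ℝ≥0∞} {F G : ℝ → ℝ≥0∞} {C : ℝ≥0∞}
    (hα : Measurable (Function.uncurry α)) (hF : Measurable F) (hG : Measurable G)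
    (hC : ∀ η, ∫⁻ y, α η y ^ 2 ≤ C) :
    ∫⁻ η, (∫⁻ y, α η y * (F y * G (η - y))) ^ 2 ≤
      C * ((∫⁻ y, F y ^ 2) * ∫⁻ y, G y ^ 2) := by
  calc ∫⁻ η, (∫⁻ y, α η y * (F y * G (η - y))) ^ 2
      ≤ ∫⁻ η, C * ∫⁻ y, (F y * G (η - y)) ^ 2 := by
        refine lintegral_mono fun η ↦ ?_
        refine (sq_lintegral_mul_le _ (hα.comp measurable_prodMk_left) (by fun_prop)).trans ?_
        exact mul_le_mul_left (hC η) _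
    _ = C * ∫⁻ η, ∫⁻ y, (F y * G (η - y)) ^ 2 := by
        rw [lintegral_const_mul]
        refine Measurable.lintegral_prod_right'
          (f := fun p : ℝ × ℝ ↦ (F p.2 * G (p.1 - p.2)) ^ 2) ?_
        fun_prop
    _ = C * ∫⁻ y, ∫⁻ η, (F y * G (η - y)) ^ 2 := by
        rw [lintegral_lintegral_swap]
        apply Measurable.aemeasurable
        simp only [Function.uncurry_def]
        fun_prop
    _ = _ := by
        congr 1
        rw [← lintegral_mul_const _ (by fun_prop)]
        refine lintegral_congr fun y ↦ ?_
        simp_rw [mul_pow]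
        rw [lintegral_const_mul _ (by fun_prop), lintegral_sub_right_eq_self (fun η ↦ G η ^ 2) y]

/-- Schur-type bound when the squared kernel is integrable in the output variable. -/
theorem lintegral_sq_le_of_outer {β : ℝ → ℝ → ℝ≥0∞} {F G : ℝ → ℝ≥0∞} {C : ℝ≥0∞}
    (hβ : Measurable (Function.uncurry β)) (hF : Measurable F) (hG : Measurable G)
    (hC : ∀ y, ∫⁻ η, β η y ^ 2 ≤ C) :
    ∫⁻ η, (∫⁻ y, β η y * (F y * G (η - y))) ^ 2 ≤
      C * ((∫⁻ y, F y ^ 2) * ∫⁻ y, G y ^ 2) := by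
  have hβ1 : ∀ η, Measurable (β η) := fun η ↦ hβ.comp measurable_prodMk_left
  have hβ2 : Measurable fun p : ℝ × ℝ ↦ β p.1 p.2 := hβ
  calc ∫⁻ η, (∫⁻ y, β η y * (F y * G (η - y))) ^ 2
      ≤ ∫⁻ η, (∫⁻ y, β η y ^ 2 * F y ^ 2) * ∫⁻ y, G y ^ 2 := by
        refine lintegral_mono fun η ↦ ?_
        simp_rw [← mul_assoc]
        refine (sq_lintegral_mul_le _ ((hβ1 η).mul hF) (by fun_prop)).trans (le_of_eq ?_)
        rw [lintegral_sub_left_eq_self (fun y ↦ G y ^ 2) η]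
        simp only [Pi.mul_apply, mul_pow]
    _ = (∫⁻ η, ∫⁻ y, β η y ^ 2 * F y ^ 2) * ∫⁻ y, G y ^ 2 := by
        rw [lintegral_mul_const]
        refine Measurable.lintegral_prod_right' (f := fun p : ℝ × ℝ ↦ β p.1 p.2 ^ 2 * F p.2 ^ 2) ?_
        fun_prop
    _ = (∫⁻ y, ∫⁻ η, β η y ^ 2 * F y ^ 2) * ∫⁻ y, G y ^ 2 := by
        rw [lintegral_lintegral_swap]
        apply Measurable.aemeasurable
        simp only [Function.uncurry_def]
        fun_prop
    _ ≤ (∫⁻ y, C * F y ^ 2) * ∫⁻ y, G y ^ 2 := by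
        refine mul_le_mul_left (lintegral_mono fun y ↦ ?_) _
        have h : Measurable fun η ↦ β η y ^ 2 := (hβ.comp measurable_prodMk_right).pow_const 2
        rw [lintegral_mul_const _ h]
        exact mul_le_mul_left (hC y) _
    _ = _ := by
        rw [lintegral_const_mul _ (by fun_prop), mul_assoc]

/-- A nonnegative kernel whose integrals in the second variable are bounded uniformly in the
first. -/
structure UnifInt (A : ℝ → ℝ → ℝ) : Prop where
  measurable : Measurable (Function.uncurry A)
  nonneg : ∀ x y, 0 ≤ A x y
  bound : ∃ C : ℝ≥0, ∀ x, ∫⁻ y, ENNReal.ofReal (A x y) ≤ C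

theorem UnifInt.add {A B : ℝ → ℝ → ℝ} (hA : UnifInt A) (hB : UnifInt B) :
    UnifInt fun x y ↦ A x y + B x y := by
  obtain ⟨C, hC⟩ := hA.bound
  obtain ⟨D, hD⟩ := hB.bound
  refine ⟨hA.measurable.add hB.measurable, fun x y ↦ add_nonneg (hA.nonneg _ _) (hB.nonneg _ _),
    C + D, fun x ↦ ?_⟩
  have h : Measurable fun y ↦ ENNReal.ofReal (A x y) :=
    (hA.measurable.comp measurable_prodMk_left).ennreal_ofReal
  simp_rw [fun y ↦ ENNReal.ofReal_add (hA.nonneg x y) (hB.nonneg x y)]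
  rw [lintegral_add_left h, ENNReal.coe_add]
  exact add_le_add (hC x) (hD x)

theorem UnifInt.const_mul {A : ℝ → ℝ → ℝ} (hA : UnifInt A) {c : ℝ} (hc : 0 ≤ c) :
    UnifInt fun x y ↦ c * A x y := by
  obtain ⟨C, hC⟩ := hA.bound
  refine ⟨hA.measurable.const_mul c, fun x y ↦ mul_nonneg hc (hA.nonneg _ _),
    c.toNNReal * C, fun x ↦ ?_⟩
  simp_rw [fun y ↦ ENNReal.ofReal_mul (q := A x y) hc]
  rw [lintegral_const_mul' _ _ ENNReal.ofReal_ne_top, ENNReal.coe_mul]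
  exact mul_le_mul_right (hC x) _

theorem UnifInt.zero : UnifInt fun _ _ ↦ 0 :=
  ⟨measurable_const, fun _ _ ↦ le_rfl, 0, fun x ↦ by simp⟩

/-- The integrable weight `(1 + x²)^{-2/3}`. The exponent leaves room above `-1`, which the density
interaction needs, and below `-1/2`, which integrability needs. -/
noncomputable def rho (x : ℝ) : ℝ := (1 + x ^ 2) ^ (-(2 / 3) : ℝ)

theorem rho_nonneg (x : ℝ) : 0 ≤ rho x := Real.rpow_nonneg (by positivity) _

theorem continuous_rho : Continuous rho := by
  unfold rho
  exact Continuous.rpow_const (by fun_prop) fun x ↦ Or.inl (by positivity)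

theorem rho_neg (x : ℝ) : rho (-x) = rho x := by simp [rho]

theorem inv_le_rho (x : ℝ) : (1 + x ^ 2)⁻¹ ≤ rho x := by
  rw [rho, ← Real.rpow_neg_one]
  exact Real.rpow_le_rpow_of_exponent_le (by nlinarith [sq_nonneg x]) (by norm_num)

theorem integrable_rho : Integrable rho := by
  have h := integrable_rpow_neg_one_add_norm_sq (E := ℝ) (μ := volume) (r := 4 / 3)
    (by simp; norm_num)
  refine h.congr (Filter.Eventually.of_forall fun x ↦ ?_)
  simp only [rho, Real.norm_eq_abs, sq_abs]
  norm_num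

theorem unifInt_rho : UnifInt fun _ y ↦ rho y :=
  ⟨(continuous_rho.comp continuous_snd).measurable, fun _ y ↦ rho_nonneg y,
    (∫⁻ y, ENNReal.ofReal (rho y)).toNNReal, fun _ ↦ by
      rw [ENNReal.coe_toNNReal]
      exact integrable_rho.lintegral_lt_top.ne⟩

theorem unifInt_rho_sub : UnifInt fun x y ↦ rho (x - y) := by
  obtain ⟨C, hC⟩ := unifInt_rho.bound
  refine ⟨(continuous_rho.comp (continuous_fst.sub continuous_snd)).measurable,
    fun x y ↦ rho_nonneg _, C, fun x ↦ ?_⟩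
  rw [lintegral_sub_left_eq_self (fun y ↦ ENNReal.ofReal (rho y)) x]
  exact hC 0

/-- The rescaled Cauchy kernel `r / (1 + r²x²)`, of integral `π` for `r > 0`. -/
noncomputable def cauchyKernel (r x : ℝ) : ℝ := r / (1 + (r * x) ^ 2)

theorem lintegral_inv_one_add_sq :
    ∫⁻ x : ℝ, ENNReal.ofReal (1 + x ^ 2)⁻¹ = ENNReal.ofReal Real.pi := by
  rw [← ofReal_integral_eq_lintegral_ofReal integrable_inv_one_add_sq
    (Filter.Eventually.of_forall fun x ↦ by positivity), integral_univ_inv_one_add_sq]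

theorem lintegral_cauchyKernel_le (r c : ℝ) :
    ∫⁻ x, ENNReal.ofReal (cauchyKernel r (x - c)) ≤ ENNReal.ofReal Real.pi := by
  rw [lintegral_sub_right_eq_self (fun x ↦ ENNReal.ofReal (cauchyKernel r x)) c]
  rcases le_or_gt r 0 with hr | hr
  · have : ∀ x, ENNReal.ofReal (cauchyKernel r x) = 0 := fun x ↦
      ENNReal.ofReal_of_nonpos (div_nonpos_of_nonpos_of_nonneg hr (by positivity))
    simp [this]
  · simp_rw [cauchyKernel, div_eq_mul_inv, ENNReal.ofReal_mul hr.le]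
    rw [lintegral_const_mul' _ _ ENNReal.ofReal_ne_top,
      lintegral_comp_mul_left (fun y ↦ ENNReal.ofReal (1 + y ^ 2)⁻¹) hr, lintegral_inv_one_add_sq,
      ← mul_assoc, ← ENNReal.ofReal_mul hr.le, mul_inv_cancel₀ hr.ne']
    simp

theorem unifInt_cauchyKernel {r c : ℝ → ℝ} (hr : Measurable r) (hc : Measurable c)
    (h0 : ∀ x, 0 ≤ r x) : UnifInt fun x y ↦ cauchyKernel (r x) (y - c x) := by
  refine ⟨?_, fun x y ↦ div_nonneg (h0 x) (by positivity), Real.pi.toNNReal, fun x ↦ ?_⟩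
  · simp only [cauchyKernel, Function.uncurry_def]
    fun_prop
  · exact lintegral_cauchyKernel_le _ _

theorem ofReal_mul_enorm_sq {w : ℝ} (hw : 0 ≤ w) (z : ℂ) :
    ENNReal.ofReal w * ‖z‖ₑ ^ 2 = (ENNReal.ofReal √w * ‖z‖ₑ) ^ 2 := by
  rw [mul_pow, ← ENNReal.ofReal_pow (Real.sqrt_nonneg w), Real.sq_sqrt hw]

theorem energy_eq (s : ℝ) (h : ℝ → ℂ) :
    energy s h = ∫⁻ η, (ENNReal.ofReal √((1 + η ^ 2) ^ s) * ‖h η‖ₑ) ^ 2 :=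
  lintegral_congr fun η ↦ ofReal_mul_enorm_sq (Real.rpow_nonneg (by positivity) _) _

theorem continuous_weight (s : ℝ) : Continuous fun η : ℝ ↦ (1 + η ^ 2) ^ s :=
  Continuous.rpow_const (by fun_prop) fun x ↦ Or.inl (by positivity)

/-- Weighted bilinear estimate: it suffices to split the squared kernel into a part integrable in
`y`, uniformly in `η`, and a part integrable in `η`, uniformly in `y`. -/
theorem exists_energy_bilinear_le {s s₁ s₂ : ℝ} {k : ℝ → ℝ → ℂ} {A B : ℝ → ℝ → ℝ}
    (hA : UnifInt A) (hB : UnifInt fun y η ↦ B η y)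
    (hk : ∀ η y, (1 + η ^ 2) ^ s * ‖k η y‖ ^ 2 ≤
      (A η y + B η y) * ((1 + y ^ 2) ^ s₁ * (1 + (η - y) ^ 2) ^ s₂)) :
    ∃ C : ℝ≥0, ∀ f g : ℝ → ℂ, Measurable f → Measurable g →
      energy s (fun η ↦ ∫ y, k η y * (f y * g (η - y))) ≤ C * (energy s₁ f * energy s₂ g) := by
  obtain ⟨C, hC⟩ := hA.bound
  obtain ⟨D, hD⟩ := hB.bound
  refine ⟨2 * C + 2 * D, fun f g hf hg ↦ ?_⟩
  set α : ℝ → ℝ → ℝ≥0∞ := fun η y ↦ ENNReal.ofReal √(A η y) with hαdef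
  set β : ℝ → ℝ → ℝ≥0∞ := fun η y ↦ ENNReal.ofReal √(B η y) with hβdef
  set F : ℝ → ℝ≥0∞ := fun y ↦ ENNReal.ofReal √((1 + y ^ 2) ^ s₁) * ‖f y‖ₑ with hFdef
  set G : ℝ → ℝ≥0∞ := fun y ↦ ENNReal.ofReal √((1 + y ^ 2) ^ s₂) * ‖g y‖ₑ with hGdef
  have hB0 : ∀ η y, 0 ≤ B η y := fun η y ↦ hB.nonneg y η
  have hBm : Measurable (Function.uncurry B) := hB.measurable.comp measurable_swap
  have hα : Measurable (Function.uncurry α) := hA.measurable.sqrt.ennreal_ofReal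
  have hβ : Measurable (Function.uncurry β) := hBm.sqrt.ennreal_ofReal
  have hF : Measurable F :=
    ((continuous_weight s₁).measurable.sqrt.ennreal_ofReal).mul hf.enorm
  have hG : Measurable G :=
    ((continuous_weight s₂).measurable.sqrt.ennreal_ofReal).mul hg.enorm
  have hα2 : ∀ η, ∫⁻ y, α η y ^ 2 ≤ C := fun η ↦ by
    simp_rw [hαdef, ← ENNReal.ofReal_pow (Real.sqrt_nonneg _),
      fun y ↦ Real.sq_sqrt (hA.nonneg η y)]
    exact hC η
  have hβ2 : ∀ y, ∫⁻ η, β η y ^ 2 ≤ D := fun y ↦ by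
    simp_rw [hβdef, ← ENNReal.ofReal_pow (Real.sqrt_nonneg _),
      fun η ↦ Real.sq_sqrt (hB0 η y)]
    exact hD y
  have hαη : ∀ η, Measurable (α η) := fun η ↦ hα.comp measurable_prodMk_left
  have hα' : Measurable fun p : ℝ × ℝ ↦ α p.1 p.2 := hα
  have hβ' : Measurable fun p : ℝ × ℝ ↦ β p.1 p.2 := hβ
  have hpt : ∀ η y, ENNReal.ofReal √((1 + η ^ 2) ^ s) * ‖k η y * (f y * g (η - y))‖ₑ ≤
      α η y * (F y * G (η - y)) + β η y * (F y * G (η - y)) := by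
    intro η y
    have w : ∀ (x t : ℝ), 0 ≤ (1 + x ^ 2) ^ t := fun x t ↦ Real.rpow_nonneg (by positivity) _
    have h1 : √((1 + η ^ 2) ^ s) * ‖k η y‖ ≤ (√(A η y) + √(B η y)) *
        (√((1 + y ^ 2) ^ s₁) * √((1 + (η - y) ^ 2) ^ s₂)) := by
      have h2 := Real.sqrt_le_sqrt (hk η y)
      rw [Real.sqrt_mul (w _ _), Real.sqrt_sq (norm_nonneg _), Real.sqrt_mul
        (add_nonneg (hA.nonneg _ _) (hB0 _ _)), Real.sqrt_mul (w _ _)] at h2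
      refine h2.trans ?_
      gcongr
      rw [Real.sqrt_le_left (by positivity), add_sq, Real.sq_sqrt (hA.nonneg _ _),
        Real.sq_sqrt (hB0 _ _)]
      nlinarith [mul_nonneg (Real.sqrt_nonneg (A η y)) (Real.sqrt_nonneg (B η y))]
    have h3 := ENNReal.ofReal_le_ofReal h1
    rw [ENNReal.ofReal_mul (Real.sqrt_nonneg _), ENNReal.ofReal_mul (by positivity),
      ENNReal.ofReal_add (Real.sqrt_nonneg _) (Real.sqrt_nonneg _),
      ENNReal.ofReal_mul (Real.sqrt_nonneg _), ofReal_norm] at h3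
    calc ENNReal.ofReal √((1 + η ^ 2) ^ s) * ‖k η y * (f y * g (η - y))‖ₑ
        = ENNReal.ofReal √((1 + η ^ 2) ^ s) * ‖k η y‖ₑ * (‖f y‖ₑ * ‖g (η - y)‖ₑ) := by
          rw [enorm_mul, enorm_mul, mul_assoc]
      _ ≤ _ := mul_le_mul_left h3 _
      _ = _ := by simp only [hαdef, hβdef, hFdef, hGdef]; ring
  have hE : energy s (fun η ↦ ∫ y, k η y * (f y * g (η - y))) ≤
      ∫⁻ η, (2 * (∫⁻ y, α η y * (F y * G (η - y))) ^ 2 +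
        2 * (∫⁻ y, β η y * (F y * G (η - y))) ^ 2) := by
    rw [energy_eq]
    refine lintegral_mono fun η ↦ ?_
    refine le_trans ?_ (add_sq_le_two_mul _ _)
    refine pow_le_pow_left' ?_ 2
    calc _ ≤ ENNReal.ofReal √((1 + η ^ 2) ^ s) * ∫⁻ y, ‖k η y * (f y * g (η - y))‖ₑ :=
          mul_le_mul_right (enorm_integral_le_lintegral_enorm _) _
      _ = ∫⁻ y, ENNReal.ofReal √((1 + η ^ 2) ^ s) * ‖k η y * (f y * g (η - y))‖ₑ :=
          (lintegral_const_mul' _ _ ENNReal.ofReal_ne_top).symm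
      _ ≤ _ := lintegral_mono (hpt η)
      _ = _ := lintegral_add_left ((hαη η).mul (by fun_prop)) _
  refine hE.trans ?_
  have hm : Measurable fun η ↦ 2 * (∫⁻ y, α η y * (F y * G (η - y))) ^ 2 := by
    refine ((Measurable.lintegral_prod_right'
      (f := fun p : ℝ × ℝ ↦ α p.1 p.2 * (F p.2 * G (p.1 - p.2))) ?_).pow_const 2).const_mul 2
    fun_prop
  rw [lintegral_add_left hm, lintegral_const_mul' _ _ (by norm_num),
    lintegral_const_mul' _ _ (by norm_num), energy_eq s₁ f, energy_eq s₂ g]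
  have e1 := lintegral_sq_le_of_inner hα hF hG hα2
  have e2 := lintegral_sq_le_of_outer hβ hF hG hβ2
  calc _ ≤ 2 * (C * ((∫⁻ y, F y ^ 2) * ∫⁻ y, G y ^ 2)) +
        2 * (D * ((∫⁻ y, F y ^ 2) * ∫⁻ y, G y ^ 2)) := by gcongr
    _ = _ := by push_cast; ring

/-! ### Sufficiency: the mixed interaction -/

/-- Powers of comparable numbers are comparable, whatever the sign of the exponent. -/
theorem rpow_le_mul_rpow {a b K s : ℝ} (ha : 0 < a) (hb : 0 < b) (hK : 1 ≤ K) (hab : a ≤ K * b)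
    (hba : b ≤ K * a) : a ^ s ≤ K ^ |s| * b ^ s := by
  have hK0 : 0 < K := by linarith
  rcases le_total 0 s with hs | hs
  · rw [abs_of_nonneg hs, ← Real.mul_rpow hK0.le hb.le]
    exact Real.rpow_le_rpow ha.le hab hs
  · have h1 : b / K ≤ a := by rw [div_le_iff₀ hK0]; linarith
    have h2 := Real.rpow_le_rpow_of_nonpos (by positivity) h1 hs
    rw [Real.div_rpow hb.le hK0.le] at h2
    rw [abs_of_nonpos hs, Real.rpow_neg hK0.le, mul_comm, ← div_eq_mul_inv]
    exact h2

theorem rpow_le_mul_rpow_of_nonneg {a b K s : ℝ} (ha : 0 ≤ a) (hb : 0 ≤ b) (hK : 0 ≤ K)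
    (hab : a ≤ K * b) (hs : 0 ≤ s) : a ^ s ≤ K ^ s * b ^ s := by
  rw [← Real.mul_rpow hK hb]
  exact Real.rpow_le_rpow ha hab hs

theorem cauchyKernel_neg (r x : ℝ) : cauchyKernel r (-x) = cauchyKernel r x := by
  simp [cauchyKernel]

theorem cauchyKernel_nonneg {r : ℝ} (hr : 0 ≤ r) (x : ℝ) : 0 ≤ cauchyKernel r x :=
  div_nonneg hr (by positivity)

/-- The discriminant `D = 1/4 - 2p` of the resonance function `k² - εk + 2p`, `ε = ±1`, whose zeros
in `k` are `ε/2 ± √D`; it is truncated at `0`, where there are no zeros. -/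
noncomputable def resParam (p : ℝ) : ℝ := max (1 / 4 - 2 * p) 0

/-- Two Cauchy kernels concentrated at the zeros in `k` of `k² - εk + 2p`. -/
noncomputable def resKernel (ε p k : ℝ) : ℝ :=
  cauchyKernel (resParam p) (k - (ε / 2 + √(resParam p))) +
    cauchyKernel (resParam p) (k - (ε / 2 - √(resParam p)))

theorem resParam_nonneg (p : ℝ) : 0 ≤ resParam p := le_max_right _ _

theorem resKernel_nonneg (ε p k : ℝ) : 0 ≤ resKernel ε p k :=
  add_nonneg (cauchyKernel_nonneg (resParam_nonneg _) _) (cauchyKernel_nonneg (resParam_nonneg _) _)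

theorem measurable_resParam : Measurable resParam := by unfold resParam; fun_prop

theorem unifInt_resKernel (ε : ℝ) : UnifInt fun p η ↦ resKernel ε p η := by
  have h := measurable_resParam
  exact (unifInt_cauchyKernel h (by fun_prop) resParam_nonneg).add
    (unifInt_cauchyKernel h (by fun_prop) resParam_nonneg)

theorem unifInt_resKernel_shift (ε : ℝ) : UnifInt fun p η ↦ resKernel ε p (η - p) := by
  have h := measurable_resParam
  have := (unifInt_cauchyKernel (r := resParam) (c := fun p ↦ p + (ε / 2 + √(resParam p))) h
    (by fun_prop) resParam_nonneg).add
    (unifInt_cauchyKernel (r := resParam) (c := fun p ↦ p + (ε / 2 - √(resParam p))) h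
    (by fun_prop) resParam_nonneg)
  simpa only [resKernel, sub_sub] using this

theorem unifInt_resKernel_reflect (ε : ℝ) : UnifInt fun p y ↦ resKernel ε p (p - y) := by
  have h := measurable_resParam
  have := (unifInt_cauchyKernel (r := resParam) (c := fun p ↦ p - (ε / 2 + √(resParam p))) h
    (by fun_prop) resParam_nonneg).add
    (unifInt_cauchyKernel (r := resParam) (c := fun p ↦ p - (ε / 2 - √(resParam p))) h
    (by fun_prop) resParam_nonneg)
  have e : ∀ p y c : ℝ, cauchyKernel (resParam p) (y - (p - c)) =
      cauchyKernel (resParam p) (p - y - c) := fun p y c ↦ by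
    rw [← cauchyKernel_neg]; congr 1; ring
  simpa only [resKernel, e] using this

/-- Near resonance the squared time factor, times `k²`, is controlled by the two Cauchy kernels at
the zeros of the resonance function. -/
theorem resonant_le_resKernel {ε p k w : ℝ} (hε : |ε| = 1) (hk : 4 ≤ |k|)
    (hw : w = k ^ 2 - ε * k + 2 * p) (hwk : |w| ≤ k ^ 2 / 4) :
    k ^ 2 / (1 + (k * w) ^ 2) ≤ 4 * resKernel ε p k := by
  have hε2 : ε ^ 2 = 1 := by rw [← sq_abs, hε, one_pow]
  set κ := k - ε / 2 with hκ
  have hεk : |ε * k| = |k| := by rw [abs_mul, hε, one_mul]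
  have h1 := abs_le.1 hεk.le
  have hk2 : 4 * |k| ≤ k ^ 2 := by rw [← sq_abs k]; nlinarith
  have hk16 : 16 ≤ k ^ 2 := by nlinarith
  have hwl := abs_le.1 hwk
  have hD0 : 1 / 4 - 2 * p = κ ^ 2 - w := by rw [hw, hκ]; linear_combination -(1 / 4) * hε2
  have hκ2 : κ ^ 2 = k ^ 2 - ε * k + 1 / 4 := by rw [hκ]; linear_combination (1 / 4) * hε2
  have hDlo : k ^ 2 / 2 ≤ 1 / 4 - 2 * p := by rw [hD0, hκ2]; linarith [h1.2]
  have hDhi : 1 / 4 - 2 * p ≤ 2 * k ^ 2 := by rw [hD0, hκ2]; linarith [h1.1]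
  have hDp : 0 < 1 / 4 - 2 * p := by linarith
  have hD : resParam p = 1 / 4 - 2 * p := max_eq_left hDp.le
  set D := resParam p with hDdef
  rw [← hD] at hDlo hDhi hDp hD0
  set r := √D with hr
  have hr0 : 0 < r := Real.sqrt_pos.2 hDp
  have hr2 : r ^ 2 = D := Real.sq_sqrt hDp.le
  have hwf : w = (κ - r) * (κ + r) := by linear_combination hD0 + hr2
  -- `x` is the distance from `κ` to the nearer root `± r`
  have main : ∀ x, x ^ 2 * D ≤ w ^ 2 → k ^ 2 / (1 + (k * w) ^ 2) ≤ 4 * cauchyKernel D x := by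
    intro x hx
    have h2 : D * (x ^ 2 * D) ≤ 2 * k ^ 2 * w ^ 2 :=
      mul_le_mul hDhi hx (by positivity) (by positivity)
    rw [cauchyKernel, mul_div_assoc', div_le_div_iff₀ (by positivity) (by positivity)]
    have h3 : 1 + (D * x) ^ 2 ≤ 2 * (1 + (k * w) ^ 2) := by nlinarith
    calc k ^ 2 * (1 + (D * x) ^ 2) ≤ (2 * D) * (2 * (1 + (k * w) ^ 2)) := by
          apply mul_le_mul (by linarith) h3 (by positivity) (by positivity)
      _ = _ := by ring
  have n1 := cauchyKernel_nonneg (r := D) hDp.le (k - (ε / 2 + r))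
  have n2 := cauchyKernel_nonneg (r := D) hDp.le (k - (ε / 2 - r))
  have hres : resKernel ε p k = cauchyKernel D (k - (ε / 2 + r)) +
    cauchyKernel D (k - (ε / 2 - r)) := rfl
  rw [hres]
  rcases le_total 0 κ with h0 | h0
  · have := main (k - (ε / 2 + r)) (by
      rw [show k - (ε / 2 + r) = κ - r by rw [hκ]; ring, hwf, mul_pow, ← hr2]
      gcongr
      linarith)
    linarith
  · have := main (k - (ε / 2 - r)) (by
      rw [show k - (ε / 2 - r) = κ + r by rw [hκ]; ring, hwf, mul_pow, ← hr2,
        mul_comm ((κ - r) ^ 2), ← neg_sq (κ - r)]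
      gcongr
      linarith)
    linarith

/-- Low Airy frequency. Here and in the next two lemmas `a`, `b`, `c` are the weights `1 + ξ²` of
the two Schrödinger frequencies and of the Airy frequency, and `o` is the squared time factor. -/
theorem mixed_low_le {a b c o r τ s : ℝ} (hτ : 0 ≤ τ) (ha : 0 < a) (hb : 0 < b) (hc1 : 1 ≤ c)
    (hc17 : c ≤ 17) (habc : a ≤ 2 * b * c) (ho8 : o ≤ 8) (hr : c⁻¹ ≤ r) :
    a ^ τ * o ≤ 8 * 34 ^ τ * 17 ^ |s| * 17 * r * (b ^ τ * c ^ s) := by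
  have hc0 : 0 < c := by linarith
  have e1 : a ^ τ ≤ 34 ^ τ * b ^ τ :=
    rpow_le_mul_rpow_of_nonneg ha.le hb.le (by norm_num) (by nlinarith) hτ
  have e2 : (1 : ℝ) ≤ 17 ^ |s| * c ^ s := by
    have := rpow_le_mul_rpow (a := 1) (b := c) (K := 17) (s := s) one_pos hc0 (by norm_num)
      (by linarith) (by linarith)
    rwa [Real.one_rpow] at this
  have e3 : 1 ≤ 17 * r := by
    have : (17 : ℝ)⁻¹ ≤ r := le_trans (inv_anti₀ hc0 hc17) hr
    linarith
  have p0 : 0 ≤ 34 ^ τ * b ^ τ := by positivity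
  calc a ^ τ * o ≤ (34 ^ τ * b ^ τ) * 8 :=
        (mul_le_mul_of_nonneg_left ho8 (by positivity)).trans
          (mul_le_mul_of_nonneg_right e1 (by norm_num))
    _ = (34 ^ τ * b ^ τ) * 8 * 1 := by ring
    _ ≤ (34 ^ τ * b ^ τ) * 8 * ((17 ^ |s| * c ^ s) * (17 * r)) :=
        mul_le_mul_of_nonneg_left (one_le_mul_of_one_le_of_one_le e2 e3) (by positivity)
    _ = _ := by ring

/-- High Airy frequency, away from resonance. -/
theorem mixed_high_le {a b c o r r' τ s : ℝ} (hτ : 0 ≤ τ) (hs1 : -1 ≤ s) (hs3 : τ - 3 ≤ s)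
    (ha : 0 < a) (hb1 : 1 ≤ b) (hc1 : 1 ≤ c) (habc : a ≤ 2 * (b + c))
    (ho : o ≤ 160 * c ^ (-3 : ℝ)) (hr : c⁻¹ ≤ r) (hr' : b⁻¹ ≤ r') :
    a ^ τ * o ≤ 160 * 4 ^ τ * (r + r') * (b ^ τ * c ^ s) := by
  have hc0 : 0 < c := by linarith
  have hb0 : 0 < b := by linarith
  have hr0 : 0 ≤ r := le_trans (by positivity) hr
  have hr0' : 0 ≤ r' := le_trans (by positivity) hr'
  have main : a ^ τ * c ^ (-3 : ℝ) ≤ 4 ^ τ * (r + r') * (b ^ τ * c ^ s) := by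
    rcases le_total c b with hcb | hcb
    · have e1 : a ^ τ ≤ 4 ^ τ * b ^ τ :=
        rpow_le_mul_rpow_of_nonneg ha.le hb0.le (by norm_num) (by linarith) hτ
      have e2 : c ^ (-3 : ℝ) ≤ (r + r') * c ^ s := by
        refine le_trans ?_ (mul_le_mul_of_nonneg_right
          (hr.trans (le_add_of_nonneg_right hr0')) (by positivity))
        rw [← Real.rpow_neg_one, ← Real.rpow_add hc0]
        exact Real.rpow_le_rpow_of_exponent_le hc1 (by linarith)
      calc a ^ τ * c ^ (-3 : ℝ) ≤ (4 ^ τ * b ^ τ) * ((r + r') * c ^ s) :=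
            mul_le_mul e1 e2 (by positivity) (by positivity)
        _ = _ := by ring
    · have e1 : a ^ τ ≤ 4 ^ τ * c ^ τ :=
        rpow_le_mul_rpow_of_nonneg ha.le hc0.le (by norm_num) (by linarith) hτ
      have e2 : c ^ τ * c ^ (-3 : ℝ) ≤ b⁻¹ * (b ^ τ * c ^ s) := by
        rw [← mul_assoc, ← Real.rpow_neg_one, ← Real.rpow_add hb0, ← Real.rpow_add hc0]
        rcases le_total 1 τ with h | h
        · have h1 : (1 : ℝ) ≤ b ^ (-1 + τ) := Real.one_le_rpow hb1 (by linarith)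
          calc c ^ (τ + -3) ≤ 1 * c ^ s := by
                rw [one_mul]; exact Real.rpow_le_rpow_of_exponent_le hc1 (by linarith)
            _ ≤ _ := mul_le_mul_of_nonneg_right h1 (by positivity)
        · have h1 : c ^ (-1 + τ) ≤ b ^ (-1 + τ) :=
            Real.rpow_le_rpow_of_nonpos hb0 hcb (by linarith)
          calc c ^ (τ + -3) ≤ c ^ (-1 + τ) * c ^ s := by
                rw [← Real.rpow_add hc0]
                exact Real.rpow_le_rpow_of_exponent_le hc1 (by linarith)
            _ ≤ _ := mul_le_mul_of_nonneg_right h1 (by positivity)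
      calc a ^ τ * c ^ (-3 : ℝ) ≤ (4 ^ τ * c ^ τ) * c ^ (-3 : ℝ) :=
            mul_le_mul_of_nonneg_right e1 (by positivity)
        _ = 4 ^ τ * (c ^ τ * c ^ (-3 : ℝ)) := by ring
        _ ≤ 4 ^ τ * (b⁻¹ * (b ^ τ * c ^ s)) := mul_le_mul_of_nonneg_left e2 (by positivity)
        _ ≤ 4 ^ τ * ((r + r') * (b ^ τ * c ^ s)) :=
            mul_le_mul_of_nonneg_left (mul_le_mul_of_nonneg_right
              (hr'.trans (le_add_of_nonneg_left hr0)) (by positivity)) (by positivity)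
        _ = _ := by ring
  calc a ^ τ * o ≤ a ^ τ * (160 * c ^ (-3 : ℝ)) := mul_le_mul_of_nonneg_left ho (by positivity)
    _ = 160 * (a ^ τ * c ^ (-3 : ℝ)) := by ring
    _ ≤ 160 * (4 ^ τ * (r + r') * (b ^ τ * c ^ s)) := by linarith
    _ = _ := by ring

/-- High Airy frequency near resonance: the loss `c⁻¹ ≤ c ^ s` is paid for by the factor `M ≈ c`
that the time factor gains. -/
theorem mixed_resonant_le {a b c o R M τ s : ℝ} (hτ : 0 ≤ τ) (hs1 : -1 ≤ s)
    (ha : 0 < a) (hb : 0 < b) (hc1 : 1 ≤ c) (hab : a ≤ 4 * b) (hcM : c ≤ 2 * M)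
    (ho0 : 0 ≤ o) (ho : M * o ≤ 32 * R) :
    a ^ τ * o ≤ 64 * 4 ^ τ * R * (b ^ τ * c ^ s) := by
  have hc0 : 0 < c := by linarith
  have e1 : a ^ τ ≤ 4 ^ τ * b ^ τ :=
    rpow_le_mul_rpow_of_nonneg ha.le hb.le (by norm_num) hab hτ
  have e2 : 1 ≤ 2 * M * c ^ s := by
    have : c ^ (-1 : ℝ) ≤ c ^ s := Real.rpow_le_rpow_of_exponent_le hc1 hs1
    rw [Real.rpow_neg_one] at this
    calc (1 : ℝ) = c * c⁻¹ := (mul_inv_cancel₀ hc0.ne').symm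
      _ ≤ 2 * M * c ^ s := mul_le_mul hcM this (by positivity) (by linarith)
  calc a ^ τ * o ≤ (4 ^ τ * b ^ τ * o) * 1 := by
        rw [mul_one]; exact mul_le_mul_of_nonneg_right e1 ho0
    _ ≤ (4 ^ τ * b ^ τ * o) * (2 * M * c ^ s) := mul_le_mul_of_nonneg_left e2 (by positivity)
    _ = 2 * 4 ^ τ * (b ^ τ * c ^ s) * (M * o) := by ring
    _ ≤ 2 * 4 ^ τ * (b ^ τ * c ^ s) * (32 * R) := mul_le_mul_of_nonneg_left ho (by positivity)
    _ = _ := by ring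

/-- Kernel bound for the Schrödinger–Airy interaction. Here `k` is the Airy frequency and `p`, `q`
are the two Schrödinger frequencies, the weight falling on `p`. -/
theorem exists_mixed_kernel_le {τ s ε : ℝ} (hτ : 0 ≤ τ) (hs1 : -1 ≤ s) (hs3 : τ - 3 ≤ s)
    (hε : |ε| = 1) :
    ∃ C, 0 ≤ C ∧ ∀ p q k : ℝ, p = q + ε * k →
      (1 + p ^ 2) ^ τ * ‖osc (k * (2 * p - ε * k + k ^ 2))‖ ^ 2 ≤
        C * (rho k + rho q + resKernel ε p k) * ((1 + q ^ 2) ^ τ * (1 + k ^ 2) ^ s) := by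
  refine ⟨8 * 34 ^ τ * 17 ^ |s| * 17 + 160 * 4 ^ τ + 64 * 4 ^ τ, by positivity, ?_⟩
  intro p q k hpq
  have hε2 : ε ^ 2 = 1 := by rw [← sq_abs, hε, one_pow]
  obtain ⟨w, hw⟩ : ∃ w, w = 2 * p - ε * k + k ^ 2 := ⟨_, rfl⟩
  rw [← hw]
  have ha1 : 1 ≤ 1 + p ^ 2 := by nlinarith [sq_nonneg p]
  have hb1 : 1 ≤ 1 + q ^ 2 := by nlinarith [sq_nonneg q]
  have hc1 : 1 ≤ 1 + k ^ 2 := by nlinarith [sq_nonneg k]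
  have habc : 1 + p ^ 2 ≤ 2 * (1 + q ^ 2) * (1 + k ^ 2) := by
    have := one_add_sq_le_mul q (ε * k)
    rw [← hpq, mul_pow, hε2, one_mul] at this
    exact this
  have habc' : 1 + p ^ 2 ≤ 2 * ((1 + q ^ 2) + (1 + k ^ 2)) := by
    have h1 : (ε * k) ^ 2 = k ^ 2 := by rw [mul_pow, hε2, one_mul]
    rw [hpq]
    nlinarith [sq_nonneg (q - ε * k)]
  have hR := resKernel_nonneg ε p k
  have hρk := rho_nonneg k
  have hρq := rho_nonneg q
  have hosc0 := norm_nonneg (osc (k * w))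
  have hosc1 := norm_osc_le_one (k * w)
  have hosc := norm_osc_sq_le (k * w)
  have hW : 0 ≤ (1 + q ^ 2) ^ τ * (1 + k ^ 2) ^ s := by positivity
  have hC₁0 : (0 : ℝ) ≤ 8 * 34 ^ τ * 17 ^ |s| * 17 := by positivity
  have hC₂0 : (0 : ℝ) ≤ 160 * 4 ^ τ := by positivity
  have hC₃0 : (0 : ℝ) ≤ 64 * 4 ^ τ := by positivity
  rcases le_or_gt |k| 4 with hk | hk
  · have hc17 : 1 + k ^ 2 ≤ 17 := by rw [← sq_abs]; nlinarith [abs_nonneg k]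
    refine (mixed_low_le (s := s) hτ (by linarith) (by linarith) hc1 hc17 habc
      (by nlinarith : ‖osc (k * w)‖ ^ 2 ≤ 8) (inv_le_rho k)).trans ?_
    exact mul_le_mul_of_nonneg_right (mul_le_mul (by linarith) (by linarith) hρk (by linarith)) hW
  have hkk : 4 * |k| ≤ k ^ 2 := by rw [← sq_abs k]; nlinarith
  have hk16 : 16 ≤ k ^ 2 := by nlinarith
  rcases le_total |w| (k ^ 2 / 4) with hwk | hwk
  · -- resonant region: both Schrödinger frequencies have size `k²`
    have r1 := resonant_le_resKernel hε hk.le (w := w) (by rw [hw]; ring) hwk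
    have hεk : |ε * k| = |k| := by rw [abs_mul, hε, one_mul]
    have h1 := abs_le.1 hεk.le
    have hq : k ^ 2 / 4 ≤ |q| := by
      have : 2 * q = w - ε * k - k ^ 2 := by rw [hw, hpq]; ring
      have h2 : k ^ 2 / 2 ≤ -(2 * q) := by rw [this]; linarith [(abs_le.1 hwk).2, h1.1]
      have := neg_le_abs q
      linarith
    have hp : |p| ≤ 2 * |q| := by
      rw [hpq]
      refine (abs_add_le _ _).trans ?_
      rw [hεk]; linarith
    have hab : 1 + p ^ 2 ≤ 4 * (1 + q ^ 2) := by
      rw [← sq_abs p, ← sq_abs q]; nlinarith [abs_nonneg p]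
    have ho : k ^ 2 * ‖osc (k * w)‖ ^ 2 ≤ 32 * resKernel ε p k := by
      have := mul_le_mul_of_nonneg_left hosc (sq_nonneg k)
      rw [mul_div_left_comm] at this
      linarith
    refine (mixed_resonant_le (s := s) hτ hs1 (by linarith) (by linarith) hc1 hab
      (by linarith : 1 + k ^ 2 ≤ 2 * k ^ 2) (by positivity) ho).trans ?_
    exact mul_le_mul_of_nonneg_right (mul_le_mul (by linarith) (by linarith) hR (by linarith)) hW
  · have e0 : ‖osc (k * w)‖ ^ 2 ≤ 160 * (1 + k ^ 2) ^ (-3 : ℝ) := by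
      have h1 : k ^ 4 / 16 ≤ w ^ 2 := by
        rw [← sq_abs w]; nlinarith [sq_nonneg k]
      have h2 : k ^ 6 / 16 ≤ (k * w) ^ 2 := by nlinarith [sq_nonneg k]
      have h3 : (1 + k ^ 2) ^ 3 ≤ (17 / 16) ^ 3 * k ^ 6 := by
        have : 1 + k ^ 2 ≤ 17 / 16 * k ^ 2 := by linarith
        calc (1 + k ^ 2) ^ 3 ≤ (17 / 16 * k ^ 2) ^ 3 := by gcongr
          _ = _ := by ring
      have h4 : (1 + k ^ 2) ^ (-3 : ℝ) = 1 / (1 + k ^ 2) ^ 3 := by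
        rw [Real.rpow_neg (by positivity), one_div]; norm_cast
      rw [h4]
      refine hosc.trans ?_
      rw [mul_one_div, div_le_div_iff₀ (by positivity) (by positivity)]
      have h5 : (1 + k ^ 2) ^ 3 ≤ 20 * (1 + (k * w) ^ 2) := by
        refine h3.trans ?_
        linarith [sq_nonneg (k * w)]
      linarith
    refine (mixed_high_le hτ hs1 hs3 (by linarith) hb1 hc1 habc' e0 (inv_le_rho k)
      (inv_le_rho q)).trans ?_
    exact mul_le_mul_of_nonneg_right
      (mul_le_mul (by linarith) (by linarith) (by linarith) (by linarith)) hW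

theorem mixed_sufficient {s₁ s₂ : ℝ} (h : max (-1) (-3 + |s₁|) ≤ s₂) :
    ∃ C : ℝ≥0, ∀ f g : 𝓢(ℝ, ℂ), energy s₁ (mixedForm f g) ≤ C * (energy s₁ f * energy s₂ g) := by
  obtain ⟨h1, h3⟩ := max_le_iff.1 h
  have key : ∃ A B : ℝ → ℝ → ℝ, UnifInt A ∧ UnifInt (fun y η ↦ B η y) ∧ ∀ η y,
      (1 + η ^ 2) ^ s₁ * ‖osc ((η - y) * (2 * η - (η - y) + (η - y) ^ 2))‖ ^ 2 ≤
      (A η y + B η y) * ((1 + y ^ 2) ^ s₁ * (1 + (η - y) ^ 2) ^ s₂) := by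
    rcases le_total 0 s₁ with hs | hs
    · rw [abs_of_nonneg hs] at h3
      obtain ⟨C, hC, hb⟩ := exists_mixed_kernel_le (ε := 1) hs h1 (by linarith) (by simp)
      refine ⟨_, _, ((unifInt_rho_sub.add unifInt_rho).add
        (unifInt_resKernel_reflect 1)).const_mul hC, UnifInt.zero, fun η y ↦ ?_⟩
      have := hb η y (η - y) (by ring)
      rw [one_mul] at this
      simpa using this
    · rw [abs_of_nonpos hs] at h3
      obtain ⟨C, hC, hb⟩ := exists_mixed_kernel_le (ε := -1) (τ := -s₁) (by linarith) h1
        (by linarith) (by simp)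
      have u1 : UnifInt fun y η ↦ rho (η - y) := by
        have := unifInt_rho_sub
        have e : ∀ x y : ℝ, rho (x - y) = rho (y - x) := fun x y ↦ by rw [← rho_neg, neg_sub]
        simpa only [e] using this
      refine ⟨_, fun η y ↦ C * (rho (η - y) + rho η + resKernel (-1) y (η - y)), UnifInt.zero,
        ((u1.add unifInt_rho).add (unifInt_resKernel_shift (-1))).const_mul hC, fun η y ↦ ?_⟩
      have := hb y η (η - y) (by ring)
      rw [show 2 * y - -1 * (η - y) + (η - y) ^ 2 = 2 * η - (η - y) + (η - y) ^ 2 by ring,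
        Real.rpow_neg (by positivity), Real.rpow_neg (by positivity)] at this
      have p1 : (0 : ℝ) < (1 + η ^ 2) ^ s₁ := Real.rpow_pos_of_pos (by positivity) _
      have p2 : (0 : ℝ) < (1 + y ^ 2) ^ s₁ := Real.rpow_pos_of_pos (by positivity) _
      have h4 := mul_le_mul_of_nonneg_left this (mul_pos p1 p2).le
      rw [zero_add]
      calc _ = (1 + η ^ 2) ^ s₁ * (1 + y ^ 2) ^ s₁ * (((1 + y ^ 2) ^ s₁)⁻¹ *
            ‖osc ((η - y) * (2 * η - (η - y) + (η - y) ^ 2))‖ ^ 2) := by field_simp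
        _ ≤ _ := h4
        _ = _ := by field_simp
  obtain ⟨A, B, hA, hB, hk⟩ := key
  obtain ⟨C, hC⟩ := exists_energy_bilinear_le hA hB hk
  exact ⟨C, fun f g ↦ hC f g f.continuous.measurable g.continuous.measurable⟩

/-! ### Sufficiency: the self-interaction of the Airy flow -/

/-- Both inputs at high frequency: with `a`, `b`, `c` the weights of the output and of the two
inputs, the time factor recovers the derivative and one power of the weights of both inputs. -/
theorem kdv_high_le {a b c o r s : ℝ} (hs : -1 ≤ s) (ha : 0 < a) (hb : 0 < b) (hc : 0 < c)
    (habc : a ≤ 2 * (b * c)) (ho : o ≤ 4 / (b * c)) (hr : a⁻¹ ≤ r) :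
    a ^ s * o ≤ 4 * 2 ^ (s + 1) * r * (b ^ s * c ^ s) := by
  have hbc : 0 < b * c := by positivity
  have e1 : a ^ (s + 1) ≤ 2 ^ (s + 1) * (b * c) ^ (s + 1) :=
    rpow_le_mul_rpow_of_nonneg ha.le hbc.le (by norm_num) habc (by linarith)
  have e2 : a ^ s = a ^ (s + 1) * a⁻¹ := by
    rw [← Real.rpow_neg_one, ← Real.rpow_add ha]; congr 1; ring
  have e3 : (b * c) ^ (s + 1) = (b ^ s * c ^ s) * (b * c) := by
    rw [Real.rpow_add hbc, Real.rpow_one, Real.mul_rpow hb.le hc.le]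
  have hr0 : 0 ≤ r := le_trans (by positivity) hr
  calc a ^ s * o ≤ a ^ s * (4 / (b * c)) := mul_le_mul_of_nonneg_left ho (by positivity)
    _ = a ^ (s + 1) * (a⁻¹ * (4 / (b * c))) := by rw [e2]; ring
    _ ≤ (2 ^ (s + 1) * (b * c) ^ (s + 1)) * (r * (4 / (b * c))) :=
        mul_le_mul e1 (mul_le_mul_of_nonneg_right hr (by positivity)) (by positivity)
          (by positivity)
    _ = _ := by rw [e3]; field_simp

/-- The case of one low input frequency `y`; the kernel is then concentrated on `|y| ≲ η⁻²`. -/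
theorem kdv_low_le {η y z s : ℝ} (hz : z = η - y) (hy : |y| ≤ 1) :
    (1 + η ^ 2) ^ s * (η ^ 2 * ‖osc (-(3 * η * y * z))‖ ^ 2) ≤
      4 ^ |s| * 2 ^ |s| * 8 * (rho y + cauchyKernel (η ^ 2) y) *
        ((1 + y ^ 2) ^ s * (1 + z ^ 2) ^ s) := by
  have hy2 : y ^ 2 ≤ 1 := by rw [← sq_abs]; nlinarith [abs_nonneg y]
  have e1 : (1 + η ^ 2) ^ s ≤ 4 ^ |s| * (1 + z ^ 2) ^ s := by
    refine rpow_le_mul_rpow (by positivity) (by positivity) (by norm_num) ?_ ?_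
    · have := one_add_sq_le_mul y z
      rw [hz, add_sub_cancel] at this
      rw [hz]; nlinarith [sq_nonneg (η - y)]
    · have := one_add_sq_le_mul η (-y)
      rw [hz, sub_eq_add_neg]; nlinarith [sq_nonneg η]
  have e2 : 1 ≤ 2 ^ |s| * (1 + y ^ 2) ^ s := by
    have := rpow_le_mul_rpow (a := 1) (b := 1 + y ^ 2) (K := 2) (s := s) one_pos (by positivity)
      (by norm_num) (by nlinarith) (by linarith)
    rwa [Real.one_rpow] at this
  have hρ := rho_nonneg y
  have hκ := cauchyKernel_nonneg (sq_nonneg η) y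
  have e3 : η ^ 2 * ‖osc (-(3 * η * y * z))‖ ^ 2 ≤ 8 * (rho y + cauchyKernel (η ^ 2) y) := by
    have hosc0 := norm_nonneg (osc (-(3 * η * y * z)))
    have hosc1 := norm_osc_le_one (-(3 * η * y * z))
    rcases le_or_gt |η| 2 with hη | hη
    · have h4 : η ^ 2 ≤ 4 := by rw [← sq_abs]; nlinarith [abs_nonneg η]
      have h2 : 1 / 2 ≤ rho y := by
        refine le_trans ?_ (inv_le_rho y)
        rw [one_div]
        exact inv_anti₀ (by positivity) (by linarith)
      have h5 : ‖osc (-(3 * η * y * z))‖ ^ 2 ≤ 1 := by nlinarith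
      nlinarith [sq_nonneg η]
    · have hz2 : η ^ 2 / 4 ≤ z ^ 2 := by
        have : |η| / 2 ≤ |z| := by
          have := abs_sub_abs_le_abs_sub η y
          rw [hz]; linarith
        rw [← sq_abs z, ← sq_abs η]; nlinarith [abs_nonneg η]
      have h6 : (η ^ 2 * y) ^ 2 ≤ (-(3 * η * y * z)) ^ 2 := by
        have : (-(3 * η * y * z)) ^ 2 = (η * y) ^ 2 * (9 * z ^ 2) := by ring
        rw [this, show (η ^ 2 * y) ^ 2 = (η * y) ^ 2 * η ^ 2 by ring]
        exact mul_le_mul_of_nonneg_left (by linarith [sq_nonneg η]) (by positivity)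
      have h7 := mul_le_mul_of_nonneg_left (norm_osc_sq_le (-(3 * η * y * z))) (sq_nonneg η)
      have h8 : η ^ 2 * (8 / (1 + (-(3 * η * y * z)) ^ 2)) ≤ 8 * cauchyKernel (η ^ 2) y := by
        rw [cauchyKernel, mul_div_left_comm]
        gcongr
      linarith
  calc _ ≤ (4 ^ |s| * (1 + z ^ 2) ^ s) * (8 * (rho y + cauchyKernel (η ^ 2) y)) :=
        mul_le_mul e1 e3 (by positivity) (by positivity)
    _ = (4 ^ |s| * (1 + z ^ 2) ^ s) * (8 * (rho y + cauchyKernel (η ^ 2) y)) * 1 := by ring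
    _ ≤ (4 ^ |s| * (1 + z ^ 2) ^ s) * (8 * (rho y + cauchyKernel (η ^ 2) y)) *
        (2 ^ |s| * (1 + y ^ 2) ^ s) := mul_le_mul_of_nonneg_left e2 (by positivity)
    _ = _ := by ring

theorem kdv_sufficient {s : ℝ} (hs : -1 ≤ s) :
    ∃ C : ℝ≥0, ∀ g : 𝓢(ℝ, ℂ), energy s (kdvForm g) ≤ C * energy s g ^ 2 := by
  set c₁ : ℝ := 4 ^ |s| * 2 ^ |s| * 8 with hc₁
  set c₂ : ℝ := 4 * 2 ^ (s + 1) with hc₂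
  have hc₁0 : 0 ≤ c₁ := by positivity
  have hc₂0 : 0 ≤ c₂ := by positivity
  have hA : UnifInt fun η y ↦ c₁ * ((rho y + cauchyKernel (η ^ 2) (y - 0)) +
      (rho (η - y) + cauchyKernel (η ^ 2) (y - η))) :=
    ((unifInt_rho.add (unifInt_cauchyKernel (by fun_prop) (by fun_prop) fun η ↦ sq_nonneg η)).add
      (unifInt_rho_sub.add (unifInt_cauchyKernel (by fun_prop) (by fun_prop)
        fun η ↦ sq_nonneg η))).const_mul hc₁0
  have hB : UnifInt fun _ η : ℝ ↦ c₂ * rho η := unifInt_rho.const_mul hc₂0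
  have key := exists_energy_bilinear_le (s := s) (s₁ := s) (s₂ := s)
    (k := fun η y ↦ (η : ℂ) * osc (-(3 * η * y * (η - y)))) (B := fun η _ ↦ c₂ * rho η) hA hB ?_
  · obtain ⟨C, hC⟩ := key
    refine ⟨C, fun g ↦ ?_⟩
    have := hC g g g.continuous.measurable g.continuous.measurable
    rw [sq]
    refine le_trans (le_of_eq ?_) this
    congr 1
    ext η
    rw [kdvForm, ← integral_const_mul]
    congr 1
    ext y
    ring
  · intro η y
    obtain ⟨z, hz⟩ : ∃ z, z = η - y := ⟨_, rfl⟩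
    have hη : y + z = η := by rw [hz]; ring
    simp only [norm_mul, mul_pow, Complex.norm_real, Real.norm_eq_abs, sq_abs, sub_zero]
    rw [← cauchyKernel_neg _ (y - η), neg_sub, ← hz]
    have n1 := rho_nonneg y
    have n2 := rho_nonneg z
    have n3 := rho_nonneg η
    have n4 := cauchyKernel_nonneg (sq_nonneg η) y
    have n5 := cauchyKernel_nonneg (sq_nonneg η) z
    have hW : 0 ≤ (1 + y ^ 2) ^ s * (1 + z ^ 2) ^ s := by positivity
    rcases le_or_gt |y| 1 with hy | hy
    · refine (kdv_low_le hz hy).trans (mul_le_mul_of_nonneg_right ?_ hW)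
      rw [← hc₁]
      nlinarith [mul_nonneg hc₁0 n2, mul_nonneg hc₁0 n5, mul_nonneg hc₂0 n3]
    rcases le_or_gt |z| 1 with hz1 | hz1
    · have := kdv_low_le (s := s) (η := η) (y := z) (z := y) (by rw [hz]; ring) hz1
      rw [show 3 * η * z * y = 3 * η * y * z by ring, mul_comm ((1 + z ^ 2) ^ s)] at this
      refine this.trans (mul_le_mul_of_nonneg_right ?_ hW)
      rw [← hc₁]
      nlinarith [mul_nonneg hc₁0 n1, mul_nonneg hc₁0 n4, mul_nonneg hc₂0 n3]
    · have hy2 : 1 ≤ y ^ 2 := by rw [← sq_abs]; nlinarith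
      have hz2 : 1 ≤ z ^ 2 := by rw [← sq_abs]; nlinarith
      have ho : η ^ 2 * ‖osc (-(3 * η * y * z))‖ ^ 2 ≤ 4 / ((1 + y ^ 2) * (1 + z ^ 2)) := by
        have h1 := mul_le_mul_of_nonneg_left (norm_osc_sq_le (-(3 * η * y * z))) (sq_nonneg η)
        refine h1.trans ?_
        rw [mul_div_assoc', div_le_div_iff₀ (by positivity) (by positivity)]
        have h2 : (1 + y ^ 2) * (1 + z ^ 2) ≤ 4 * (y ^ 2 * z ^ 2) := by
          calc (1 + y ^ 2) * (1 + z ^ 2) ≤ (2 * y ^ 2) * (2 * z ^ 2) :=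
                mul_le_mul (by linarith) (by linarith) (by positivity) (by positivity)
            _ = _ := by ring
        have h3 := mul_le_mul_of_nonneg_left h2 (sq_nonneg η)
        nlinarith [mul_nonneg (sq_nonneg η) (mul_nonneg (sq_nonneg y) (sq_nonneg z))]
      refine (kdv_high_le hs (by positivity) (by positivity) (by positivity) ?_ ho
        (inv_le_rho η)).trans (mul_le_mul_of_nonneg_right ?_ hW)
      · rw [← hη, ← mul_assoc]; exact one_add_sq_le_mul y z
      · rw [← hc₂]
        nlinarith [mul_nonneg hc₁0 n1, mul_nonneg hc₁0 n2, mul_nonneg hc₁0 n4, mul_nonneg hc₁0 n5]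

/-! ### Sufficiency: the density interaction -/

/-- Low output frequency. Here and below `a`, `b`, `c` are the weights `1 + ξ²` of the output and of
the two inputs, and `o` is the squared time factor together with the derivative. -/
theorem density_low_le {a b c o r s₁ s₂ : ℝ} (hs : -(1 / 2) ≤ s₁) (ha1 : 1 ≤ a) (ha17 : a ≤ 17)
    (hb1 : 1 ≤ b) (hc1 : 1 ≤ c) (hbc : b ≤ 34 * c) (hcb : c ≤ 34 * b) (ho0 : 0 ≤ o)
    (ho : o * b ≤ 52000) (hr : a⁻¹ ≤ r) :
    a ^ s₂ * o ≤ 17 * 52000 * 17 ^ |s₂| * 34 ^ |s₁| * r * (b ^ s₁ * c ^ s₁) := by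
  have ha0 : 0 < a := by linarith
  have hb0 : 0 < b := by linarith
  have hc0 : 0 < c := by linarith
  have e1 : a ^ s₂ ≤ 17 ^ |s₂| := by
    have := rpow_le_mul_rpow (a := a) (b := 1) (K := 17) (s := s₂) ha0 one_pos (by norm_num)
      (by linarith) (by linarith)
    rwa [Real.one_rpow, mul_one] at this
  have e2 : b ^ s₁ ≤ 34 ^ |s₁| * c ^ s₁ := rpow_le_mul_rpow hb0 hc0 (by norm_num) hbc hcb
  have e3 : b ^ (-1 : ℝ) ≤ b ^ s₁ * b ^ s₁ := by
    rw [← Real.rpow_add hb0]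
    exact Real.rpow_le_rpow_of_exponent_le hb1 (by linarith)
  have e4 : 1 ≤ 17 * r := by
    have : (17 : ℝ)⁻¹ ≤ r := le_trans (inv_anti₀ ha0 ha17) hr
    linarith
  have e5 : o ≤ 52000 * (34 ^ |s₁| * (b ^ s₁ * c ^ s₁)) := by
    calc o = (o * b) * b ^ (-1 : ℝ) := by rw [Real.rpow_neg_one]; field_simp
      _ ≤ 52000 * (b ^ s₁ * (34 ^ |s₁| * c ^ s₁)) :=
          mul_le_mul ho (e3.trans (mul_le_mul_of_nonneg_left e2 (by positivity))) (by positivity)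
            (by norm_num)
      _ = _ := by ring
  calc a ^ s₂ * o ≤ 17 ^ |s₂| * (52000 * (34 ^ |s₁| * (b ^ s₁ * c ^ s₁))) :=
        mul_le_mul e1 e5 ho0 (by positivity)
    _ = 17 ^ |s₂| * (52000 * (34 ^ |s₁| * (b ^ s₁ * c ^ s₁))) * 1 := by ring
    _ ≤ 17 ^ |s₂| * (52000 * (34 ^ |s₁| * (b ^ s₁ * c ^ s₁))) * (17 * r) :=
        mul_le_mul_of_nonneg_left e4 (by positivity)
    _ = _ := by ring

/-- Near resonance both inputs have frequency comparable to the square of the output frequency. -/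
theorem density_resonant_le {a b c o R s₁ s₂ : ℝ} (hs : s₂ ≤ 4 * s₁) (ha1 : 1 ≤ a)
    (hb : 0 < b) (hc : 0 < c) (hb1 : b ≤ 32 * a ^ 2) (hb2 : a ^ 2 ≤ 32 * b)
    (hc1 : c ≤ 32 * a ^ 2) (hc2 : a ^ 2 ≤ 32 * c) (ho0 : 0 ≤ o) (ho : o ≤ 32 * R) :
    a ^ s₂ * o ≤ 32 * 32 ^ |s₁| * 32 ^ |s₁| * R * (b ^ s₁ * c ^ s₁) := by
  have ha0 : 0 < a := by linarith
  have e1 : (a ^ 2) ^ s₁ ≤ 32 ^ |s₁| * b ^ s₁ :=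
    rpow_le_mul_rpow (by positivity) hb (by norm_num) hb2 hb1
  have e2 : (a ^ 2) ^ s₁ ≤ 32 ^ |s₁| * c ^ s₁ :=
    rpow_le_mul_rpow (by positivity) hc (by norm_num) hc2 hc1
  have e3 : a ^ s₂ ≤ (a ^ 2) ^ s₁ * (a ^ 2) ^ s₁ := by
    rw [← Real.rpow_natCast, ← Real.rpow_mul ha0.le, ← Real.rpow_add ha0]
    exact Real.rpow_le_rpow_of_exponent_le ha1 (by push_cast; linarith)
  calc a ^ s₂ * o ≤ ((32 ^ |s₁| * b ^ s₁) * (32 ^ |s₁| * c ^ s₁)) * (32 * R) :=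
        mul_le_mul (e3.trans (mul_le_mul e1 e2 (by positivity) (by positivity))) ho ho0
          (by positivity)
    _ = _ := by ring

theorem rpow_le_of_large {a b c s₁ s₂ : ℝ} (h0 : 0 ≤ s₁) (hs4 : s₂ ≤ 4 * s₁) (hs2 : s₂ ≤ s₁ + 2)
    (ha1 : 1 ≤ a) (hc1 : 1 ≤ c) (hb : 0 < b) (hab : a ≤ 4 * b) :
    a ^ (s₂ - 2) ≤ 4 ^ s₁ * (a ^ (-(2 / 3) : ℝ) + c ^ (-(2 / 3) : ℝ)) * (b ^ s₁ * c ^ s₁) := by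
  have ha0 : 0 < a := by linarith
  have hc0 : 0 < c := by linarith
  have e1 : a ^ s₁ ≤ 4 ^ s₁ * b ^ s₁ :=
    rpow_le_mul_rpow_of_nonneg ha0.le hb.le (by norm_num) hab h0
  have key : a ^ (s₂ - 2 - s₁) ≤ (a ^ (-(2 / 3) : ℝ) + c ^ (-(2 / 3) : ℝ)) * c ^ s₁ := by
    rw [add_mul]
    have p1 : 0 ≤ a ^ (-(2 / 3) : ℝ) * c ^ s₁ := by positivity
    have p2 : 0 ≤ c ^ (-(2 / 3) : ℝ) * c ^ s₁ := by positivity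
    rcases le_total (2 / 3) s₁ with h | h
    · have : 1 ≤ c ^ (-(2 / 3) : ℝ) * c ^ s₁ := by
        rw [← Real.rpow_add hc0]; exact Real.one_le_rpow hc1 (by linarith)
      have h2 : a ^ (s₂ - 2 - s₁) ≤ 1 := Real.rpow_le_one_of_one_le_of_nonpos ha1 (by linarith)
      linarith
    · rcases le_total a c with hac | hca
      · have : a ^ (s₂ - 2 - s₁) ≤ a ^ (-(2 / 3) : ℝ) * c ^ s₁ := by
          calc a ^ (s₂ - 2 - s₁) ≤ a ^ (-(2 / 3) : ℝ) * a ^ s₁ := by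
                rw [← Real.rpow_add ha0]
                exact Real.rpow_le_rpow_of_exponent_le ha1 (by linarith)
            _ ≤ _ := mul_le_mul_of_nonneg_left (Real.rpow_le_rpow ha0.le hac h0) (by positivity)
        linarith
      · have : a ^ (s₂ - 2 - s₁) ≤ c ^ (-(2 / 3) : ℝ) * c ^ s₁ := by
          calc a ^ (s₂ - 2 - s₁) ≤ a ^ (-(2 / 3) + s₁) :=
                Real.rpow_le_rpow_of_exponent_le ha1 (by linarith)
            _ ≤ c ^ (-(2 / 3) + s₁) :=
                Real.rpow_le_rpow_of_nonpos hc0 hca (by linarith)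
            _ = _ := Real.rpow_add hc0 _ _
        linarith
  calc a ^ (s₂ - 2) = a ^ s₁ * a ^ (s₂ - 2 - s₁) := by
        rw [← Real.rpow_add ha0]; congr 1; ring
    _ ≤ (4 ^ s₁ * b ^ s₁) * ((a ^ (-(2 / 3) : ℝ) + c ^ (-(2 / 3) : ℝ)) * c ^ s₁) :=
        mul_le_mul e1 key (by positivity) (by positivity)
    _ = _ := by ring

/-- Away from resonance the time factor gains `W⁻¹`, where `W` dominates the weights of both inputs
and the square of the weight of the output. -/
theorem density_nonresonant_le {a b c o W s₁ s₂ : ℝ} (hs : -(1 / 2) ≤ s₁) (hs4 : s₂ ≤ 4 * s₁)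
    (hs2 : s₂ ≤ s₁ + 2) (ha1 : 1 ≤ a) (hb1 : 1 ≤ b) (hc1 : 1 ≤ c) (habc : a ≤ 2 * (b + c))
    (hW : 0 < W) (haW : a ^ 2 ≤ 48 * W) (hbW : b ≤ 10 * W) (hcW : c ≤ 10 * W)
    (ho : o ≤ 8 / W) :
    a ^ s₂ * o ≤ 8 * 48 ^ |1 + 2 * s₁| * 10 ^ |s₁| * 10 ^ |s₁| * 48 * 4 ^ |s₁| *
      (a ^ (-(2 / 3) : ℝ) + b ^ (-(2 / 3) : ℝ) + c ^ (-(2 / 3) : ℝ)) * (b ^ s₁ * c ^ s₁) := by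
  have ha0 : 0 < a := by linarith
  have hb0 : 0 < b := by linarith
  have hc0 : 0 < c := by linarith
  have q1 : (1 : ℝ) ≤ 48 ^ |1 + 2 * s₁| := Real.one_le_rpow (by norm_num) (abs_nonneg _)
  have q2 : (1 : ℝ) ≤ 10 ^ |s₁| := Real.one_le_rpow (by norm_num) (abs_nonneg _)
  have q3 : (1 : ℝ) ≤ 4 ^ |s₁| := Real.one_le_rpow (by norm_num) (abs_nonneg _)
  set Q := a ^ (-(2 / 3) : ℝ) + b ^ (-(2 / 3) : ℝ) + c ^ (-(2 / 3) : ℝ) with hQ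
  have pa : 0 < a ^ (-(2 / 3) : ℝ) := by positivity
  have pb : 0 < b ^ (-(2 / 3) : ℝ) := by positivity
  have pc : 0 < c ^ (-(2 / 3) : ℝ) := by positivity
  have hQ0 : 0 < Q := by positivity
  have hP : 0 < b ^ s₁ * c ^ s₁ := by positivity
  have hoW : a ^ s₂ * o ≤ 8 * (a ^ s₂ * W ^ (-1 : ℝ)) := by
    rw [Real.rpow_neg_one]
    calc a ^ s₂ * o ≤ a ^ s₂ * (8 / W) := mul_le_mul_of_nonneg_left ho (by positivity)
      _ = _ := by ring
  refine hoW.trans ?_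
  rcases le_total 0 s₁ with h0 | h0
  · have e1 : W ^ (-1 : ℝ) ≤ 48 * a ^ (-2 : ℝ) := by
      have : a ^ (-2 : ℝ) = 1 / a ^ 2 := by
        rw [Real.rpow_neg ha0.le, one_div]; norm_cast
      rw [Real.rpow_neg_one, this, mul_one_div, ← one_div,
        div_le_div_iff₀ hW (by positivity)]
      linarith
    have e2 : a ^ (s₂ - 2) ≤ 4 ^ s₁ * Q * (b ^ s₁ * c ^ s₁) := by
      rcases le_total c b with hcb | hcb
      · refine (rpow_le_of_large h0 hs4 hs2 ha1 hc1 hb0 (by linarith)).trans ?_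
        exact mul_le_mul_of_nonneg_right
          (mul_le_mul_of_nonneg_left (by linarith) (by positivity)) hP.le
      · refine (rpow_le_of_large h0 hs4 hs2 ha1 hb1 hc0 (by linarith)).trans ?_
        rw [mul_comm (c ^ s₁)]
        exact mul_le_mul_of_nonneg_right
          (mul_le_mul_of_nonneg_left (by linarith) (by positivity)) hP.le
    rw [abs_of_nonneg h0] at *
    calc 8 * (a ^ s₂ * W ^ (-1 : ℝ)) ≤ 8 * (a ^ s₂ * (48 * a ^ (-2 : ℝ))) := by gcongr
      _ = 8 * 48 * a ^ (s₂ - 2) := by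
        rw [sub_eq_add_neg, Real.rpow_add ha0]; ring
      _ ≤ 8 * 48 * (4 ^ s₁ * Q * (b ^ s₁ * c ^ s₁)) := by gcongr
      _ = 1 * 1 * 1 * (8 * 48 * (4 ^ s₁ * Q * (b ^ s₁ * c ^ s₁))) := by ring
      _ ≤ 48 ^ |1 + 2 * s₁| * 10 ^ s₁ * 10 ^ s₁ * (8 * 48 * (4 ^ s₁ * Q * (b ^ s₁ * c ^ s₁))) := by
        gcongr
      _ = _ := by ring
  · have hW10 : 0 < 10 * W := by positivity
    have eb : (10 * W) ^ s₁ ≤ b ^ s₁ := Real.rpow_le_rpow_of_nonpos hb0 hbW h0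
    have ec : (10 * W) ^ s₁ ≤ c ^ s₁ := Real.rpow_le_rpow_of_nonpos hc0 hcW h0
    have e10 : (10 : ℝ) ^ |s₁| * 10 ^ s₁ = 1 := by
      rw [abs_of_nonpos h0, ← Real.rpow_add (by norm_num)]; simp
    have e3 : W ^ s₁ * W ^ s₁ ≤ 10 ^ |s₁| * 10 ^ |s₁| * (b ^ s₁ * c ^ s₁) := by
      have h1 := mul_le_mul eb ec (by positivity) (by positivity)
      rw [Real.mul_rpow (by norm_num) hW.le] at h1
      calc W ^ s₁ * W ^ s₁ =
            (10 ^ |s₁| * 10 ^ s₁) * (10 ^ |s₁| * 10 ^ s₁) * (W ^ s₁ * W ^ s₁) := by rw [e10]; ring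
        _ = 10 ^ |s₁| * 10 ^ |s₁| * (10 ^ s₁ * W ^ s₁ * (10 ^ s₁ * W ^ s₁)) := by ring
        _ ≤ _ := mul_le_mul_of_nonneg_left h1 (by positivity)
    have e4 : W ^ (-(1 + 2 * s₁)) ≤ 48 ^ |1 + 2 * s₁| * (a ^ 2) ^ (-(1 + 2 * s₁)) := by
      have h1 : a ^ 2 / 48 ≤ W := by linarith
      have h2 := Real.rpow_le_rpow_of_nonpos (by positivity) h1
        (by linarith : -(1 + 2 * s₁) ≤ 0)
      rw [Real.div_rpow (by positivity) (by norm_num), Real.rpow_neg (by norm_num : (0:ℝ) ≤ 48),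
        div_inv_eq_mul] at h2
      rw [abs_of_nonneg (by linarith)]
      linarith
    have e5 : a ^ s₂ * (a ^ 2) ^ (-(1 + 2 * s₁)) ≤ Q := by
      rw [← Real.rpow_natCast, ← Real.rpow_mul ha0.le, ← Real.rpow_add ha0]
      refine le_trans (Real.rpow_le_rpow_of_exponent_le ha1 (?_ : _ ≤ -(2 / 3 : ℝ))) (by linarith)
      push_cast; linarith
    have e6 : W ^ (-1 : ℝ) = W ^ (-(1 + 2 * s₁)) * (W ^ s₁ * W ^ s₁) := by
      rw [← Real.rpow_add hW, ← Real.rpow_add hW]; congr 1; ring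
    calc 8 * (a ^ s₂ * W ^ (-1 : ℝ)) =
          8 * (a ^ s₂ * (W ^ (-(1 + 2 * s₁)) * (W ^ s₁ * W ^ s₁))) := by rw [e6]
      _ ≤ 8 * (a ^ s₂ * ((48 ^ |1 + 2 * s₁| * (a ^ 2) ^ (-(1 + 2 * s₁))) *
          (10 ^ |s₁| * 10 ^ |s₁| * (b ^ s₁ * c ^ s₁)))) := by gcongr
      _ = 8 * 48 ^ |1 + 2 * s₁| * 10 ^ |s₁| * 10 ^ |s₁| * 1 * 1 *
          (a ^ s₂ * (a ^ 2) ^ (-(1 + 2 * s₁))) * (b ^ s₁ * c ^ s₁) := by ring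
      _ ≤ 8 * 48 ^ |1 + 2 * s₁| * 10 ^ |s₁| * 10 ^ |s₁| * 48 * 4 ^ |s₁| * Q *
          (b ^ s₁ * c ^ s₁) := by
        gcongr
        norm_num

theorem sq_mul_norm_osc_sq_le (η w : ℝ) :
    η ^ 2 * ‖osc (-(η * w))‖ ^ 2 ≤ 8 * (η ^ 2 / (1 + (η * w) ^ 2)) := by
  have := mul_le_mul_of_nonneg_left (norm_osc_sq_le (-(η * w))) (sq_nonneg η)
  rwa [neg_sq, mul_div_left_comm] at this

theorem sq_mul_norm_osc_sq_le_div {η w : ℝ} (h : 0 < w ^ 2) :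
    η ^ 2 * ‖osc (-(η * w))‖ ^ 2 ≤ 8 / w ^ 2 := by
  refine (sq_mul_norm_osc_sq_le η w).trans ?_
  rw [mul_div_assoc', div_le_div_iff₀ (by positivity) h]
  nlinarith

theorem density_osc_low_le {η y w : ℝ} (hw : w = η ^ 2 - η + 2 * y) (hη : |η| ≤ 4) :
    η ^ 2 * ‖osc (-(η * w))‖ ^ 2 * (1 + y ^ 2) ≤ 52000 := by
  have h16 : η ^ 2 ≤ 16 := by rw [← sq_abs]; nlinarith [abs_nonneg η]
  rcases le_or_gt |y| 20 with hy | hy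
  · have hy2 : 1 + y ^ 2 ≤ 401 := by rw [← sq_abs]; nlinarith [abs_nonneg y]
    have h0 : ‖osc (-(η * w))‖ ^ 2 ≤ 1 := pow_le_one₀ (norm_nonneg _) (norm_osc_le_one _)
    have h1 : η ^ 2 * ‖osc (-(η * w))‖ ^ 2 ≤ 16 * 1 :=
      mul_le_mul h16 h0 (by positivity) (by norm_num)
    exact (mul_le_mul h1 hy2 (by positivity) (by norm_num)).trans (by norm_num)
  · have hwy : |y| ≤ |w| := by
      have h2 : |2 * y| ≤ |w| + |η ^ 2 - η| := by
        have := abs_sub w (η ^ 2 - η)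
        rwa [show w - (η ^ 2 - η) = 2 * y by rw [hw]; ring] at this
      have h3 : |η ^ 2 - η| ≤ 20 := by
        have := abs_le.1 hη
        exact abs_le.2 ⟨by linarith [sq_nonneg η], by linarith⟩
      rw [abs_mul, abs_two] at h2
      linarith
    have hy2 : 400 ≤ y ^ 2 := by rw [← sq_abs]; nlinarith
    have hwy2 : y ^ 2 ≤ w ^ 2 := sq_le_sq.2 hwy
    have hw0 : 0 < w ^ 2 := by linarith
    refine (mul_le_mul (sq_mul_norm_osc_sq_le_div hw0) (by linarith : 1 + y ^ 2 ≤ 2 * w ^ 2)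
      (by positivity) (by positivity)).trans ?_
    rw [div_mul_eq_mul_div, div_le_iff₀ hw0]
    linarith

theorem weight_comparable_sq {N x : ℝ} (h1 : N ^ 2 / 4 ≤ |x|) (h2 : |x| ≤ N ^ 2) :
    1 + x ^ 2 ≤ 32 * (1 + N ^ 2) ^ 2 ∧ (1 + N ^ 2) ^ 2 ≤ 32 * (1 + x ^ 2) := by
  rw [← sq_abs x]
  constructor <;> nlinarith [abs_nonneg x, sq_nonneg N, sq_nonneg (N ^ 2 - 1)]

theorem weight_le_of_nonresonant {w x : ℝ} (hw1 : 16 ≤ w ^ 2) (h : |2 * x| ≤ 6 * |w|) :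
    1 + x ^ 2 ≤ 10 * w ^ 2 := by
  rw [abs_mul, abs_two] at h
  have : x ^ 2 ≤ (3 * |w|) ^ 2 := by
    rw [← sq_abs x]; exact pow_le_pow_left₀ (abs_nonneg x) (by linarith) 2
  rw [mul_pow, sq_abs] at this
  linarith

/-- Kernel bound for the density interaction: `η` is the output frequency, `y` and `y - η` those of
the two Schrödinger factors. -/
theorem exists_density_kernel_le {s₁ s₂ : ℝ} (hs : -(1 / 2) ≤ s₁) (hs4 : s₂ ≤ 4 * s₁)
    (hs2 : s₂ ≤ s₁ + 2) :
    ∃ C, 0 ≤ C ∧ ∀ η y : ℝ,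
      (1 + η ^ 2) ^ s₂ * (η ^ 2 * ‖osc (-(η * (η ^ 2 - η + 2 * y)))‖ ^ 2) ≤
        C * (rho η + rho y + rho (η - y) + resKernel 1 y η) *
          ((1 + y ^ 2) ^ s₁ * (1 + (η - y) ^ 2) ^ s₁) := by
  obtain ⟨C₁, hC₁⟩ : ∃ C : ℝ, C = 17 * 52000 * 17 ^ |s₂| * 34 ^ |s₁| := ⟨_, rfl⟩
  obtain ⟨C₂, hC₂⟩ : ∃ C : ℝ, C = 32 * 32 ^ |s₁| * 32 ^ |s₁| := ⟨_, rfl⟩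
  obtain ⟨C₃, hC₃⟩ : ∃ C : ℝ,
    C = 8 * 48 ^ |1 + 2 * s₁| * 10 ^ |s₁| * 10 ^ |s₁| * 48 * 4 ^ |s₁| := ⟨_, rfl⟩
  have hC₁0 : 0 ≤ C₁ := by rw [hC₁]; positivity
  have hC₂0 : 0 ≤ C₂ := by rw [hC₂]; positivity
  have hC₃0 : 0 ≤ C₃ := by rw [hC₃]; positivity
  refine ⟨C₁ + C₂ + C₃, by positivity, fun η y ↦ ?_⟩
  obtain ⟨z, hz⟩ : ∃ z, z = η - y := ⟨_, rfl⟩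
  obtain ⟨w, hw⟩ : ∃ w, w = η ^ 2 - η + 2 * y := ⟨_, rfl⟩
  rw [← hz, ← hw]
  have n1 := rho_nonneg y
  have n2 := rho_nonneg z
  have n3 := rho_nonneg η
  have n4 := resKernel_nonneg 1 y η
  have hW0 : 0 ≤ (1 + y ^ 2) ^ s₁ * (1 + z ^ 2) ^ s₁ := by positivity
  have hoo : 0 ≤ η ^ 2 * ‖osc (-(η * w))‖ ^ 2 := by positivity
  have ha1 : 1 ≤ 1 + η ^ 2 := by linarith [sq_nonneg η]
  have hb1 : 1 ≤ 1 + y ^ 2 := by linarith [sq_nonneg y]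
  have hc1' : 1 ≤ 1 + z ^ 2 := by linarith [sq_nonneg z]
  -- it suffices to bound by any one of the three constants times any one part of the kernel
  have combine : ∀ {C r : ℝ}, 0 ≤ r → C ≤ C₁ + C₂ + C₃ →
      r ≤ rho η + rho y + rho z + resKernel 1 y η →
      C * r * ((1 + y ^ 2) ^ s₁ * (1 + z ^ 2) ^ s₁) ≤
      (C₁ + C₂ + C₃) * (rho η + rho y + rho z + resKernel 1 y η) *
        ((1 + y ^ 2) ^ s₁ * (1 + z ^ 2) ^ s₁) := fun hr hC hrr ↦
    mul_le_mul_of_nonneg_right (mul_le_mul hC hrr hr (by linarith)) hW0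
  rcases le_or_gt |η| 4 with hη | hη
  · have h16 : 1 + η ^ 2 ≤ 17 := by rw [← sq_abs]; nlinarith [abs_nonneg η]
    have hbc : 1 + y ^ 2 ≤ 34 * (1 + z ^ 2) := by
      have := one_add_sq_le_mul η (-z)
      rw [show η + -z = y by rw [hz]; ring, neg_sq] at this
      exact this.trans (mul_le_mul_of_nonneg_right (by linarith) (by positivity))
    have hcb : 1 + z ^ 2 ≤ 34 * (1 + y ^ 2) := by
      have := one_add_sq_le_mul η (-y)
      rw [show η + -y = z by rw [hz]; ring, neg_sq] at this
      exact this.trans (mul_le_mul_of_nonneg_right (by linarith) (by positivity))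
    have := density_low_le (s₂ := s₂) hs ha1 h16 hb1 hc1' hbc hcb hoo
      (density_osc_low_le hw hη) (inv_le_rho η)
    rw [← hC₁] at this
    exact this.trans (combine n3 (by linarith) (by linarith))
  have hη4 : 4 * |η| ≤ η ^ 2 := by rw [← sq_abs η]; nlinarith
  have hη16 : 16 ≤ η ^ 2 := by linarith
  have hl := abs_le.1 (le_refl |η|)
  have hy2 : 2 * y = w - η ^ 2 + η := by rw [hw]; ring
  have hz2 : 2 * z = -(w - η ^ 2 - η) := by rw [hz, hw]; ring
  rcases le_total |w| (η ^ 2 / 4) with hwη | hwη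
  · have r1 := resonant_le_resKernel (ε := 1) (p := y) (by simp) hη.le (w := w)
      (by rw [hw]; ring) hwη
    have hw' := abs_le.1 hwη
    have sy := weight_comparable_sq (N := η) (x := y)
      (by rw [abs_of_nonpos (by linarith)]; linarith)
      (by rw [abs_of_nonpos (by linarith)]; linarith)
    have sz := weight_comparable_sq (N := η) (x := z)
      (by rw [abs_of_nonneg (by linarith)]; linarith)
      (by rw [abs_of_nonneg (by linarith)]; linarith)
    have ho := sq_mul_norm_osc_sq_le η w
    have := density_resonant_le hs4 ha1 (by linarith) (by linarith) sy.1 sy.2 sz.1 sz.2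
      hoo (by linarith : _ ≤ 32 * resKernel 1 y η)
    rw [← hC₂] at this
    exact this.trans (combine n4 (by linarith) (by linarith))
  · have hw16 : (η ^ 2) ^ 2 / 16 ≤ w ^ 2 := by
      rw [← sq_abs w]
      have := pow_le_pow_left₀ (by positivity) hwη 2
      calc (η ^ 2) ^ 2 / 16 = (η ^ 2 / 4) ^ 2 := by ring
        _ ≤ _ := this
    have hη256 : 16 * η ^ 2 ≤ (η ^ 2) ^ 2 := by
      have := mul_le_mul_of_nonneg_right hη16 (sq_nonneg η)
      calc 16 * η ^ 2 ≤ η ^ 2 * η ^ 2 := this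
        _ = _ := by ring
    have hw1 : 16 ≤ w ^ 2 := by linarith
    have hwl := abs_le.1 (le_refl |w|)
    have sy := weight_le_of_nonresonant (x := y) hw1
      (by rw [hy2]; exact abs_le.2 ⟨by linarith, by linarith⟩)
    have sz := weight_le_of_nonresonant (x := z) hw1
      (by rw [hz2, abs_neg]; exact abs_le.2 ⟨by linarith, by linarith⟩)
    have haw : (1 + η ^ 2) ^ 2 ≤ 48 * w ^ 2 := by
      calc (1 + η ^ 2) ^ 2 = 1 + 2 * η ^ 2 + (η ^ 2) ^ 2 := by ring
        _ ≤ _ := by linarith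
    have habc : 1 + η ^ 2 ≤ 2 * ((1 + y ^ 2) + (1 + z ^ 2)) := by
      have : η = y + z := by rw [hz]; ring
      rw [this]; nlinarith [sq_nonneg (y - z)]
    have := density_nonresonant_le hs hs4 hs2 ha1 hb1 hc1' habc (by linarith) haw sy sz
      (sq_mul_norm_osc_sq_le_div (η := η) (w := w) (by linarith))
    rw [← hC₃] at this
    exact this.trans (combine (r := rho η + rho y + rho z) (by linarith) (by linarith)
      (by linarith))

theorem energy_conj_neg (s : ℝ) (f : ℝ → ℂ) :
    energy s (fun z ↦ (starRingEnd ℂ) (f (-z))) = energy s f := by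
  rw [energy, energy,
    ← lintegral_neg_eq_self (fun η ↦ ENNReal.ofReal ((1 + η ^ 2) ^ s) * ‖f η‖ₑ ^ 2)]
  simp

theorem density_sufficient {s₁ s₂ : ℝ} (hs : -(1 / 2) ≤ s₁) (h : s₂ ≤ min (4 * s₁) (s₁ + 2)) :
    ∃ C : ℝ≥0, ∀ f : 𝓢(ℝ, ℂ), energy s₂ (densityForm f) ≤ C * energy s₁ f ^ 2 := by
  obtain ⟨h4, h2⟩ := le_min_iff.1 h
  obtain ⟨c, hc, hk⟩ := exists_density_kernel_le hs h4 h2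
  have hA : UnifInt fun η y ↦ c * (rho y + rho (η - y)) :=
    (unifInt_rho.add unifInt_rho_sub).const_mul hc
  have hB : UnifInt fun y η ↦ c * (rho η + resKernel 1 y η) :=
    (unifInt_rho.add (unifInt_resKernel 1)).const_mul hc
  have key := exists_energy_bilinear_le (s := s₂) (s₁ := s₁) (s₂ := s₁)
    (k := fun η y ↦ (η : ℂ) * osc (-(η * (η ^ 2 - η + 2 * y))))
    (B := fun η y ↦ c * (rho η + resKernel 1 y η)) hA hB ?_
  · obtain ⟨C, hC⟩ := key
    refine ⟨C, fun f ↦ ?_⟩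
    have := hC f (fun z ↦ (starRingEnd ℂ) (f (-z))) f.continuous.measurable
      (Continuous.measurable (by fun_prop))
    rw [energy_conj_neg, ← sq] at this
    refine le_trans (le_of_eq ?_) this
    congr 1
    ext η
    rw [densityForm, ← integral_const_mul]
    congr 1
    ext y
    rw [neg_sub, mul_assoc]
  · intro η y
    simp only [norm_mul, mul_pow, Complex.norm_real, Real.norm_eq_abs, sq_abs]
    refine (hk η y).trans (le_of_eq ?_)
    ring

/-! ### Sufficiency: the cubic interaction -/

/-- The cubic resonance function factors, so the time factor is bounded by a kernel that is
integrable in either factor alone. -/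
theorem norm_osc_two_mul_le (u v : ℝ) :
    ‖osc (2 * u * v)‖ ≤ 4 * ((1 + u ^ 2)⁻¹ + (1 + v ^ 2)⁻¹) := by
  have key : ∀ u v : ℝ, u ^ 2 ≤ v ^ 2 → ‖osc (2 * u * v)‖ ≤ 4 * (1 + u ^ 2)⁻¹ := by
    intro u v h
    refine (sq_le_sq₀ (norm_nonneg _) (by positivity)).1 ?_
    refine (norm_osc_sq_le _).trans ?_
    rw [← div_eq_mul_inv, div_pow, div_le_div_iff₀ (by positivity) (by positivity)]
    have : u ^ 2 * u ^ 2 ≤ u ^ 2 * v ^ 2 := mul_le_mul_of_nonneg_left h (sq_nonneg u)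
    nlinarith [sq_nonneg (u ^ 2 - 1)]
  have p1 : 0 < (1 + u ^ 2)⁻¹ := by positivity
  have p2 : 0 < (1 + v ^ 2)⁻¹ := by positivity
  rcases le_total (u ^ 2) (v ^ 2) with h | h
  · linarith [key u v h]
  · have := key v u h
    rw [show 2 * v * u = 2 * u * v by ring] at this
    linarith

theorem cubic_weight_le {s : ℝ} (hs : 0 ≤ s) (x y z : ℝ) :
    √((1 + (x + y + z) ^ 2) ^ s) ≤
      √(4 ^ s) * (√((1 + x ^ 2) ^ s) * √((1 + y ^ 2) ^ s) * √((1 + z ^ 2) ^ s)) := by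
  rw [← Real.sqrt_mul (by positivity), ← Real.sqrt_mul (by positivity),
    ← Real.sqrt_mul (by positivity), ← Real.mul_rpow (by positivity) (by positivity),
    ← Real.mul_rpow (by positivity) (by positivity),
    ← Real.mul_rpow (by positivity) (by positivity)]
  refine Real.sqrt_le_sqrt (Real.rpow_le_rpow (by positivity) ?_ hs)
  have h1 := one_add_sq_le_mul (x + y) z
  have h2 := one_add_sq_le_mul x y
  calc 1 + (x + y + z) ^ 2 ≤ 2 * (1 + (x + y) ^ 2) * (1 + z ^ 2) := h1
    _ ≤ 2 * (2 * (1 + x ^ 2) * (1 + y ^ 2)) * (1 + z ^ 2) := by gcongr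
    _ = _ := by ring

/-- The integrable weight `(1 + x²)⁻¹` with values in `ℝ≥0∞`. -/
noncomputable def rhoE (x : ℝ) : ℝ≥0∞ := ENNReal.ofReal (1 + x ^ 2)⁻¹

theorem measurable_rhoE : Measurable rhoE := by unfold rhoE; fun_prop

/-- Trilinear estimate: the kernel depends on `q.1` and `η - q.2` only, through integrable weights,
and Cauchy–Schwarz pairs the factors `F q.2`, `F (η - q.1)` against the third. -/
theorem lintegral_trilinear_sq_le {F : ℝ → ℝ≥0∞} (hF : Measurable F) :
    ∫⁻ η, (∫⁻ q : ℝ × ℝ, (rhoE q.1 + rhoE (η - q.2)) *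
      (F q.2 * F (q.2 - q.1) * F (η - q.1))) ^ 2 ≤
    (2 * ENNReal.ofReal Real.pi) ^ 2 * (∫⁻ x, F x ^ 2) ^ 3 := by
  have hr := measurable_rhoE
  set N := ∫⁻ x, F x ^ 2 with hN
  set P := ENNReal.ofReal Real.pi with hP
  have hP' : ∫⁻ x, rhoE x = P := lintegral_inv_one_add_sq
  have second : ∀ η, ∫⁻ q : ℝ × ℝ, (rhoE q.1 + rhoE (η - q.2)) * F (q.2 - q.1) ^ 2 = 2 * P * N := by
    intro η
    have e1 : ∫⁻ q : ℝ × ℝ, rhoE q.1 * F (q.2 - q.1) ^ 2 = P * N := by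
      rw [Measure.volume_eq_prod, lintegral_prod _ (by fun_prop)]
      have : ∀ y, ∫⁻ x, rhoE y * F (x - y) ^ 2 = rhoE y * N := fun y ↦ by
        rw [lintegral_const_mul _ (by fun_prop), lintegral_sub_right_eq_self (fun x ↦ F x ^ 2) y]
      simp_rw [this]
      rw [lintegral_mul_const _ hr, hP']
    have e2 : ∫⁻ q : ℝ × ℝ, rhoE (η - q.2) * F (q.2 - q.1) ^ 2 = P * N := by
      rw [Measure.volume_eq_prod, lintegral_prod_symm _ (by fun_prop)]
      have : ∀ x, ∫⁻ y, rhoE (η - x) * F (x - y) ^ 2 = rhoE (η - x) * N := fun x ↦ by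
        rw [lintegral_const_mul _ (by fun_prop), lintegral_sub_left_eq_self (fun x ↦ F x ^ 2) x]
      simp_rw [this]
      rw [lintegral_mul_const _ (by fun_prop), lintegral_sub_left_eq_self rhoE η, hP']
    simp_rw [add_mul]
    rw [lintegral_add_left (by fun_prop), e1, e2]
    ring
  have first : ∫⁻ η, ∫⁻ q : ℝ × ℝ, (rhoE q.1 + rhoE (η - q.2)) * (F q.2 * F (η - q.1)) ^ 2 =
      2 * P * N ^ 2 := by
    have e1 : ∫⁻ η, ∫⁻ q : ℝ × ℝ, rhoE q.1 * (F q.2 * F (η - q.1)) ^ 2 = P * N ^ 2 := by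
      rw [lintegral_lintegral_swap
        (by apply Measurable.aemeasurable; unfold Function.uncurry; fun_prop)]
      have : ∀ q : ℝ × ℝ, ∫⁻ η, rhoE q.1 * (F q.2 * F (η - q.1)) ^ 2 =
          rhoE q.1 * (F q.2 ^ 2 * N) := fun q ↦ by
        simp_rw [mul_pow]
        rw [lintegral_const_mul _ (by fun_prop), lintegral_const_mul _ (by fun_prop),
          lintegral_sub_right_eq_self (fun x ↦ F x ^ 2) q.1]
      simp_rw [this]
      rw [Measure.volume_eq_prod, lintegral_prod_mul (f := rhoE) (g := fun x ↦ F x ^ 2 * N)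
        hr.aemeasurable (by fun_prop), lintegral_mul_const _ (by fun_prop), hP', ← hN]
      ring
    have e2 : ∫⁻ η, ∫⁻ q : ℝ × ℝ, rhoE (η - q.2) * (F q.2 * F (η - q.1)) ^ 2 = P * N ^ 2 := by
      have i1 : ∀ η, ∫⁻ q : ℝ × ℝ, rhoE (η - q.2) * (F q.2 * F (η - q.1)) ^ 2 =
          N * ∫⁻ x, rhoE (η - x) * F x ^ 2 := fun η ↦ by
        have : ∀ q : ℝ × ℝ, rhoE (η - q.2) * (F q.2 * F (η - q.1)) ^ 2 =
          F (η - q.1) ^ 2 * (rhoE (η - q.2) * F q.2 ^ 2) := fun q ↦ by ring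
        simp_rw [this]
        rw [Measure.volume_eq_prod, lintegral_prod_mul (f := fun y ↦ F (η - y) ^ 2)
          (g := fun x ↦ rhoE (η - x) * F x ^ 2) (by fun_prop) (by fun_prop),
          lintegral_sub_left_eq_self (fun x ↦ F x ^ 2) η]
      simp_rw [i1]
      have hm : Measurable fun η ↦ ∫⁻ x, rhoE (η - x) * F x ^ 2 :=
        Measurable.lintegral_prod_right' (f := fun p : ℝ × ℝ ↦ rhoE (p.1 - p.2) * F p.2 ^ 2)
          (by fun_prop)
      rw [lintegral_const_mul _ hm, lintegral_lintegral_swap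
        (by apply Measurable.aemeasurable; unfold Function.uncurry; fun_prop)]
      have i2 : ∀ x, ∫⁻ η, rhoE (η - x) * F x ^ 2 = P * F x ^ 2 := fun x ↦ by
        rw [lintegral_mul_const _ (by fun_prop), lintegral_sub_right_eq_self rhoE x, hP']
      simp_rw [i2]
      rw [lintegral_const_mul _ (by fun_prop), ← hN]
      ring
    simp_rw [add_mul]
    have hm : Measurable fun η ↦ ∫⁻ q : ℝ × ℝ, rhoE q.1 * (F q.2 * F (η - q.1)) ^ 2 :=
      Measurable.lintegral_prod_right'
        (f := fun p : ℝ × (ℝ × ℝ) ↦ rhoE p.2.1 * (F p.2.2 * F (p.1 - p.2.1)) ^ 2) (by fun_prop)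
    have : ∀ η, ∫⁻ q : ℝ × ℝ, (rhoE q.1 * (F q.2 * F (η - q.1)) ^ 2 +
        rhoE (η - q.2) * (F q.2 * F (η - q.1)) ^ 2) =
        (∫⁻ q : ℝ × ℝ, rhoE q.1 * (F q.2 * F (η - q.1)) ^ 2) +
        ∫⁻ q : ℝ × ℝ, rhoE (η - q.2) * (F q.2 * F (η - q.1)) ^ 2 := fun η ↦
      lintegral_add_left (by fun_prop) _
    simp_rw [this]
    rw [lintegral_add_left hm, e1, e2]
    ring
  have cs : ∀ η, (∫⁻ q : ℝ × ℝ, (rhoE q.1 + rhoE (η - q.2)) *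
      (F q.2 * F (q.2 - q.1) * F (η - q.1))) ^ 2 ≤
      (∫⁻ q : ℝ × ℝ, (rhoE q.1 + rhoE (η - q.2)) * (F q.2 * F (η - q.1)) ^ 2) * (2 * P * N) := by
    intro η
    have hm : Measurable fun q : ℝ × ℝ ↦ (rhoE q.1 + rhoE (η - q.2)) ^ (1 / 2 : ℝ) := by fun_prop
    have hs : ∀ q : ℝ × ℝ, ((rhoE q.1 + rhoE (η - q.2)) ^ (1 / 2 : ℝ)) ^ 2 =
        rhoE q.1 + rhoE (η - q.2) := fun q ↦ by
      rw [← ENNReal.rpow_natCast, ← ENNReal.rpow_mul]; norm_num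
    have h := sq_lintegral_mul_le volume
      (f := fun q : ℝ × ℝ ↦ (rhoE q.1 + rhoE (η - q.2)) ^ (1 / 2 : ℝ) * (F q.2 * F (η - q.1)))
      (g := fun q : ℝ × ℝ ↦ (rhoE q.1 + rhoE (η - q.2)) ^ (1 / 2 : ℝ) * F (q.2 - q.1))
      (by fun_prop) (by fun_prop)
    simp_rw [mul_pow _ (F _ * F _), mul_pow (_ ^ (1 / 2 : ℝ)) (F (_ - _)), hs] at h
    rw [second] at h
    refine le_trans (le_of_eq ?_) h
    congr 1
    refine lintegral_congr fun q ↦ ?_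
    conv_lhs => rw [← hs q]
    ring
  refine (lintegral_mono cs).trans (le_of_eq ?_)
  have hm : Measurable fun η ↦ ∫⁻ q : ℝ × ℝ, (rhoE q.1 + rhoE (η - q.2)) *
      (F q.2 * F (η - q.1)) ^ 2 :=
    Measurable.lintegral_prod_right' (f := fun p : ℝ × (ℝ × ℝ) ↦
      (rhoE p.2.1 + rhoE (p.1 - p.2.2)) * (F p.2.2 * F (p.1 - p.2.1)) ^ 2) (by fun_prop)
  rw [lintegral_mul_const _ hm, first]
  ring

theorem cubic_sufficient {s : ℝ} (hs : 0 ≤ s) :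
    ∃ C : ℝ≥0, ∀ f : 𝓢(ℝ, ℂ), energy s (cubicForm f) ≤ C * energy s f ^ 3 := by
  refine ⟨((√(4 ^ s) * 4).toNNReal * (2 * Real.pi.toNNReal)) ^ 2, fun f ↦ ?_⟩
  set F : ℝ → ℝ≥0∞ := fun y ↦ ENNReal.ofReal √((1 + y ^ 2) ^ s) * ‖f y‖ₑ with hFdef
  have hF : Measurable F :=
    ((continuous_weight s).measurable.sqrt.ennreal_ofReal).mul f.continuous.measurable.enorm
  set c := ENNReal.ofReal (√(4 ^ s) * 4) with hc
  have hpt : ∀ η (q : ℝ × ℝ), ENNReal.ofReal √((1 + η ^ 2) ^ s) *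
      ‖osc (2 * q.1 * (η - q.2)) * (f q.2 * (starRingEnd ℂ) (f (q.2 - q.1)) * f (η - q.1))‖ₑ ≤
      c * ((rhoE q.1 + rhoE (η - q.2)) * (F q.2 * F (q.2 - q.1) * F (η - q.1))) := by
    rintro η ⟨y, x⟩
    have h1 := cubic_weight_le hs x (-(x - y)) (η - y)
    rw [show x + -(x - y) + (η - y) = η by ring, neg_sq] at h1
    have h2 := mul_le_mul h1 (norm_osc_two_mul_le y (η - x)) (norm_nonneg _) (by positivity)
    have h3 := ENNReal.ofReal_le_ofReal h2
    rw [ENNReal.ofReal_mul (Real.sqrt_nonneg _), ofReal_norm] at h3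
    have e : √(4 ^ s) * (√((1 + x ^ 2) ^ s) * √((1 + (x - y) ^ 2) ^ s) *
        √((1 + (η - y) ^ 2) ^ s)) * (4 * ((1 + y ^ 2)⁻¹ + (1 + (η - x) ^ 2)⁻¹)) =
        (√(4 ^ s) * 4) * (((1 + y ^ 2)⁻¹ + (1 + (η - x) ^ 2)⁻¹) * (√((1 + x ^ 2) ^ s) *
        √((1 + (x - y) ^ 2) ^ s) * √((1 + (η - y) ^ 2) ^ s))) := by ring
    rw [e, ENNReal.ofReal_mul (p := √(4 ^ s) * 4) (by positivity),
      ENNReal.ofReal_mul (p := (1 + y ^ 2)⁻¹ + (1 + (η - x) ^ 2)⁻¹) (by positivity),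
      ENNReal.ofReal_add (by positivity) (by positivity),
      ENNReal.ofReal_mul (q := √((1 + (η - y) ^ 2) ^ s)) (by positivity),
      ENNReal.ofReal_mul (q := √((1 + (x - y) ^ 2) ^ s)) (by positivity)] at h3
    simp only [enorm_mul, RCLike.enorm_conj]
    calc _ = ENNReal.ofReal √((1 + η ^ 2) ^ s) * ‖osc (2 * y * (η - x))‖ₑ *
          (‖f x‖ₑ * ‖f (x - y)‖ₑ * ‖f (η - y)‖ₑ) := by ring
      _ ≤ _ := mul_le_mul_left h3 _
      _ = _ := by
        rw [hc, ENNReal.ofReal_mul (p := √(4 ^ s)) (by positivity)]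
        simp only [hFdef, rhoE]
        ring
  have hr := measurable_rhoE
  rw [energy_eq, energy_eq s f]
  calc ∫⁻ η, (ENNReal.ofReal √((1 + η ^ 2) ^ s) * ‖cubicForm f η‖ₑ) ^ 2
      ≤ ∫⁻ η, (c * ∫⁻ q : ℝ × ℝ, (rhoE q.1 + rhoE (η - q.2)) *
          (F q.2 * F (q.2 - q.1) * F (η - q.1))) ^ 2 := by
        refine lintegral_mono fun η ↦ pow_le_pow_left' ?_ 2
        rw [← lintegral_const_mul _ (by fun_prop)]
        refine le_trans ?_ (lintegral_mono (hpt η))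
        rw [lintegral_const_mul' _ _ ENNReal.ofReal_ne_top]
        exact mul_le_mul_right (enorm_integral_le_lintegral_enorm _) _
    _ = c ^ 2 * ∫⁻ η, (∫⁻ q : ℝ × ℝ, (rhoE q.1 + rhoE (η - q.2)) *
          (F q.2 * F (q.2 - q.1) * F (η - q.1))) ^ 2 := by
        simp_rw [mul_pow]
        rw [lintegral_const_mul' _ _ (by rw [hc]; exact ENNReal.pow_ne_top ENNReal.ofReal_ne_top)]
    _ ≤ c ^ 2 * ((2 * ENNReal.ofReal Real.pi) ^ 2 * (∫⁻ x, F x ^ 2) ^ 3) :=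
        mul_le_mul_right (lintegral_trilinear_sq_le hF) _
    _ = _ := by
        rw [hc, ENNReal.ofReal, ENNReal.ofReal]
        push_cast
        ring

/-! ### Lower bounds for oscillatory integrals with nonnegative amplitude -/

theorem integrable_osc_mul {X : Type*} [MeasurableSpace X] {μ : Measure X} {Φ P : X → ℝ}
    (hΦ : Measurable Φ) (hP : Integrable P μ) :
    Integrable (fun x ↦ osc (Φ x) * (P x : ℂ)) μ :=
  hP.ofReal.bdd_mul (c := 1) (continuous_osc.measurable.comp hΦ).aestronglyMeasurable
    (.of_forall fun _ ↦ norm_osc_le_one _)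

/-- Coherent interaction: if the phase stays bounded by `1` then the time integration does not
produce any cancellation. -/
theorem norm_integral_osc_ge_of_abs_le {X : Type*} [MeasurableSpace X] {μ : Measure X}
    {Φ P : X → ℝ} {T : Set X} {p : ℝ} (hΦ : Measurable Φ) (hP : Integrable P μ)
    (hP0 : ∀ x, 0 ≤ P x) (hΦ1 : ∀ x, P x ≠ 0 → |Φ x| ≤ 1) (hT : MeasurableSet T)
    (hTμ : μ T ≠ ∞) (hp : ∀ x ∈ T, p ≤ P x) :
    1 / 2 * (p * μ.real T) ≤ ‖∫ x, osc (Φ x) * (P x : ℂ) ∂μ‖ := by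
  have hi := integrable_osc_mul hΦ hP
  refine le_trans ?_ (Complex.re_le_norm _)
  have e := Complex.reCLM.integral_comp_comm hi
  simp only [Complex.reCLM_apply, Complex.re_mul_ofReal] at e
  rw [← e]
  have hir : Integrable (fun x ↦ (osc (Φ x)).re * P x) μ := by
    simpa only [RCLike.re_to_complex, Complex.re_mul_ofReal] using hi.re
  have hge : ∀ x, 1 / 2 * P x ≤ (osc (Φ x)).re * P x := fun x ↦ by
    by_cases h : P x = 0
    · simp [h]
    · exact mul_le_mul_of_nonneg_right (half_le_re_osc (hΦ1 x h)) (hP0 x)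
  calc 1 / 2 * (p * μ.real T) = 1 / 2 * ∫ _ in T, p ∂μ := by
        rw [setIntegral_const, smul_eq_mul]; ring
    _ ≤ 1 / 2 * ∫ x, P x ∂μ := by
        have h1 : ∫ _ in T, p ∂μ ≤ ∫ x in T, P x ∂μ :=
          setIntegral_mono_on (integrableOn_const hTμ) hP.integrableOn hT hp
        have h2 := setIntegral_le_integral (s := T) hP (.of_forall hP0)
        linarith
    _ = ∫ x, 1 / 2 * P x ∂μ := (integral_const_mul _ _).symm
    _ ≤ _ := integral_mono (hP.const_mul _) hir hge

/-- Noncoherent interaction: for a positive phase the imaginary part `(1 - cos Φ) / Φ` of the time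
factor is nonnegative, so again there is no cancellation between different frequencies. -/
theorem norm_integral_osc_ge_of_pos {Φ P : ℝ → ℝ} {J : Set ℝ} {p D : ℝ} (hΦ : Continuous Φ)
    (hP : Integrable P) (hP0 : ∀ k, 0 ≤ P k) (hpos : ∀ k, P k ≠ 0 → 0 < Φ k) (hJ : IsCompact J)
    (hp : 0 < p) (hJp : ∀ k ∈ J, p ≤ P k) (hJD : ∀ k ∈ J, Φ k ≤ D) :
    p / D * ∫ k in J, (1 - Real.cos (Φ k)) ≤ ‖∫ k, osc (Φ k) * (P k : ℂ)‖ := by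
  have hi := integrable_osc_mul hΦ.measurable hP
  refine le_trans ?_ ((le_abs_self _).trans (Complex.abs_im_le_norm _))
  have e := Complex.imCLM.integral_comp_comm hi
  simp only [Complex.imCLM_apply, Complex.im_mul_ofReal] at e
  rw [← e]
  have hir : Integrable (fun x ↦ (osc (Φ x)).im * P x) := by
    simpa only [RCLike.im_to_complex, Complex.im_mul_ofReal] using hi.im
  have h0 : ∀ x, 0 ≤ (osc (Φ x)).im * P x := fun x ↦ by
    by_cases h : P x = 0
    · simp [h]
    · have := hpos x h
      rw [im_osc this.ne']
      have := Real.cos_le_one (Φ x)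
      have := hP0 x
      have : 0 ≤ 1 - Real.cos (Φ x) := by linarith
      positivity
  refine le_trans ?_ (setIntegral_le_integral (s := J) hir (.of_forall h0))
  rw [← integral_const_mul]
  refine setIntegral_mono_on ?_ hir.integrableOn hJ.measurableSet fun k hk ↦ ?_
  · exact ContinuousOn.integrableOn_compact hJ (by fun_prop)
  · have hpk := hJp k hk
    have hΦk := hpos k (by linarith)
    have hD := hJD k hk
    have hc : 0 ≤ 1 - Real.cos (Φ k) := by linarith [Real.cos_le_one (Φ k)]
    rw [im_osc hΦk.ne', div_mul_eq_mul_div, div_mul_eq_mul_div, mul_comm p]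
    exact div_le_div₀ (mul_nonneg hc (hP0 k)) (mul_le_mul_of_nonneg_left hpk hc) hΦk hD

theorem norm_integral_osc_neg {X : Type*} [MeasurableSpace X] {μ : Measure X} (Φ P : X → ℝ) :
    ‖∫ x, osc (-Φ x) * (P x : ℂ) ∂μ‖ = ‖∫ x, osc (Φ x) * (P x : ℂ) ∂μ‖ := by
  rw [← Complex.norm_conj (∫ x, osc (Φ x) * (P x : ℂ) ∂μ), ← integral_conj]
  congr 2
  ext x
  rw [map_mul, Complex.conj_ofReal]
  congr 1
  unfold osc
  rw [intervalIntegral.integral_of_le zero_le_one, intervalIntegral.integral_of_le zero_le_one,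
    ← integral_conj]
  congr 1
  ext t
  rw [← Complex.exp_conj, map_mul, Complex.conj_ofReal, Complex.conj_I]
  congr 1
  push_cast
  ring

/-- If the phase `Φ` has derivative between `lam ≥ 4` and `K * lam` then `1 - cos Φ` cannot be small
on average. -/
theorem integral_one_sub_cos_ge {Φ dΦ : ℝ → ℝ} {a lam K : ℝ} (hd : ∀ x, HasDerivAt Φ (dΦ x) x)
    (hdc : Continuous dΦ) (h4 : 4 ≤ lam) (hK : 0 < K)
    (hl : ∀ x ∈ Set.Icc a (a + 1), lam ≤ dΦ x ∧ dΦ x ≤ K * lam) :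
    1 / (2 * K) ≤ ∫ x in Set.Icc a (a + 1), (1 - Real.cos (Φ x)) := by
  have hab : a ≤ a + 1 := by linarith
  have hΦc : Continuous Φ := continuous_iff_continuousAt.2 fun x ↦ (hd x).continuousAt
  rw [integral_Icc_eq_integral_Ioc, ← intervalIntegral.integral_of_le hab]
  have h1 : ∫ x in a..(a + 1), (1 - Real.cos (Φ x)) * dΦ x =
      (Φ (a + 1) - Real.sin (Φ (a + 1))) - (Φ a - Real.sin (Φ a)) := by
    refine intervalIntegral.integral_eq_sub_of_hasDerivAt
      (f := fun x ↦ Φ x - Real.sin (Φ x)) (fun x _ ↦ ?_)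
      (Continuous.intervalIntegrable (by fun_prop) _ _)
    have := (hd x).sub (hd x).sin
    rwa [show dΦ x - Real.cos (Φ x) * dΦ x = (1 - Real.cos (Φ x)) * dΦ x by ring] at this
  have h2 : ∫ x in a..(a + 1), dΦ x = Φ (a + 1) - Φ a :=
    intervalIntegral.integral_eq_sub_of_hasDerivAt (fun x _ ↦ hd x)
      (hdc.intervalIntegrable _ _)
  have h3 : lam ≤ Φ (a + 1) - Φ a := by
    rw [← h2]
    have := intervalIntegral.integral_mono_on hab
      (intervalIntegrable_const (μ := volume) (c := lam))
      (hdc.intervalIntegrable a (a + 1)) fun x hx ↦ (hl x hx).1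
    simpa using this
  have h4' : ∫ x in a..(a + 1), (1 - Real.cos (Φ x)) * dΦ x ≤
      ∫ x in a..(a + 1), (1 - Real.cos (Φ x)) * (K * lam) := by
    refine intervalIntegral.integral_mono_on hab (Continuous.intervalIntegrable (by fun_prop) _ _)
      (Continuous.intervalIntegrable (by fun_prop) _ _) fun x hx ↦ ?_
    exact mul_le_mul_of_nonneg_left (hl x hx).2 (by linarith [Real.cos_le_one (Φ x)])
  rw [intervalIntegral.integral_mul_const, h1] at h4'
  have s1 := Real.sin_le_one (Φ (a + 1))
  have s2 := Real.neg_one_le_sin (Φ a)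
  rw [div_le_iff₀ (by positivity)]
  have : lam * 1 ≤ lam * ((∫ x in a..(a + 1), (1 - Real.cos (Φ x))) * (2 * K)) := by linarith
  exact le_of_mul_le_mul_left this (by linarith)

/-- Lower bound for the `H^s` energy of a noncoherent interaction: the mean of `1 - cos Φ` over a
unit square is bounded below, and Cauchy–Schwarz turns it into a mean square. -/
theorem le_energy_of_phase {Φ dΦ : ℝ → ℝ → ℝ} {out : ℝ → ℂ} {a b q W lam K s : ℝ}
    (hΦ : Continuous (Function.uncurry Φ))
    (hd : ∀ k x, HasDerivAt (fun x ↦ Φ x k) (dΦ x k) x) (hdc : ∀ k, Continuous fun x ↦ dΦ x k)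
    (h4 : 4 ≤ lam) (hK : 0 < K)
    (hl : ∀ x ∈ Set.Icc a (a + 1), ∀ k ∈ Set.Icc b (b + 1), lam ≤ dΦ x k ∧ dΦ x k ≤ K * lam)
    (hq : 0 ≤ q) (hW : 0 ≤ W) (hWs : ∀ x ∈ Set.Icc a (a + 1), W ≤ (1 + x ^ 2) ^ s)
    (hout : ∀ x ∈ Set.Icc a (a + 1),
      q * ∫ k in Set.Icc b (b + 1), (1 - Real.cos (Φ x k)) ≤ ‖out x‖) :
    ENNReal.ofReal (W * (q / (2 * K)) ^ 2) ≤ energy s out := by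
  have hΦ' : Continuous fun p : ℝ × ℝ ↦ Φ p.1 p.2 := hΦ
  set I := Set.Icc a (a + 1)
  set J := Set.Icc b (b + 1)
  set h : ℝ → ℝ → ℝ≥0∞ := fun x k ↦ ENNReal.ofReal (1 - Real.cos (Φ x k)) with hh
  have hm : Measurable (Function.uncurry h) := by
    have : Continuous fun p : ℝ × ℝ ↦ 1 - Real.cos (Φ p.1 p.2) := by fun_prop
    exact this.measurable.ennreal_ofReal
  have hnn : ∀ x k, 0 ≤ 1 - Real.cos (Φ x k) := fun x k ↦ by linarith [Real.cos_le_one (Φ x k)]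
  have hxk : ∀ k, Continuous fun x ↦ Φ x k := fun k ↦
    hΦ'.comp (by fun_prop : Continuous fun x ↦ (x, k))
  have hkx : ∀ x, Continuous fun k ↦ Φ x k := fun x ↦
    hΦ'.comp (by fun_prop : Continuous fun k ↦ (x, k))
  have eI : ∀ k, ∫⁻ x in I, h x k = ENNReal.ofReal (∫ x in I, (1 - Real.cos (Φ x k))) := fun k ↦ by
    have := hxk k
    refine (ofReal_integral_eq_lintegral_ofReal ?_ (.of_forall fun x ↦ hnn x k)).symm
    exact ContinuousOn.integrableOn_compact isCompact_Icc (by fun_prop)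
  have eJ : ∀ x, ∫⁻ k in J, h x k = ENNReal.ofReal (∫ k in J, (1 - Real.cos (Φ x k))) := fun x ↦ by
    have := hkx x
    refine (ofReal_integral_eq_lintegral_ofReal ?_ (.of_forall fun k ↦ hnn x k)).symm
    exact ContinuousOn.integrableOn_compact isCompact_Icc (by fun_prop)
  have vol : ∀ c : ℝ, volume (Set.Icc c (c + 1)) = 1 := fun c ↦ by simp
  have low : ENNReal.ofReal (1 / (2 * K)) ≤ ∫⁻ x in I, ∫⁻ k in J, h x k := by
    rw [lintegral_lintegral_swap hm.aemeasurable]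
    calc ENNReal.ofReal (1 / (2 * K)) = ∫⁻ _ in J, ENNReal.ofReal (1 / (2 * K)) := by
          rw [setLIntegral_const, vol, mul_one]
      _ ≤ _ := setLIntegral_mono' measurableSet_Icc fun k hk ↦ by
          rw [eI]
          exact ENNReal.ofReal_le_ofReal (integral_one_sub_cos_ge (hd k) (hdc k) h4 hK
            fun x hx ↦ hl x hx k hk)
  have hHm : Measurable fun x ↦ ∫⁻ k in J, h x k := hm.lintegral_prod_right
  have cs := sq_lintegral_mul_le (volume.restrict I) hHm (measurable_const (a := (1 : ℝ≥0∞)))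
  simp only [mul_one, one_pow, setLIntegral_const, I, vol] at cs
  calc ENNReal.ofReal (W * (q / (2 * K)) ^ 2)
      = ENNReal.ofReal W * (ENNReal.ofReal q ^ 2 * ENNReal.ofReal (1 / (2 * K)) ^ 2) := by
        rw [← mul_pow, ← ENNReal.ofReal_mul hq, ← ENNReal.ofReal_pow (by positivity),
          ← ENNReal.ofReal_mul hW]
        congr 2
        ring
    _ ≤ ENNReal.ofReal W * (ENNReal.ofReal q ^ 2 * ∫⁻ x in I, (∫⁻ k in J, h x k) ^ 2) := by
        gcongr
        exact (pow_le_pow_left' low 2).trans cs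
    _ = ∫⁻ x in I, ENNReal.ofReal W * (ENNReal.ofReal q * ∫⁻ k in J, h x k) ^ 2 := by
        simp_rw [mul_pow]
        rw [lintegral_const_mul' _ _ (by simp), lintegral_const_mul' _ _ (by simp)]
    _ ≤ ∫⁻ x in I, ENNReal.ofReal ((1 + x ^ 2) ^ s) * ‖out x‖ₑ ^ 2 := by
        refine setLIntegral_mono' measurableSet_Icc fun x hx ↦ ?_
        gcongr
        · exact hWs x hx
        · rw [eJ, ← ENNReal.ofReal_mul hq, ← ofReal_norm]
          exact ENNReal.ofReal_le_ofReal (hout x hx)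
    _ ≤ _ := setLIntegral_le_lintegral _ _

/-! ### Test functions -/

/-- `f` is the Schwartz function given by the nonnegative real function `φ`. -/
structure IsProfile (f : 𝓢(ℝ, ℂ)) (φ : ℝ → ℝ) : Prop where
  coe : ∀ x, f x = φ x
  nonneg : ∀ x, 0 ≤ φ x

namespace IsProfile

variable {f g : 𝓢(ℝ, ℂ)} {φ ψ : ℝ → ℝ}

theorem eq_re (h : IsProfile f φ) : φ = fun x ↦ (f x).re := by
  ext x
  rw [h.coe, Complex.ofReal_re]

theorem continuous (h : IsProfile f φ) : Continuous φ := by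
  rw [h.eq_re]
  exact Complex.continuous_re.comp f.continuous

theorem integrable (h : IsProfile f φ) : Integrable φ := by
  rw [h.eq_re]
  exact f.integrable.re

theorem exists_norm_le (h : IsProfile f φ) : ∃ M, ∀ x, ‖φ x‖ ≤ M := by
  obtain ⟨M, hM⟩ := f.decay 0 0
  refine ⟨M, fun x ↦ ?_⟩
  have := hM.2 x
  rw [pow_zero, one_mul, norm_iteratedFDeriv_zero, h.coe, Complex.norm_real] at this
  exact this

theorem add (hf : IsProfile f φ) (hg : IsProfile g ψ) : IsProfile (f + g) fun x ↦ φ x + ψ x where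
  coe x := by rw [_root_.add_apply, hf.coe, hg.coe, Complex.ofReal_add]
  nonneg x := add_nonneg (hf.nonneg x) (hg.nonneg x)

theorem smul (hf : IsProfile f φ) {c : ℝ} (hc : 0 ≤ c) :
    IsProfile ((c : ℂ) • f) fun x ↦ c * φ x where
  coe x := by rw [_root_.smul_apply, hf.coe, smul_eq_mul, Complex.ofReal_mul]
  nonneg x := mul_nonneg hc (hf.nonneg x)

theorem integrable_mul (hf : IsProfile f φ) (hg : IsProfile g ψ) {a : ℝ → ℝ} (ha : Continuous a) :
    Integrable fun y ↦ φ y * ψ (a y) := by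
  obtain ⟨M, hM⟩ := hg.exists_norm_le
  exact hf.integrable.mul_bdd (c := M) (hg.continuous.comp ha).aestronglyMeasurable
    (.of_forall fun y ↦ hM _)

/-- Upper bound for the energy of a test function with values in `[0, M]` supported in `T`, where
the weight `1 + x²` is comparable to the constant `A`. -/
theorem energy_le (hf : IsProfile f φ) {s M A K V : ℝ} {T : Set ℝ} (hM : ∀ x, φ x ≤ M)
    (hT : ∀ x, φ x ≠ 0 → x ∈ T) (hTm : MeasurableSet T) (hA : 0 < A) (hK : 1 ≤ K)
    (hTA : ∀ x ∈ T, 1 + x ^ 2 ≤ K * A ∧ A ≤ K * (1 + x ^ 2))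
    (hV : volume T ≤ ENNReal.ofReal V) :
    energy s f ≤ ENNReal.ofReal (K ^ |s| * A ^ s * M ^ 2 * V) := by
  have hM0 : 0 ≤ M := (hf.nonneg 0).trans (hM 0)
  calc energy s f ≤ ∫⁻ x, T.indicator (fun _ ↦ ENNReal.ofReal (K ^ |s| * A ^ s * M ^ 2)) x := by
        refine lintegral_mono fun x ↦ ?_
        by_cases hx : φ x = 0
        · simp [hf.coe, hx]
        · have hxT := hT x hx
          rw [Set.indicator_of_mem hxT, hf.coe, ← ofReal_norm, Complex.norm_real,
            Real.norm_of_nonneg (hf.nonneg x), ← ENNReal.ofReal_pow (hf.nonneg x),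
            ← ENNReal.ofReal_mul (by positivity)]
          refine ENNReal.ofReal_le_ofReal (mul_le_mul ?_ ?_ (by positivity) (by positivity))
          · exact rpow_le_mul_rpow (by positivity) hA hK (hTA x hxT).1 (hTA x hxT).2
          · exact pow_le_pow_left₀ (hf.nonneg x) (hM x) 2
    _ = ENNReal.ofReal (K ^ |s| * A ^ s * M ^ 2) * volume T := by
        rw [lintegral_indicator hTm, setLIntegral_const]
    _ ≤ ENNReal.ofReal (K ^ |s| * A ^ s * M ^ 2) * ENNReal.ofReal V := by gcongr
    _ = _ := (ENNReal.ofReal_mul (by positivity)).symm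

end IsProfile

/-- A smooth bump at `c`, equal to `1` within distance `r` and to `0` beyond distance `2r`. -/
theorem exists_bump (c : ℝ) {r : ℝ} (hr : 0 < r) :
    ∃ (f : 𝓢(ℝ, ℂ)) (φ : ℝ → ℝ), IsProfile f φ ∧ (∀ x, φ x ≤ 1) ∧
      (∀ x, |x - c| ≤ r → φ x = 1) ∧ ∀ x, φ x ≠ 0 → |x - c| ≤ 2 * r := by
  let b : ContDiffBump c := ⟨r, 2 * r, hr, by linarith⟩
  have h1 : HasCompactSupport fun x ↦ ((b x : ℝ) : ℂ) :=
    b.hasCompactSupport.comp_left (g := fun y : ℝ ↦ (y : ℂ)) Complex.ofReal_zero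
  have h2 : ContDiff ℝ (⊤ : ℕ∞) fun x ↦ ((b x : ℝ) : ℂ) :=
    Complex.ofRealCLM.contDiff.comp b.contDiff
  refine ⟨h1.toSchwartzMap h2, b, ⟨fun x ↦ rfl, fun x ↦ b.nonneg⟩, fun x ↦ b.le_one,
    fun x hx ↦ ?_, fun x hx ↦ ?_⟩
  · exact b.one_of_mem_closedBall (by rwa [Metric.mem_closedBall, Real.dist_eq])
  · by_contra h
    exact hx (b.zero_of_le_dist (by rw [Real.dist_eq]; exact (not_le.1 h).le))

theorem le_energy_of_norm_ge {out : ℝ → ℂ} {s W m V : ℝ} {T : Set ℝ} (hTm : MeasurableSet T)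
    (hm : 0 ≤ m) (hW : 0 ≤ W) (hWs : ∀ x ∈ T, W ≤ (1 + x ^ 2) ^ s) (hout : ∀ x ∈ T, m ≤ ‖out x‖)
    (hV : ENNReal.ofReal V ≤ volume T) :
    ENNReal.ofReal (W * m ^ 2 * V) ≤ energy s out := by
  calc ENNReal.ofReal (W * m ^ 2 * V) = ENNReal.ofReal (W * m ^ 2) * ENNReal.ofReal V :=
        ENNReal.ofReal_mul (by positivity)
    _ ≤ ENNReal.ofReal (W * m ^ 2) * volume T := by gcongr
    _ = ∫⁻ x in T, ENNReal.ofReal (W * m ^ 2) := (setLIntegral_const _ _).symm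
    _ ≤ ∫⁻ x in T, ENNReal.ofReal ((1 + x ^ 2) ^ s) * ‖out x‖ₑ ^ 2 := by
        refine setLIntegral_mono' hTm fun x hx ↦ ?_
        rw [← ofReal_norm, ← ENNReal.ofReal_pow (norm_nonneg _),
          ← ENNReal.ofReal_mul (by positivity)]
        have := hWs x hx
        have := hout x hx
        gcongr
    _ ≤ _ := setLIntegral_le_lintegral _ _

/-- Comparison of exponents: a bound by powers of `1 + N²` for all large `N` orders the powers. -/
theorem le_of_forall_rpow_le {N₀ c C a b : ℝ} (hc : 0 < c)
    (h : ∀ N, N₀ ≤ N → c * (1 + N ^ 2) ^ a ≤ C * (1 + N ^ 2) ^ b) : a ≤ b := by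
  by_contra! hab
  have ht : Filter.Tendsto (fun N : ℝ ↦ (1 + N ^ 2) ^ (a - b)) Filter.atTop Filter.atTop :=
    (tendsto_rpow_atTop (sub_pos.2 hab)).comp
      (Filter.tendsto_atTop_add_const_left _ _ (Filter.tendsto_pow_atTop two_ne_zero))
  obtain ⟨N, h1, h2⟩ := ((ht.eventually_gt_atTop (C / c)).and
    (Filter.eventually_ge_atTop N₀)).exists
  have h3 := h N h2
  have h0 : (0 : ℝ) < 1 + N ^ 2 := by positivity
  rw [Real.rpow_sub h0, lt_div_iff₀ (by positivity), div_mul_eq_mul_div, div_lt_iff₀ hc] at h1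
  linarith

theorem le_mul_of_ofReal_le {C : ℝ≥0} {L U : ℝ} {E F : ℝ≥0∞} (hU : 0 ≤ U)
    (h1 : ENNReal.ofReal L ≤ E) (h2 : E ≤ C * F) (h3 : F ≤ ENNReal.ofReal U) : L ≤ C * U := by
  have h : ENNReal.ofReal L ≤ ENNReal.ofReal (C * U) := by
    rw [ENNReal.ofReal_mul C.coe_nonneg, ENNReal.ofReal_coe_nnreal]
    exact h1.trans (h2.trans (by gcongr))
  exact (ENNReal.ofReal_le_ofReal_iff (by positivity)).1 h

theorem rpow_div_le {A K s x : ℝ} (hA : 0 < A) (hK : 1 ≤ K)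
    (h : 1 + x ^ 2 ≤ K * A ∧ A ≤ K * (1 + x ^ 2)) : A ^ s / K ^ |s| ≤ (1 + x ^ 2) ^ s := by
  have hK0 : 0 < K := by linarith
  rw [div_le_iff₀ (by positivity), mul_comm]
  exact rpow_le_mul_rpow hA (by positivity) hK h.2 h.1

theorem weight_comparable {N x : ℝ} (h1 : N / 2 ≤ |x|) (hN : 0 ≤ N) (h2 : |x| ≤ 2 * N) :
    1 + x ^ 2 ≤ 10 * (1 + N ^ 2) ∧ 1 + N ^ 2 ≤ 10 * (1 + x ^ 2) := by
  rw [← sq_abs x]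
  constructor <;> nlinarith [abs_nonneg x]

theorem weight_comparable_one {x : ℝ} (h : |x| ≤ 3) :
    1 + x ^ 2 ≤ 10 * 1 ∧ 1 ≤ 10 * (1 + x ^ 2) := by
  rw [← sq_abs x]
  constructor <;> nlinarith [abs_nonneg x]

theorem rpow_neg_natCast_le {N : ℝ} (hN : 0 < N) (n : ℕ) :
    (1 + N ^ 2) ^ (-(n : ℝ)) ≤ ((N ^ 2) ^ n)⁻¹ := by
  rw [Real.rpow_neg (by positivity), Real.rpow_natCast]
  gcongr
  linarith

/-! ### Necessity: the cubic interaction -/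

/-- Coherent test function: for a bump of small fixed width at `N` the phase is bounded. -/
theorem cubic_necessary {s : ℝ} (h : ∃ C : ℝ≥0, ∀ f : 𝓢(ℝ, ℂ),
    energy s (cubicForm f) ≤ C * energy s f ^ 3) : 0 ≤ s := by
  obtain ⟨C, hC⟩ := h
  suffices s ≤ s * (3 : ℕ) by push_cast at this; linarith
  refine le_of_forall_rpow_le (N₀ := 1) (c := 1 / 10 ^ |s| * (1 / 2 * (1 * (1 / 64))) ^ 2 * (1 / 8))
    (C := C * (10 ^ |s| * 1 ^ 2 * (1 / 2)) ^ 3) (by positivity) fun N hN ↦ ?_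
  obtain ⟨f, φ, hf, h1, hone, hsupp⟩ := exists_bump N (r := 1 / 8) (by norm_num)
  have hA : 0 < 1 + N ^ 2 := by positivity
  have hE := hf.energy_le (s := s) (A := 1 + N ^ 2) (K := 10) (V := 1 / 2)
    (T := Set.Icc (N - 1 / 4) (N + 1 / 4)) h1
    (fun x hx ↦ by
      have := abs_le.1 (hsupp x hx)
      exact ⟨by linarith, by linarith⟩) measurableSet_Icc hA (by norm_num)
    (fun x hx ↦ weight_comparable (by rw [abs_of_nonneg (by linarith [hx.1])]; linarith [hx.1])
      (by linarith) (by rw [abs_of_nonneg (by linarith [hx.1])]; linarith [hx.2]))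
    (by rw [Real.volume_Icc]; exact ENNReal.ofReal_le_ofReal (by linarith))
  have hL := le_energy_of_norm_ge (s := s) (W := (1 + N ^ 2) ^ s / 10 ^ |s|)
    (m := 1 / 2 * (1 * (1 / 64)))
    (V := 1 / 8) (T := Set.Icc (N - 1 / 16) (N + 1 / 16)) (out := cubicForm f) measurableSet_Icc
    (by norm_num) (by positivity)
    (fun x hx ↦ rpow_div_le hA (by norm_num) (weight_comparable
      (by rw [abs_of_nonneg (by linarith [hx.1])]; linarith [hx.1]) (by linarith)
      (by rw [abs_of_nonneg (by linarith [hx.1])]; linarith [hx.2])))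
    (fun ξ hξ ↦ ?_)
    (by rw [Real.volume_Icc]; exact ENNReal.ofReal_le_ofReal (by linarith))
  · have := le_mul_of_ofReal_le (by positivity) hL (hC f) ((pow_le_pow_left' hE 3).trans_eq
      (ENNReal.ofReal_pow (by positivity) 3).symm)
    rw [Real.rpow_mul_natCast hA.le]
    calc _ = (1 + N ^ 2) ^ s / 10 ^ |s| * (1 / 2 * (1 * (1 / 64))) ^ 2 * (1 / 8) := by ring
      _ ≤ _ := this
      _ = _ := by ring
  · set T : Set (ℝ × ℝ) := Set.Icc (-(1 / 16)) (1 / 16) ×ˢ Set.Icc (N - 1 / 16) (N + 1 / 16)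
    have hc := hf.continuous
    obtain ⟨M, hM⟩ := hf.exists_norm_le
    have hPi : Integrable fun q : ℝ × ℝ ↦ φ (ξ - q.1) * φ q.2 * φ (q.2 - q.1) :=
      ((hf.integrable.comp_sub_left ξ).mul_prod hf.integrable).mul_bdd (c := M)
        (by fun_prop) (.of_forall fun q ↦ hM _)
    have hTv : volume.real T = 1 / 64 := by
      rw [Measure.volume_eq_prod, measureReal_prod_prod, Real.volume_real_Icc_of_le (by norm_num),
        Real.volume_real_Icc_of_le (by linarith)]
      ring
    have := norm_integral_osc_ge_of_abs_le (μ := volume)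
      (Φ := fun q : ℝ × ℝ ↦ 2 * q.1 * (ξ - q.2))
      (P := fun q : ℝ × ℝ ↦ φ (ξ - q.1) * φ q.2 * φ (q.2 - q.1)) (T := T) (p := 1)
      (by fun_prop) hPi
      (fun q ↦ mul_nonneg (mul_nonneg (hf.nonneg _) (hf.nonneg _)) (hf.nonneg _)) ?_
      (measurableSet_Icc.prod measurableSet_Icc)
      (isCompact_Icc.prod isCompact_Icc).measure_ne_top ?_
    · rw [hTv] at this
      refine this.trans_eq ?_
      unfold cubicForm
      congr 2
      ext q
      rw [hf.coe, hf.coe, hf.coe, Complex.conj_ofReal]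
      push_cast
      ring
    · rintro ⟨y, x⟩ hq
      have hx := abs_le.1 (hsupp _ (right_ne_zero_of_mul (left_ne_zero_of_mul hq)))
      have hy := abs_le.1 (hsupp _ (left_ne_zero_of_mul (left_ne_zero_of_mul hq)))
      simp only at hx hy
      have e1 : |y| ≤ 1 / 2 := abs_le.2 ⟨by linarith [hξ.1], by linarith [hξ.2]⟩
      have e2 : |ξ - x| ≤ 1 / 2 := abs_le.2 ⟨by linarith [hξ.1], by linarith [hξ.2]⟩
      rw [abs_mul, abs_mul, abs_of_pos (by norm_num : (0 : ℝ) < 2)]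
      nlinarith [abs_nonneg y, abs_nonneg (ξ - x)]
    · rintro ⟨y, x⟩ ⟨hy, hx⟩
      simp only [Set.mem_Icc] at hx hy hξ
      rw [hone _ (abs_le.2 ⟨by linarith, by linarith⟩),
        hone _ (abs_le.2 ⟨by linarith, by linarith⟩),
        hone _ (abs_le.2 ⟨by linarith, by linarith⟩)]
      norm_num

/-! ### Necessity: the mixed interaction -/

/-- Noncoherent test functions: `f` is a unit bump at `c` and `g` a unit bump at `N`, so that the
output lives at `N + c`. The choices `c = 0` and `c = -N` give high and low output frequency. -/
theorem mixed_necessary_aux {s₁ s₂ : ℝ} {C : ℝ≥0} (hC : ∀ f g : 𝓢(ℝ, ℂ),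
    energy s₁ (mixedForm f g) ≤ C * (energy s₁ f * energy s₂ g)) {N c B D : ℝ} (hN : 8 ≤ N)
    (hc : -N ≤ c) (hc0 : c ≤ 0) (hB : 0 < B) (hD : 0 < D)
    (hfc : ∀ x, |x - c| ≤ 2 → 1 + x ^ 2 ≤ 10 * B ∧ B ≤ 10 * (1 + x ^ 2))
    (hoc : ∀ x, |x - (N + c)| ≤ 1 / 2 → 1 + x ^ 2 ≤ 10 * D ∧ D ≤ 10 * (1 + x ^ 2)) :
    1 / 10 ^ |s₁| * (1 / 96) ^ 2 * (D ^ s₁ * (1 + N ^ 2) ^ (-3 : ℝ)) ≤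
      C * (10 ^ |s₁| * 4 * (10 ^ |s₂| * 4)) * (B ^ s₁ * (1 + N ^ 2) ^ s₂) := by
  have hA : 0 < 1 + N ^ 2 := by positivity
  have hN0 : 0 < N := by linarith
  obtain ⟨f, φ, hf, hf1, hfone, hfsupp⟩ := exists_bump c (r := 1) one_pos
  obtain ⟨g, ψ, hg, hg1, hgone, hgsupp⟩ := exists_bump N (r := 1) one_pos
  have hEf := hf.energy_le (s := s₁) (A := B) (K := 10) (V := 4)
    (T := Set.Icc (c - 2) (c + 2)) hf1
    (fun x hx ↦ by
      have := abs_le.1 (hfsupp x hx)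
      exact ⟨by linarith, by linarith⟩) measurableSet_Icc hB (by norm_num)
    (fun x hx ↦ hfc x (abs_le.2 ⟨by linarith [hx.1], by linarith [hx.2]⟩))
    (by rw [Real.volume_Icc]; exact ENNReal.ofReal_le_ofReal (by linarith))
  have hEg := hg.energy_le (s := s₂) (A := 1 + N ^ 2) (K := 10) (V := 4)
    (T := Set.Icc (N - 2) (N + 2)) hg1
    (fun x hx ↦ by
      have := abs_le.1 (hgsupp x hx)
      exact ⟨by linarith, by linarith⟩) measurableSet_Icc hA (by norm_num)
    (fun x hx ↦ weight_comparable (by rw [abs_of_nonneg (by linarith [hx.1])]; linarith [hx.1])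
      hN0.le (by rw [abs_of_nonneg (by linarith [hx.1])]; linarith [hx.2]))
    (by rw [Real.volume_Icc]; exact ENNReal.ofReal_le_ofReal (by linarith))
  have hL := le_energy_of_phase (s := s₁) (out := mixedForm f g)
    (Φ := fun ξ k ↦ k * (2 * ξ - k + k ^ 2)) (dΦ := fun _ k ↦ k * 2) (a := N + c - 1 / 2)
    (b := N - 1 / 2) (q := 1 / (16 * N ^ 3)) (W := D ^ s₁ / 10 ^ |s₁|) (lam := N) (K := 3)
    (by unfold Function.uncurry; fun_prop)
    (fun k x ↦ by
      have := ((((hasDerivAt_id x).const_mul 2).sub_const k).add_const (k ^ 2)).const_mul k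
      simpa using this)
    (fun k ↦ by fun_prop) (by linarith) (by norm_num)
    (fun x _ k hk ↦ ⟨by linarith [hk.1], by linarith [hk.2]⟩) (by positivity) (by positivity)
    (fun x hx ↦ rpow_div_le hD (by norm_num) (hoc x (abs_le.2
      ⟨by linarith [hx.1], by linarith [hx.2]⟩)))
    (fun ξ hξ ↦ ?_)
  · have := le_mul_of_ofReal_le (by positivity) hL (hC f g) ((mul_le_mul' hEf hEg).trans_eq
      (ENNReal.ofReal_mul (by positivity)).symm)
    have hn := rpow_neg_natCast_le hN0 3
    push_cast at hn
    calc _ ≤ 1 / 10 ^ |s₁| * (1 / 96) ^ 2 * (D ^ s₁ * ((N ^ 2) ^ 3)⁻¹) := by gcongr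
      _ = D ^ s₁ / 10 ^ |s₁| * (1 / (16 * N ^ 3) / (2 * 3)) ^ 2 := by field_simp; norm_num
      _ ≤ _ := this
      _ = _ := by ring
  · have hξ1 := hξ.1
    have hξ2 := hξ.2
    have key := norm_integral_osc_ge_of_pos (Φ := fun k ↦ k * (2 * ξ - k + k ^ 2))
      (P := fun k ↦ ψ k * φ (ξ - k)) (J := Set.Icc (N - 1 / 2) (N - 1 / 2 + 1)) (p := 1)
      (D := 16 * N ^ 3) (by fun_prop) (hg.integrable_mul hf (by fun_prop))
      (fun k ↦ mul_nonneg (hg.nonneg _) (hf.nonneg _)) ?_ isCompact_Icc one_pos ?_ ?_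
    · refine key.trans_eq ?_
      rw [mixedForm, ← integral_sub_left_eq_self _ volume ξ]
      congr 2
      ext k
      rw [hf.coe, hg.coe, sub_sub_cancel]
      push_cast
      ring
    · intro k hk
      have := abs_le.1 (hgsupp k (left_ne_zero_of_mul hk))
      have : 0 < k := by linarith
      refine mul_pos this ?_
      nlinarith
    · intro k hk
      have hk1 := hk.1
      have hk2 := hk.2
      rw [hgone k (abs_le.2 ⟨by linarith, by linarith⟩),
        hfone _ (abs_le.2 ⟨by linarith, by linarith⟩), one_mul]
    · intro k hk
      have hk1 := hk.1
      have hk2 := hk.2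
      have hk0 : 0 ≤ k := by linarith
      have hk2N : k ≤ 2 * N := by linarith
      have h1 : 2 * ξ - k + k ^ 2 ≤ 8 * N ^ 2 := by nlinarith
      calc k * (2 * ξ - k + k ^ 2) ≤ k * (8 * N ^ 2) := by gcongr
        _ ≤ 2 * N * (8 * N ^ 2) := by gcongr
        _ = _ := by ring

theorem mixed_necessary_abs {s₁ s₂ : ℝ} (h : ∃ C : ℝ≥0, ∀ f g : 𝓢(ℝ, ℂ),
    energy s₁ (mixedForm f g) ≤ C * (energy s₁ f * energy s₂ g)) : -3 + |s₁| ≤ s₂ := by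
  obtain ⟨C, hC⟩ := h
  rcases le_total 0 s₁ with hs | hs
  · rw [abs_of_nonneg hs, add_comm]
    refine le_of_forall_rpow_le (N₀ := 8) (c := 1 / 10 ^ |s₁| * (1 / 96) ^ 2)
      (C := C * (10 ^ |s₁| * 4 * (10 ^ |s₂| * 4))) (by positivity) fun N hN ↦ ?_
    have := mixed_necessary_aux hC (N := N) (c := 0) (B := 1) (D := 1 + N ^ 2) hN (by linarith)
      le_rfl one_pos (by positivity)
      (fun x hx ↦ weight_comparable_one (by rw [sub_zero] at hx; linarith))
      (fun x hx ↦ by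
        have hx' := abs_le.1 hx
        exact weight_comparable (by rw [abs_of_nonneg (by linarith)]; linarith)
          (by linarith) (by rw [abs_of_nonneg (by linarith)]; linarith))
    rwa [← Real.rpow_add (by positivity), Real.one_rpow, one_mul] at this
  · rw [abs_of_nonpos hs]
    suffices -3 ≤ s₁ + s₂ by linarith
    refine le_of_forall_rpow_le (N₀ := 8) (c := 1 / 10 ^ |s₁| * (1 / 96) ^ 2)
      (C := C * (10 ^ |s₁| * 4 * (10 ^ |s₂| * 4))) (by positivity) fun N hN ↦ ?_
    have := mixed_necessary_aux hC (N := N) (c := -N) (B := 1 + N ^ 2) (D := 1) hN le_rfl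
      (by linarith) (by positivity) one_pos
      (fun x hx ↦ by
        have hx' := abs_le.1 hx
        exact weight_comparable (by rw [abs_of_nonpos (by linarith)]; linarith)
          (by linarith) (by rw [abs_of_nonpos (by linarith)]; linarith))
      (fun x hx ↦ weight_comparable_one (by rw [add_neg_cancel, sub_zero] at hx; linarith))
    rwa [← Real.rpow_add (by positivity), Real.one_rpow, one_mul] at this

/-- Resonant test functions: the phase `k (2y + k + k²)` vanishes at `k = N`,
`y = -(N² + N) / 2`, and stays bounded for perturbations of size `N⁻²` and `N⁻¹`. -/
theorem mixed_necessary_neg_one {s₁ s₂ : ℝ} (h : ∃ C : ℝ≥0, ∀ f g : 𝓢(ℝ, ℂ),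
    energy s₁ (mixedForm f g) ≤ C * (energy s₁ f * energy s₂ g)) : -1 ≤ s₂ := by
  obtain ⟨C, hC⟩ := h
  refine le_of_forall_rpow_le (N₀ := 8) (c := 1 / 32 ^ |s₁| * (1 / 100) ^ 2)
    (C := C * (32 ^ |s₁| * 4 * (10 ^ |s₂| * (1 / 25)))) (by positivity) fun N hN ↦ ?_
  have hN0 : 0 < N := by linarith
  have hA : 0 < 1 + N ^ 2 := by positivity
  have hA2 : 0 < (1 + N ^ 2) ^ 2 := by positivity
  set c := -(N ^ 2 + N) / 2 with hc
  set r := 1 / 100 * N⁻¹ with hr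
  set t := 1 / 100 * (N ^ 2)⁻¹ with ht
  have hr0 : 0 < r := by positivity
  have ht0 : 0 < t := by positivity
  have hNr : N * r = 1 / 100 := by rw [hr]; field_simp
  have hNt : N ^ 2 * t = 1 / 100 := by rw [ht]; field_simp
  have hNt' : N * t = r := by rw [ht, hr]; field_simp
  have h8t : 8 * t ≤ r := by rw [← hNt']; gcongr
  have h8r : 8 * r ≤ 1 / 100 := by rw [← hNr]; gcongr
  have hNN : 8 * N ≤ N ^ 2 := by rw [sq]; gcongr
  obtain ⟨f, φ, hf, hf1, hfone, hfsupp⟩ := exists_bump c hr0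
  obtain ⟨g, ψ, hg, hg1, hgone, hgsupp⟩ := exists_bump N ht0
  have hEf := hf.energy_le (s := s₁) (A := (1 + N ^ 2) ^ 2) (K := 32) (V := 4 * r)
    (T := Set.Icc (c - 2 * r) (c + 2 * r)) hf1
    (fun x hx ↦ by
      have := abs_le.1 (hfsupp x hx)
      exact ⟨by linarith, by linarith⟩) measurableSet_Icc hA2 (by norm_num)
    (fun x hx ↦ by
      have hx1 := hx.1
      have hx2 := hx.2
      have := abs_of_nonpos (by linarith : x ≤ 0)
      exact weight_comparable_sq (by linarith) (by linarith))
    (by rw [Real.volume_Icc]; exact ENNReal.ofReal_le_ofReal (by linarith))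
  have hEg := hg.energy_le (s := s₂) (A := 1 + N ^ 2) (K := 10) (V := 4 * t)
    (T := Set.Icc (N - 2 * t) (N + 2 * t)) hg1
    (fun x hx ↦ by
      have := abs_le.1 (hgsupp x hx)
      exact ⟨by linarith, by linarith⟩) measurableSet_Icc hA (by norm_num)
    (fun x hx ↦ by
      have hx1 := hx.1
      have hx2 := hx.2
      have := abs_of_nonneg (by linarith : 0 ≤ x)
      exact weight_comparable (by linarith) hN0.le (by linarith))
    (by rw [Real.volume_Icc]; exact ENNReal.ofReal_le_ofReal (by linarith))
  have hL := le_energy_of_norm_ge (s := s₁) (W := ((1 + N ^ 2) ^ 2) ^ s₁ / 32 ^ |s₁|)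
    (m := 1 / 2 * (1 * (2 * t))) (V := r)
    (T := Set.Icc (c + N - r / 2) (c + N + r / 2)) (out := mixedForm f g) measurableSet_Icc
    (by positivity) (by positivity)
    (fun x hx ↦ rpow_div_le hA2 (by norm_num) (by
      have hx1 := hx.1
      have hx2 := hx.2
      have := abs_of_nonpos (by linarith : x ≤ 0)
      exact weight_comparable_sq (by linarith) (by linarith)))
    (fun ξ hξ ↦ ?_)
    (by rw [Real.volume_Icc]; exact ENNReal.ofReal_le_ofReal (by linarith))
  · have := le_mul_of_ofReal_le (by positivity) hL (hC f g) ((mul_le_mul' hEf hEg).trans_eq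
      (ENNReal.ofReal_mul (by positivity)).symm)
    have hn := rpow_neg_natCast_le hN0 1
    rw [Nat.cast_one, pow_one] at hn
    have hX : 0 < ((1 + N ^ 2) ^ 2) ^ s₁ * (r * (N ^ 2)⁻¹) := by positivity
    refine le_of_mul_le_mul_left ?_ hX
    calc _ ≤ ((1 + N ^ 2) ^ 2) ^ s₁ * (r * (N ^ 2)⁻¹) *
          (1 / 32 ^ |s₁| * (1 / 100) ^ 2 * (N ^ 2)⁻¹) := by gcongr
      _ = ((1 + N ^ 2) ^ 2) ^ s₁ / 32 ^ |s₁| * (1 / 2 * (1 * (2 * t))) ^ 2 * r := by rw [ht]; ring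
      _ ≤ _ := this
      _ = _ := by rw [ht]; ring
  · have hξ1 := hξ.1
    have hξ2 := hξ.2
    set T := Set.Icc (ξ - N - t) (ξ - N + t)
    have hTv : volume.real T = 2 * t := by
      rw [Real.volume_real_Icc_of_le (by linarith)]
      ring
    have := norm_integral_osc_ge_of_abs_le (μ := volume)
      (Φ := fun y ↦ (ξ - y) * (2 * ξ - (ξ - y) + (ξ - y) ^ 2))
      (P := fun y ↦ φ y * ψ (ξ - y)) (T := T) (p := 1)
      (by fun_prop) (hf.integrable_mul hg (by fun_prop))
      (fun q ↦ mul_nonneg (hf.nonneg _) (hg.nonneg _)) ?_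
      measurableSet_Icc isCompact_Icc.measure_ne_top ?_
    · rw [hTv] at this
      refine this.trans_eq ?_
      unfold mixedForm
      congr 2
      ext y
      rw [hf.coe, hg.coe]
      push_cast
      ring
    · intro y hy
      have h1 := abs_le.1 (hfsupp _ (left_ne_zero_of_mul hy))
      have h2 := abs_le.1 (hgsupp _ (right_ne_zero_of_mul hy))
      obtain ⟨κ, hκ⟩ : ∃ κ, κ = ξ - y - N := ⟨_, rfl⟩
      rw [← hκ] at h2
      have hκN : |N * κ| ≤ 2 * r := by
        rw [abs_mul, abs_of_pos hN0, ← hNt']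
        nlinarith [abs_le.2 h2]
      have hκ2 : κ ^ 2 ≤ t := by
        rw [← sq_abs]
        nlinarith [abs_le.2 h2, abs_nonneg κ]
      have hκN' := abs_le.1 hκN
      rw [show 2 * ξ - (ξ - y) + (ξ - y) ^ 2 = 2 * (y - c) + κ + 2 * (N * κ) + κ ^ 2 by
        rw [hκ, hc]; ring, show ξ - y = N + κ by rw [hκ]; ring, abs_mul]
      have e1 : |N + κ| ≤ 2 * N := abs_le.2 ⟨by linarith, by linarith⟩
      have e2 : |2 * (y - c) + κ + 2 * (N * κ) + κ ^ 2| ≤ 10 * r :=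
        abs_le.2 ⟨by linarith [sq_nonneg κ], by linarith⟩
      calc |N + κ| * |2 * (y - c) + κ + 2 * (N * κ) + κ ^ 2| ≤ 2 * N * (10 * r) := by gcongr
        _ = 20 * (N * r) := by ring
        _ ≤ 1 := by rw [hNr]; norm_num
    · intro y hy
      have hy1 := hy.1
      have hy2 := hy.2
      rw [hfone _ (abs_le.2 ⟨by linarith, by linarith⟩),
        hgone _ (abs_le.2 ⟨by linarith, by linarith⟩), one_mul]

theorem volume_union_Icc_le {a b r : ℝ} (hr : 0 ≤ r) :
    volume (Set.Icc (a - r) (a + r) ∪ Set.Icc (b - r) (b + r)) ≤ ENNReal.ofReal (4 * r) := by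
  refine (measure_union_le _ _).trans ?_
  rw [Real.volume_Icc, Real.volume_Icc, ← ENNReal.ofReal_add (by linarith) (by linarith)]
  exact ENNReal.ofReal_le_ofReal (by linarith)

theorem energy_add_le {f g : ℝ → ℂ} (hf : Continuous f) (s : ℝ) :
    energy s (fun x ↦ f x + g x) ≤ 2 * (energy s f + energy s g) := by
  have hm : Measurable fun x ↦ ENNReal.ofReal ((1 + x ^ 2) ^ s) * ‖f x‖ₑ ^ 2 :=
    (continuous_weight s).measurable.ennreal_ofReal.mul (hf.measurable.enorm.pow_const 2)
  rw [energy, energy, energy, ← lintegral_add_left hm, ← lintegral_const_mul' _ _ (by simp)]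
  refine lintegral_mono fun x ↦ ?_
  calc ENNReal.ofReal ((1 + x ^ 2) ^ s) * ‖f x + g x‖ₑ ^ 2
      ≤ ENNReal.ofReal ((1 + x ^ 2) ^ s) * (2 * (‖f x‖ₑ ^ 2 + ‖g x‖ₑ ^ 2)) := by
        gcongr
        rw [mul_add]
        exact (pow_le_pow_left' (enorm_add_le _ _) 2).trans (add_sq_le_two_mul _ _)
    _ = _ := by ring

/-! ### Necessity: the self-interaction of the Airy flow -/

/-- Noncoherent test function: bumps at `N` and `-N` interact to low output frequency. -/
theorem kdv_necessary {s : ℝ} (h : ∃ C : ℝ≥0, ∀ g : 𝓢(ℝ, ℂ),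
    energy s (kdvForm g) ≤ C * energy s g ^ 2) : -1 ≤ s := by
  obtain ⟨C, hC⟩ := h
  suffices -(2 : ℕ) ≤ s * (2 : ℕ) by push_cast at this; linarith
  refine le_of_forall_rpow_le (N₀ := 8) (c := 1 / 10 ^ |s| * (1 / 72) ^ 2)
    (C := C * (10 ^ |s| * 2 ^ 2 * 16) ^ 2) (by positivity) fun N hN ↦ ?_
  have hN0 : 0 < N := by linarith
  have hNN : 8 * N ≤ N ^ 2 := by rw [sq]; gcongr
  have hA : 0 < 1 + N ^ 2 := by positivity
  obtain ⟨u, φ, hu, hu1, huone, husupp⟩ := exists_bump N (r := 2) two_pos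
  obtain ⟨v, ψ, hv, hv1, hvone, hvsupp⟩ := exists_bump (-N) (r := 2) two_pos
  have hg := hu.add hv
  set g := u + v
  have hsupp : ∀ x, φ x + ψ x ≠ 0 → |x - N| ≤ 4 ∨ |x - -N| ≤ 4 := fun x hx ↦ by
    by_cases h0 : φ x = 0
    · rw [h0, zero_add] at hx
      exact Or.inr ((hvsupp x hx).trans (by norm_num))
    · exact Or.inl ((husupp x h0).trans (by norm_num))
  have hE := hg.energy_le (s := s) (M := 2) (A := 1 + N ^ 2) (K := 10) (V := 16)
    (T := Set.Icc (N - 4) (N + 4) ∪ Set.Icc (-N - 4) (-N + 4))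
    (fun x ↦ by linarith [hu1 x, hv1 x])
    (fun x hx ↦ (hsupp x hx).imp
      (fun h ↦ ⟨by linarith [(abs_le.1 h).1], by linarith [(abs_le.1 h).2]⟩)
      (fun h ↦ ⟨by linarith [(abs_le.1 h).1], by linarith [(abs_le.1 h).2]⟩))
    (measurableSet_Icc.union measurableSet_Icc) hA (by norm_num)
    (fun x hx ↦ by
      rcases hx with ⟨hx1, hx2⟩ | ⟨hx1, hx2⟩
      · have := abs_of_nonneg (by linarith : 0 ≤ x)
        exact weight_comparable (by linarith) hN0.le (by linarith)
      · have := abs_of_nonpos (by linarith : x ≤ 0)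
        exact weight_comparable (by linarith) hN0.le (by linarith))
    ((volume_union_Icc_le (by norm_num)).trans_eq (by norm_num))
  have hL := le_energy_of_phase (s := s) (out := kdvForm g)
    (Φ := fun ξ y ↦ ξ * (3 * y * (y - ξ))) (dΦ := fun ξ y ↦ 3 * y * (y - 2 * ξ)) (a := 1)
    (b := N) (q := 1 / (6 * N ^ 2)) (W := 1 ^ s / 10 ^ |s|) (lam := N ^ 2) (K := 6)
    (by unfold Function.uncurry; fun_prop)
    (fun y x ↦ by
      have := (hasDerivAt_id x).mul (((hasDerivAt_id x).const_sub y).const_mul (3 * y))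
      refine (HasDerivAt.congr_deriv this ?_)
      simp only [id]
      ring)
    (fun k ↦ by fun_prop) (by linarith) (by norm_num)
    (fun x hx k hk ↦ by
      have hx1 := hx.1
      have hx2 := hx.2
      have hk1 := hk.1
      have hk2 := hk.2
      constructor <;> nlinarith) (by positivity) (by positivity)
    (fun x hx ↦ rpow_div_le one_pos (by norm_num) (weight_comparable_one
      (abs_le.2 ⟨by linarith [hx.1], by linarith [hx.2]⟩)))
    (fun ξ hξ ↦ ?_)
  · have := le_mul_of_ofReal_le (by positivity) hL (hC g) ((pow_le_pow_left' hE 2).trans_eq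
      (ENNReal.ofReal_pow (by positivity) 2).symm)
    have hn := rpow_neg_natCast_le hN0 2
    rw [Real.rpow_mul_natCast hA.le]
    rw [Real.one_rpow] at this
    calc _ ≤ 1 / 10 ^ |s| * (1 / 72) ^ 2 * ((N ^ 2) ^ 2)⁻¹ := by gcongr
      _ = 1 / 10 ^ |s| * (1 / (6 * N ^ 2) / (2 * 6)) ^ 2 := by field_simp; norm_num
      _ ≤ _ := this
      _ = _ := by ring
  · obtain ⟨hξ1, hξ2⟩ := hξ
    have key := norm_integral_osc_ge_of_pos (Φ := fun y ↦ ξ * (3 * y * (y - ξ)))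
      (P := fun y ↦ (φ y + ψ y) * (φ (ξ - y) + ψ (ξ - y))) (J := Set.Icc N (N + 1)) (p := 1)
      (D := ξ * (6 * N ^ 2)) (by fun_prop) (hg.integrable_mul hg (by fun_prop))
      (fun k ↦ mul_nonneg (hg.nonneg _) (hg.nonneg _)) ?_ isCompact_Icc one_pos ?_ ?_
    · have hξ0 : 0 < ξ := by linarith
      rw [kdvForm, norm_mul, Complex.norm_real, Real.norm_of_nonneg hξ0.le]
      refine le_trans (le_of_eq ?_) (mul_le_mul_of_nonneg_left (key.trans_eq ?_) hξ0.le)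
      · rw [← mul_assoc]
        congr 1
        field_simp
      · congr 2
        ext y
        rw [hg.coe, hg.coe, Complex.ofReal_mul]
        congr 2
        ring
    · intro y hy
      have : 0 < y * (y - ξ) := by
        rcases hsupp y (left_ne_zero_of_mul hy) with h | h
        · have := abs_le.1 h
          exact mul_pos (by linarith) (by linarith)
        · have := abs_le.1 h
          exact mul_pos_of_neg_of_neg (by linarith) (by linarith)
      rw [mul_assoc]
      exact mul_pos (by linarith) (by linarith)
    · rintro k ⟨hk1, hk2⟩
      rw [huone k (abs_le.2 ⟨by linarith, by linarith⟩),
        hvone (ξ - k) (abs_le.2 ⟨by linarith, by linarith⟩)]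
      nlinarith [hv.nonneg k, hu.nonneg (ξ - k)]
    · rintro k ⟨hk1, hk2⟩
      refine mul_le_mul_of_nonneg_left ?_ (by linarith)
      nlinarith

/-! ### Necessity: the density interaction -/

theorem hasDerivAt_density_phase (y x : ℝ) :
    HasDerivAt (fun x : ℝ ↦ x * (x ^ 2 - x + 2 * y)) (3 * x ^ 2 - 2 * x + 2 * y) x := by
  have := (hasDerivAt_id x).mul
    ((((hasDerivAt_id x).pow 2).sub (hasDerivAt_id x)).add_const (2 * y))
  refine (HasDerivAt.congr_deriv this ?_)
  simp only [id, Pi.pow_apply, Pi.sub_apply]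
  ring

theorem norm_densityForm_of_isProfile {f : 𝓢(ℝ, ℂ)} {φ : ℝ → ℝ} (hf : IsProfile f φ) {ξ : ℝ}
    (hξ : 0 ≤ ξ) : ‖densityForm f ξ‖ =
      ξ * ‖∫ y, osc (ξ * (ξ ^ 2 - ξ + 2 * y)) * ((φ y * φ (y - ξ) : ℝ) : ℂ)‖ := by
  rw [densityForm, norm_mul, Complex.norm_real, Real.norm_of_nonneg hξ, ← norm_integral_osc_neg]
  congr 3
  ext y
  rw [hf.coe, hf.coe, Complex.conj_ofReal, Complex.ofReal_mul]

/-- Noncoherent test function: a bump at `N` interacts with itself to low output frequency. -/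
theorem density_necessary_neg_half {s₁ s₂ : ℝ} (h : ∃ C : ℝ≥0, ∀ f : 𝓢(ℝ, ℂ),
    energy s₂ (densityForm f) ≤ C * energy s₁ f ^ 2) : -(1 / 2) ≤ s₁ := by
  obtain ⟨C, hC⟩ := h
  suffices -(1 : ℕ) ≤ s₁ * (2 : ℕ) by push_cast at this; linarith
  refine le_of_forall_rpow_le (N₀ := 8) (c := 1 / 10 ^ |s₂| * (1 / 48) ^ 2)
    (C := C * (10 ^ |s₁| * 8) ^ 2) (by positivity) fun N hN ↦ ?_
  have hN0 : 0 < N := by linarith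
  have hA : 0 < 1 + N ^ 2 := by positivity
  obtain ⟨f, φ, hf, h1, hone, hsupp⟩ := exists_bump N (r := 2) two_pos
  have hE := hf.energy_le (s := s₁) (A := 1 + N ^ 2) (K := 10) (V := 8)
    (T := Set.Icc (N - 4) (N + 4)) h1
    (fun x hx ↦ by
      have := abs_le.1 (hsupp x hx)
      exact ⟨by linarith, by linarith⟩) measurableSet_Icc hA (by norm_num)
    (fun x hx ↦ by
      have hx1 := hx.1
      have hx2 := hx.2
      have := abs_of_nonneg (by linarith : 0 ≤ x)
      exact weight_comparable (by linarith) hN0.le (by linarith))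
    (by rw [Real.volume_Icc]; exact ENNReal.ofReal_le_ofReal (by linarith))
  have hL := le_energy_of_phase (s := s₂) (out := densityForm f)
    (Φ := fun ξ y ↦ ξ * (ξ ^ 2 - ξ + 2 * y)) (dΦ := fun ξ y ↦ 3 * ξ ^ 2 - 2 * ξ + 2 * y) (a := 1)
    (b := N) (q := 1 / (4 * N)) (W := 1 ^ s₂ / 10 ^ |s₂|) (lam := N) (K := 6)
    (by unfold Function.uncurry; fun_prop) hasDerivAt_density_phase
    (fun k ↦ by fun_prop) (by linarith) (by norm_num)
    (fun x hx k hk ↦ by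
      have hx1 := hx.1
      have hx2 := hx.2
      have hk1 := hk.1
      have hk2 := hk.2
      constructor <;> nlinarith) (by positivity) (by positivity)
    (fun x hx ↦ rpow_div_le one_pos (by norm_num) (weight_comparable_one
      (abs_le.2 ⟨by linarith [hx.1], by linarith [hx.2]⟩)))
    (fun ξ hξ ↦ ?_)
  · have := le_mul_of_ofReal_le (by positivity) hL (hC f) ((pow_le_pow_left' hE 2).trans_eq
      (ENNReal.ofReal_pow (by positivity) 2).symm)
    have hn := rpow_neg_natCast_le hN0 1
    rw [pow_one] at hn
    rw [Real.rpow_mul_natCast hA.le]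
    rw [Real.one_rpow] at this
    calc _ ≤ 1 / 10 ^ |s₂| * (1 / 48) ^ 2 * (N ^ 2)⁻¹ := by gcongr
      _ = 1 / 10 ^ |s₂| * (1 / (4 * N) / (2 * 6)) ^ 2 := by field_simp; norm_num
      _ ≤ _ := this
      _ = _ := by ring
  · obtain ⟨hξ1, hξ2⟩ := hξ
    have hξ0 : 0 < ξ := by linarith
    have key := norm_integral_osc_ge_of_pos (Φ := fun y ↦ ξ * (ξ ^ 2 - ξ + 2 * y))
      (P := fun y ↦ φ y * φ (y - ξ)) (J := Set.Icc N (N + 1)) (p := 1)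
      (D := ξ * (4 * N)) (by fun_prop) (hf.integrable_mul hf (by fun_prop))
      (fun k ↦ mul_nonneg (hf.nonneg _) (hf.nonneg _)) ?_ isCompact_Icc one_pos ?_ ?_
    · rw [norm_densityForm_of_isProfile hf hξ0.le]
      refine le_trans (le_of_eq ?_) (mul_le_mul_of_nonneg_left key hξ0.le)
      rw [← mul_assoc]
      congr 1
      field_simp
    · intro y hy
      have := abs_le.1 (hsupp y (left_ne_zero_of_mul hy))
      refine mul_pos hξ0 ?_
      nlinarith
    · rintro k ⟨hk1, hk2⟩
      rw [hone k (abs_le.2 ⟨by linarith, by linarith⟩),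
        hone (k - ξ) (abs_le.2 ⟨by linarith, by linarith⟩), one_mul]
    · rintro k ⟨hk1, hk2⟩
      refine mul_le_mul_of_nonneg_left ?_ hξ0.le
      nlinarith

/-- Noncoherent test function with a high- and a low-frequency part. The amplitude
`(1 + N²)^(-s₁/2)` of the high-frequency part makes the two parts equally large in `H^{s₁}`. -/
theorem density_necessary_add_two {s₁ s₂ : ℝ} (h : ∃ C : ℝ≥0, ∀ f : 𝓢(ℝ, ℂ),
    energy s₂ (densityForm f) ≤ C * energy s₁ f ^ 2) : s₂ ≤ s₁ + 2 := by
  obtain ⟨C, hC⟩ := h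
  suffices s₂ + (-s₁ + -(2 : ℕ)) ≤ 0 by push_cast at this; linarith
  refine le_of_forall_rpow_le (N₀ := 8) (c := 1 / 10 ^ |s₂| * (1 / 48) ^ 2)
    (C := C * (2 * (10 ^ |s₁| * 4 + 10 ^ |s₁| * 4)) ^ 2) (by positivity) fun N hN ↦ ?_
  have hN0 : 0 < N := by linarith
  have hNN : 8 * N ≤ N ^ 2 := by rw [sq]; gcongr
  have hA : 0 < 1 + N ^ 2 := by positivity
  obtain ⟨u, φ, hu, hu1, huone, husupp⟩ := exists_bump N (r := 1) one_pos
  obtain ⟨v, ψ, hv, hv1, hvone, hvsupp⟩ := exists_bump 0 (r := 1) one_pos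
  set l := (1 + N ^ 2) ^ (-s₁ / 2) with hl
  have hl0 : 0 < l := by positivity
  have hl2 : l ^ 2 = (1 + N ^ 2) ^ (-s₁) := by
    rw [hl, ← Real.rpow_mul_natCast hA.le]
    congr 1
    push_cast
    ring
  have hlu := hu.smul hl0.le
  have hf := hlu.add hv
  have hEu := hlu.energy_le (s := s₁) (M := l) (A := 1 + N ^ 2) (K := 10) (V := 4)
    (T := Set.Icc (N - 2) (N + 2)) (fun x ↦ mul_le_of_le_one_right hl0.le (hu1 x))
    (fun x hx ↦ by
      have := abs_le.1 (husupp x (right_ne_zero_of_mul hx))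
      exact ⟨by linarith, by linarith⟩) measurableSet_Icc hA (by norm_num)
    (fun x hx ↦ by
      have hx1 := hx.1
      have hx2 := hx.2
      have := abs_of_nonneg (by linarith : 0 ≤ x)
      exact weight_comparable (by linarith) hN0.le (by linarith))
    (by rw [Real.volume_Icc]; exact ENNReal.ofReal_le_ofReal (by linarith))
  have hEv := hv.energy_le (s := s₁) (A := 1) (K := 10) (V := 4)
    (T := Set.Icc (-2) 2) hv1
    (fun x hx ↦ by
      have := abs_le.1 (hvsupp x hx)
      exact ⟨by linarith, by linarith⟩) measurableSet_Icc one_pos (by norm_num)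
    (fun x hx ↦ weight_comparable_one (abs_le.2 ⟨by linarith [hx.1], by linarith [hx.2]⟩))
    (by rw [Real.volume_Icc]; exact ENNReal.ofReal_le_ofReal (by norm_num))
  rw [hl2, mul_assoc (10 ^ |s₁|), ← Real.rpow_add hA, add_neg_cancel, Real.rpow_zero,
    mul_one] at hEu
  rw [Real.one_rpow, mul_one, one_pow, mul_one] at hEv
  have hE : energy s₁ ((l : ℂ) • u + v) ≤
      ENNReal.ofReal (2 * (10 ^ |s₁| * 4 + 10 ^ |s₁| * 4)) := by
    refine (energy_add_le ((l : ℂ) • u).continuous s₁).trans ?_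
    rw [ENNReal.ofReal_mul zero_le_two, ENNReal.ofReal_add (by positivity) (by positivity),
      ENNReal.ofReal_ofNat]
    gcongr
  set f := (l : ℂ) • u + v
  have hL := le_energy_of_phase (s := s₂) (out := densityForm f)
    (Φ := fun ξ y ↦ ξ * (ξ ^ 2 - ξ + 2 * y)) (dΦ := fun ξ y ↦ 3 * ξ ^ 2 - 2 * ξ + 2 * y)
    (a := N - 1 / 2) (b := N - 1 / 2) (q := l / (4 * N ^ 2))
    (W := (1 + N ^ 2) ^ s₂ / 10 ^ |s₂|) (lam := N ^ 2) (K := 6)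
    (by unfold Function.uncurry; fun_prop) hasDerivAt_density_phase
    (fun k ↦ by fun_prop) (by linarith) (by norm_num)
    (fun x hx k hk ↦ by
      have hx1 := hx.1
      have hx2 := hx.2
      have hk1 := hk.1
      have hk2 := hk.2
      constructor <;> nlinarith) (by positivity) (by positivity)
    (fun x hx ↦ rpow_div_le hA (by norm_num) (by
      have hx1 := hx.1
      have hx2 := hx.2
      have := abs_of_nonneg (by linarith : 0 ≤ x)
      exact weight_comparable (by linarith) hN0.le (by linarith)))
    (fun ξ hξ ↦ ?_)
  · have := le_mul_of_ofReal_le (by positivity) hL (hC f) ((pow_le_pow_left' hE 2).trans_eq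
      (ENNReal.ofReal_pow (by positivity) 2).symm)
    have hn := rpow_neg_natCast_le hN0 2
    rw [Real.rpow_add hA, Real.rpow_add hA, ← hl2, Real.rpow_zero, mul_one]
    calc _ ≤ 1 / 10 ^ |s₂| * (1 / 48) ^ 2 * ((1 + N ^ 2) ^ s₂ * (l ^ 2 * ((N ^ 2) ^ 2)⁻¹)) := by
          gcongr
      _ = (1 + N ^ 2) ^ s₂ / 10 ^ |s₂| * (l / (4 * N ^ 2) / (2 * 6)) ^ 2 := by
          field_simp; norm_num
      _ ≤ _ := this
  · obtain ⟨hξ1, hξ2⟩ := hξ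
    have hξ0 : 0 < ξ := by linarith
    have key := norm_integral_osc_ge_of_pos (Φ := fun y ↦ ξ * (ξ ^ 2 - ξ + 2 * y))
      (P := fun y ↦ (l * φ y + ψ y) * (l * φ (y - ξ) + ψ (y - ξ)))
      (J := Set.Icc (N - 1 / 2) (N - 1 / 2 + 1)) (p := l)
      (D := ξ * (4 * N ^ 2)) (by fun_prop) (hf.integrable_mul hf (by fun_prop))
      (fun k ↦ mul_nonneg (hf.nonneg _) (hf.nonneg _)) ?_ isCompact_Icc hl0 ?_ ?_
    · rw [norm_densityForm_of_isProfile hf hξ0.le]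
      refine le_trans (le_of_eq ?_) (mul_le_mul_of_nonneg_left key hξ0.le)
      rw [← mul_assoc]
      congr 1
      field_simp
    · intro y hy
      have hy2 : -2 ≤ y := by
        by_cases h0 : φ y = 0
        · have hy' := left_ne_zero_of_mul hy
          rw [h0, mul_zero, zero_add] at hy'
          have := abs_le.1 (hvsupp y hy')
          linarith
        · have := abs_le.1 (husupp y h0)
          linarith
      refine mul_pos hξ0 ?_
      nlinarith
    · rintro k ⟨hk1, hk2⟩
      rw [huone k (abs_le.2 ⟨by linarith, by linarith⟩),
        hvone (k - ξ) (abs_le.2 ⟨by linarith, by linarith⟩), mul_one]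
      have h1 : l ≤ l + ψ k := by linarith [hv.nonneg k]
      have h2 : 1 ≤ l * φ (k - ξ) + 1 := by linarith [hlu.nonneg (k - ξ)]
      calc l = l * 1 := (mul_one l).symm
        _ ≤ _ := mul_le_mul h1 h2 zero_le_one (by linarith)
    · rintro k ⟨hk1, hk2⟩
      refine mul_le_mul_of_nonneg_left ?_ hξ0.le
      nlinarith

/-- Resonant test function: the phase `η (η² - η + 2y)` vanishes at `η = N`,
`y = (N - N²) / 2`, and stays bounded for perturbations of size `N⁻²` and `N⁻¹`. -/
theorem density_necessary_four_mul {s₁ s₂ : ℝ} (h : ∃ C : ℝ≥0, ∀ f : 𝓢(ℝ, ℂ),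
    energy s₂ (densityForm f) ≤ C * energy s₁ f ^ 2) : s₂ ≤ 4 * s₁ := by
  obtain ⟨C, hC⟩ := h
  suffices s₂ ≤ s₁ * (4 : ℕ) by push_cast at this; linarith
  refine le_of_forall_rpow_le (N₀ := 8) (c := 1 / 10 ^ |s₂| * (1 / 400) ^ 2 * (1 / 50))
    (C := C * (32 ^ |s₁| * 2 ^ 2 * (8 / 100)) ^ 2) (by positivity) fun N hN ↦ ?_
  have hN0 : 0 < N := by linarith
  have hA : 0 < 1 + N ^ 2 := by positivity
  have hA2 : 0 < (1 + N ^ 2) ^ 2 := by positivity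
  set c := (N - N ^ 2) / 2 with hc
  set r := 1 / 100 * N⁻¹ with hr
  set t := 1 / 100 * (N ^ 2)⁻¹ with ht
  have hr0 : 0 < r := by positivity
  have ht0 : 0 < t := by positivity
  have hNr : N * r = 1 / 100 := by rw [hr]; field_simp
  have hNt' : N * t = r := by rw [ht, hr]; field_simp
  have h8t : 8 * t ≤ r := by rw [← hNt']; gcongr
  have h8r : 8 * r ≤ 1 / 100 := by rw [← hNr]; gcongr
  have hNN : 8 * N ≤ N ^ 2 := by rw [sq]; gcongr
  obtain ⟨u, φ, hu, hu1, huone, husupp⟩ := exists_bump c hr0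
  obtain ⟨v, ψ, hv, hv1, hvone, hvsupp⟩ := exists_bump (c - N) hr0
  have hf := hu.add hv
  set f := u + v
  have hsupp : ∀ x, φ x + ψ x ≠ 0 → |x - c| ≤ 2 * r ∨ |x - (c - N)| ≤ 2 * r := fun x hx ↦ by
    by_cases h0 : φ x = 0
    · rw [h0, zero_add] at hx
      exact Or.inr (hvsupp x hx)
    · exact Or.inl (husupp x h0)
  have hE := hf.energy_le (s := s₁) (M := 2) (A := (1 + N ^ 2) ^ 2) (K := 32) (V := 4 * (2 * r))
    (T := Set.Icc (c - 2 * r) (c + 2 * r) ∪ Set.Icc (c - N - 2 * r) (c - N + 2 * r))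
    (fun x ↦ by linarith [hu1 x, hv1 x])
    (fun x hx ↦ (hsupp x hx).imp
      (fun h ↦ ⟨by linarith [(abs_le.1 h).1], by linarith [(abs_le.1 h).2]⟩)
      (fun h ↦ ⟨by linarith [(abs_le.1 h).1], by linarith [(abs_le.1 h).2]⟩))
    (measurableSet_Icc.union measurableSet_Icc) hA2 (by norm_num)
    (fun x hx ↦ by
      rcases hx with ⟨hx1, hx2⟩ | ⟨hx1, hx2⟩ <;>
      · have := abs_of_nonpos (by linarith : x ≤ 0)
        exact weight_comparable_sq (by linarith) (by linarith))
    (volume_union_Icc_le (by positivity))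
  have hL := le_energy_of_norm_ge (s := s₂) (W := (1 + N ^ 2) ^ s₂ / 10 ^ |s₂|)
    (m := N / 2 * (1 / 2 * (1 * r))) (V := 2 * t)
    (T := Set.Icc (N - t) (N + t)) (out := densityForm f) measurableSet_Icc
    (by positivity) (by positivity)
    (fun x hx ↦ rpow_div_le hA (by norm_num) (by
      have hx1 := hx.1
      have hx2 := hx.2
      have := abs_of_nonneg (by linarith : 0 ≤ x)
      exact weight_comparable (by linarith) hN0.le (by linarith)))
    (fun ξ hξ ↦ ?_)
    (by rw [Real.volume_Icc]; exact ENNReal.ofReal_le_ofReal (by linarith))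
  · have := le_mul_of_ofReal_le (by positivity) hL (hC f) ((pow_le_pow_left' hE 2).trans_eq
      (ENNReal.ofReal_pow (by positivity) 2).symm)
    have e4 : (1 + N ^ 2) ^ (s₁ * (4 : ℕ)) = (((1 + N ^ 2) ^ 2) ^ s₁) ^ 2 := by
      rw [← Real.rpow_mul_natCast hA2.le, ← Real.rpow_natCast (1 + N ^ 2) 2, ← Real.rpow_mul hA.le]
      congr 1
      push_cast
      ring
    rw [e4]
    have hX : 0 < (N ^ 2)⁻¹ := by positivity
    refine le_of_mul_le_mul_left ?_ hX
    have hm : N / 2 * (1 / 2 * (1 * r)) = 1 / 400 := by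
      calc _ = (N * r) / 4 := by ring
        _ = _ := by rw [hNr]; norm_num
    rw [hm] at this
    calc _ = (1 + N ^ 2) ^ s₂ / 10 ^ |s₂| * (1 / 400) ^ 2 * (2 * t) := by rw [ht]; ring
      _ ≤ _ := this
      _ = _ := by rw [hr]; ring
  · obtain ⟨hξ1, hξ2⟩ := hξ
    have hξ0 : 0 < ξ := by linarith
    set T := Set.Icc (c - r / 2) (c + r / 2)
    have hTv : volume.real T = r := by
      rw [Real.volume_real_Icc_of_le (by linarith)]
      ring
    have key := norm_integral_osc_ge_of_abs_le (μ := volume)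
      (Φ := fun y ↦ ξ * (ξ ^ 2 - ξ + 2 * y))
      (P := fun y ↦ (φ y + ψ y) * (φ (y - ξ) + ψ (y - ξ))) (T := T) (p := 1)
      (by fun_prop) (hf.integrable_mul hf (by fun_prop))
      (fun q ↦ mul_nonneg (hf.nonneg _) (hf.nonneg _)) ?_
      measurableSet_Icc isCompact_Icc.measure_ne_top ?_
    · rw [hTv] at key
      rw [norm_densityForm_of_isProfile hf hξ0.le]
      exact mul_le_mul (by linarith) key (by positivity) hξ0.le
    · intro y hy
      -- The other combinations of the two bumps have output frequency near `0` or `-N`.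
      have hyc : |y - c| ≤ 2 * r := by
        rcases hsupp y (left_ne_zero_of_mul hy) with h | h
        · exact h
        · have h' := abs_le.1 h
          rcases hsupp _ (right_ne_zero_of_mul hy) with h2 | h2 <;>
          · have h2' := abs_le.1 h2
            linarith
      have h1 := abs_le.1 hyc
      obtain ⟨κ, hκ⟩ : ∃ κ, κ = ξ - N := ⟨_, rfl⟩
      have h2 : |κ| ≤ t := abs_le.2 ⟨by linarith, by linarith⟩
      have hκN : |N * κ| ≤ r := by
        rw [abs_mul, abs_of_pos hN0, ← hNt']
        gcongr
      have hκ2 : κ ^ 2 ≤ t := by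
        rw [← sq_abs]
        nlinarith [abs_nonneg κ]
      have h2' := abs_le.1 h2
      have hκN' := abs_le.1 hκN
      rw [show ξ ^ 2 - ξ + 2 * y = 2 * (y - c) - κ + 2 * (N * κ) + κ ^ 2 by
        rw [hκ, hc]; ring, abs_mul]
      have e1 : |ξ| ≤ 2 * N := abs_le.2 ⟨by linarith, by linarith⟩
      have e2 : |2 * (y - c) - κ + 2 * (N * κ) + κ ^ 2| ≤ 10 * r :=
        abs_le.2 ⟨by linarith [sq_nonneg κ], by linarith⟩
      calc |ξ| * |2 * (y - c) - κ + 2 * (N * κ) + κ ^ 2| ≤ 2 * N * (10 * r) := by gcongr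
        _ = 20 * (N * r) := by ring
        _ ≤ 1 := by rw [hNr]; norm_num
    · intro y hy
      have hy1 := hy.1
      have hy2 := hy.2
      rw [huone y (abs_le.2 ⟨by linarith, by linarith⟩),
        hvone (y - ξ) (abs_le.2 ⟨by linarith, by linarith⟩)]
      nlinarith [hv.nonneg y, hu.nonneg (y - ξ)]

end SKdV

theorem lemma2p1 (s₁ s₂ : ℝ) :
    ((∃ C : ℝ≥0, ∀ u₀ : 𝓢(ℝ, ℂ),
        SKdV.hsNorm s₁ (SKdV.duhamelS
          (fun t ↦ SKdV.mul (SKdV.absSq (SKdV.S t u₀)) (SKdV.S t u₀)) 1)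
          ≤ C * SKdV.hsNorm s₁ (u₀.toLp 2) ^ 3)
      ↔ 0 ≤ s₁) ∧
    ((∃ C : ℝ≥0, ∀ u₀ v₀ : 𝓢(ℝ, ℂ),
        SKdV.hsNorm s₁ (SKdV.duhamelS (fun t ↦ SKdV.mul (SKdV.S t u₀) (SKdV.K t v₀)) 1)
          ≤ C * (SKdV.hsNorm s₁ (u₀.toLp 2) * SKdV.hsNorm s₂ (v₀.toLp 2)))
      ↔ max (-1) (-3 + |s₁|) ≤ s₂) ∧
    ((∃ C : ℝ≥0, ∀ v₀ : 𝓢(ℝ, ℂ),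
        SKdV.hsNorm s₂ (SKdV.duhamelK (fun t ↦ SKdV.mul (SKdV.K t v₀) (SKdV.K t v₀)) 1)
          ≤ C * SKdV.hsNorm s₂ (v₀.toLp 2) ^ 2)
      ↔ -1 ≤ s₂) ∧
    ((∃ C : ℝ≥0, ∀ u₀ : 𝓢(ℝ, ℂ),
        SKdV.hsNorm s₂ (SKdV.duhamelK (fun t ↦ SKdV.absSq (SKdV.S t u₀)) 1)
          ≤ C * SKdV.hsNorm s₁ (u₀.toLp 2) ^ 2)
      ↔ -(1 / 2) ≤ s₁ ∧ s₂ ≤ min (4 * s₁) (s₁ + 2)) := by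
  refine ⟨(SKdV.cubic_bound_iff s₁).trans ⟨SKdV.cubic_necessary, SKdV.cubic_sufficient⟩,
    (SKdV.mixed_bound_iff s₁ s₂).trans ⟨fun h ↦ max_le (SKdV.mixed_necessary_neg_one h)
      (SKdV.mixed_necessary_abs h), SKdV.mixed_sufficient⟩,
    (SKdV.kdv_bound_iff s₂).trans ⟨SKdV.kdv_necessary, SKdV.kdv_sufficient⟩,
    (SKdV.density_bound_iff s₁ s₂).trans ⟨fun h ↦ ⟨SKdV.density_necessary_neg_half h,
      le_min (SKdV.density_necessary_four_mul h) (SKdV.density_necessary_add_two h)⟩,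
      fun h ↦ SKdV.density_sufficient h.1 h.2⟩⟩
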